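/- Let $D\subset\mathbb R^d$ be a nonempty convex open set (possibly unbounded), let $\Pi$ denote the nearest-point projection onto $\bar D$, and let $\mathbb D=\mathbb D(\mathbb R^+,\mathbb R^d)$ be the space of càdlàg functions $[0,\infty)\to\mathbb R^d$. For $k:[0,\infty)\to\mathbb R^d$ let $|k|_t$ denote its total variation on $[0,t]$ with respect to the Euclidean norm. For $v\in\partial D$ let $\mathcal N_v$ be the set of unit vectors $\mathbf n$ with $\langle z-v,\mathbf n\rangle\ge 0$ for all $z\in\bar D$. A pair $(x,k)\in\mathbb D\times\mathbb D$ solves the Skorokhod problem on $D$ associated with $y\in\mathbb D$ if $x_t=y_t+k_t$ and $x_t\in\bar D$ for all $t\ge0$, $k_0=0$, $k$ has locally bounded variation, and $$k_t=\int_0^t\mathbf n_s\,d|k|_s,\qquad |k|_t=\int_0^t\mathbf 1_{\{x_s\in\partial D\}}\,d|k|_s,\qquad t\ge0,$$ for some function $\mathbf n$ with $\mathbf n_s\in\mathcal N_{x_s}$ whenever $x_s\in\partial D$. The $S$ topology on $\mathbb D$ is Jakubowski's: it is the sequential topology whose closed sets are those closed under the following sequential convergence. Sequences converge, $x^n\to_S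 x$, if for every $\varepsilon>0$ there are càdlàg functions $v^n,v$ of locally bounded variation with $\sup_t|x^n_t-v^n_t|\le\varepsilon$ for all $n$, $\sup_t|x_t-v_t|\le\varepsilon$, and $\int_{[0,\infty)} f\,dv^n\to\int_{[0,\infty)} f\,dv$ for every continuous compactly supported $f:[0,\infty)\to\mathbb R$ (where $dv$ has mass $v_0$ at $0$, and similarly for $dv^n$). **Theorem.** For $n=0,1,2,\dots$ let $y^n\in\mathbb D$ with $y^n_0\in\bar D$, and let $x^n\in\mathbb D$ be the solution of the penalized equation $$x^n_t=y^n_t+k^n_t,\qquad k^n_t=-n\int_0^t\bigl(x^n_s-\Pi(x^n_s)\bigr)\,ds,\qquad t\ge 0 .$$ Assume that $y^n\to y\in\mathbb D$ in the Skorokhod topology $J_1$. Then: (i) for every $q\ge0$, $\ \sup_n\sup_{t\le q}|x^n_t|<\infty\ $ and $\ \sup_n|k^n|_q<\infty$. Moreover, the Skorokhod problem on $D$ associated with $y$ has exactly one solution $(x,k)$, and (ii) $x^n_t\to x_t$ for every $t\ge0$ at which $y$ is continuous; (iii) $x^n\to x$ in the $S$ topology. -/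

import Mathlib

open Set Filter Topology MeasureTheory
open scoped NNReal ENNReal CompactlySupported

/-- A function `x : [0, ∞) → E` is càdlàg: right-continuous with left limits in `E`. -/
def IsCadlag {E : Type*} [TopologicalSpace E] (x : ℝ≥0 → E) : Prop :=
  ∀ t : ℝ≥0, ContinuousWithinAt x (Ici t) t ∧ ∃ l : E, Tendsto x (𝓝[<] t) (𝓝 l)

/-- The Skorokhod space `𝔻(ℝ⁺, ℝᵈ)` of càdlàg functions with values in Euclidean space. -/
structure SkorokhodSpace (d : ℕ) where
  toFun : ℝ≥0 → EuclideanSpace ℝ (Fin d)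
  isCadlag' : IsCadlag toFun

instance (d : ℕ) : CoeFun (SkorokhodSpace d) (fun _ => ℝ≥0 → EuclideanSpace ℝ (Fin d)) :=
  ⟨SkorokhodSpace.toFun⟩

/-- Convergence of sequences in the Skorokhod topology `J₁` on `𝔻(ℝ⁺, ℝᵈ)`: there are increasing
bijections `lam n` of `[0, ∞)` with `sup_t |lam n t - t| → 0` and
`sup_{t ≤ q} |yₙ (lam n t) - y t| → 0` for every `q`. -/
def J1Tendsto {d : ℕ} (yn : ℕ → SkorokhodSpace d) (y : SkorokhodSpace d) : Prop :=
  ∃ lam : ℕ → (ℝ≥0 ≃o ℝ≥0),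
    TendstoUniformly (fun (n : ℕ) (t : ℝ≥0) => lam n t) (fun t => t) atTop ∧
    ∀ q : ℝ≥0, TendstoUniformlyOn (fun (n : ℕ) (t : ℝ≥0) => yn n (lam n t)) y atTop (Iic q)

/-- Nearest-point projection onto a set `K`. For `K` nonempty, closed and convex
the nearest point exists and is unique. -/
noncomputable def nearestPoint {d : ℕ} (K : Set (EuclideanSpace ℝ (Fin d)))
    (x : EuclideanSpace ℝ (Fin d)) : EuclideanSpace ℝ (Fin d) :=
  Classical.epsilon (fun p => p ∈ K ∧ dist x p = Metric.infDist x K)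

theorem nearestPoint_spec {d : ℕ} {K : Set (EuclideanSpace ℝ (Fin d))} (hK : IsClosed K)
    (hne : K.Nonempty) (x : EuclideanSpace ℝ (Fin d)) :
    nearestPoint K x ∈ K ∧ dist x (nearestPoint K x) = Metric.infDist x K := by
  obtain ⟨p, hp, hd⟩ := hK.exists_infDist_eq_dist hne x
  exact Classical.epsilon_spec (p := fun p => p ∈ K ∧ dist x p = Metric.infDist x K)
    ⟨p, hp, hd.symm⟩

/-- The penalization term `k_t = -n ∫₀ᵗ (x_s - Π(x_s)) ds`, with `Π` the projection onto the
closure of `D`. -/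
noncomputable def penaltyTerm {d : ℕ} (D : Set (EuclideanSpace ℝ (Fin d))) (n : ℕ)
    (x : ℝ≥0 → EuclideanSpace ℝ (Fin d)) (t : ℝ≥0) : EuclideanSpace ℝ (Fin d) :=
  -((n : ℝ) • ∫ s in (0 : ℝ)..(t : ℝ),
      (x s.toNNReal - nearestPoint (closure D) (x s.toNNReal)))

/-- `x` solves the penalized equation `x_t = y_t - n ∫₀ᵗ (x_s - Π(x_s)) ds`, `t ≥ 0`. -/
def IsPenalizedSolution {d : ℕ} (D : Set (EuclideanSpace ℝ (Fin d))) (n : ℕ)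
    (y x : SkorokhodSpace d) : Prop :=
  ∀ t : ℝ≥0, x t = y t + penaltyTerm D n x t

/-- Inward unit normal vectors to `D` at `x`. -/
def inwardUnitNormals {d : ℕ} (D : Set (EuclideanSpace ℝ (Fin d)))
    (x : EuclideanSpace ℝ (Fin d)) : Set (EuclideanSpace ℝ (Fin d)) :=
  {v | ‖v‖ = 1 ∧ ∀ z ∈ closure D, 0 ≤ inner ℝ (z - x) v}

/-- The (Euclidean) total variation `|k|_t` of `k` on `[0, t]`. -/
noncomputable def variationUpTo {d : ℕ} (k : ℝ≥0 → EuclideanSpace ℝ (Fin d)) (t : ℝ≥0) : ℝ≥0∞ :=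
  eVariationOn k (Icc 0 t)

/-- `μ` is the measure `d|k|` on `[0, ∞)` of a function `k` of locally bounded variation:
the locally finite measure with `μ [0, t] = |k|_t` for all `t`. -/
def IsVariationMeasure {d : ℕ} (k : ℝ≥0 → EuclideanSpace ℝ (Fin d)) (μ : Measure ℝ≥0) : Prop :=
  IsLocallyFiniteMeasure μ ∧ ∀ t : ℝ≥0, μ (Icc 0 t) = variationUpTo k t

/-- `(x, k)` solves the Skorokhod problem on `D` associated with `y`. -/
def IsSkorokhodSolution {d : ℕ} (D : Set (EuclideanSpace ℝ (Fin d)))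
    (y x k : SkorokhodSpace d) : Prop :=
  (∀ t, x t = y t + k t) ∧
  (∀ t, x t ∈ closure D) ∧
  LocallyBoundedVariationOn k univ ∧
  k 0 = 0 ∧
  ∃ (μ : Measure ℝ≥0) (normal : ℝ≥0 → EuclideanSpace ℝ (Fin d)),
    IsVariationMeasure k μ ∧
    AEStronglyMeasurable normal μ ∧
    (∀ s, x s ∈ frontier D → normal s ∈ inwardUnitNormals D (x s)) ∧
    (∀ t, IntegrableOn normal (Icc 0 t) μ ∧ k t = ∫ s in Icc 0 t, normal s ∂μ) ∧
    (∀ t, variationUpTo k t =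
      ∫⁻ s in Icc 0 t, indicator {s | x s ∈ frontier D} (fun _ => 1) s ∂μ)

/-- The càdlàg function `v : [0, ∞) → ℝ` of locally bounded variation corresponds to the signed
Radon measure `dv = μ - ν`, i.e. `v t = dv [0, t]` (so `dv` has mass `v 0` at `0`). -/
def IsStieltjesPair (v : ℝ≥0 → ℝ) (μ ν : Measure ℝ≥0) : Prop :=
  IsLocallyFiniteMeasure μ ∧ IsLocallyFiniteMeasure ν ∧
    ∀ t : ℝ≥0, v t = μ.real (Icc 0 t) - ν.real (Icc 0 t)

/-- Weak-* convergence of càdlàg functions of locally bounded variation: all `vn n` and `v` are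
such functions and `∫ f dvₙ → ∫ f dv` for every continuous compactly supported
`f : [0, ∞) → ℝ`. The integral does not depend on the representing pairs. -/
def WeakStarTendsto (vn : ℕ → ℝ≥0 → ℝ) (v : ℝ≥0 → ℝ) : Prop :=
  ∃ (μn νn : ℕ → Measure ℝ≥0) (μ ν : Measure ℝ≥0),
    (∀ n, IsStieltjesPair (vn n) (μn n) (νn n)) ∧ IsStieltjesPair v μ ν ∧
    ∀ f : C_c(ℝ≥0, ℝ),
      Tendsto (fun n => ∫ s, f s ∂(μn n) - ∫ s, f s ∂(νn n)) atTop
        (𝓝 (∫ s, f s ∂μ - ∫ s, f s ∂ν))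

/-- Jakubowski's convergence generating the `S` topology: for every `ε > 0` there are functions of
locally bounded variation, uniformly `ε`-close to `xₙ` and `x`, which converge weakly-*. -/
def SGeneratingTendsto {d : ℕ} (xn : ℕ → SkorokhodSpace d) (x : SkorokhodSpace d) : Prop :=
  ∀ ε : ℝ, 0 < ε → ∃ (vn : ℕ → ℝ≥0 → EuclideanSpace ℝ (Fin d))
      (v : ℝ≥0 → EuclideanSpace ℝ (Fin d)),
    (∀ n t, ‖xn n t - vn n t‖ ≤ ε) ∧ (∀ t, ‖x t - v t‖ ≤ ε) ∧
    ∀ i : Fin d, WeakStarTendsto (fun n t => vn n t i) (fun t => v t i)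

/-- Jakubowski's `S` topology on `𝔻(ℝ⁺, ℝᵈ)`: the sequential topology generated by
`SGeneratingTendsto` (a set is open iff every sequence converging in that sense to one of its
points is eventually in it; equivalently, closed sets are the sequentially closed ones). -/
@[reducible] def sTopology (d : ℕ) : TopologicalSpace (SkorokhodSpace d) where
  IsOpen U := ∀ (xn : ℕ → SkorokhodSpace d) (x : SkorokhodSpace d),
    SGeneratingTendsto xn x → x ∈ U → ∀ᶠ n in atTop, xn n ∈ U
  isOpen_univ := fun _ _ _ _ => Eventually.of_forall fun _ => mem_univ _
  isOpen_inter := fun _ _ hU hV xn x hx hm =>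
    (hU xn x hx hm.1).and (hV xn x hx hm.2)
  isOpen_sUnion := fun _ h xn x hx hm => by
    obtain ⟨U, hU, hxU⟩ := hm
    exact (h U hU xn x hx hxU).mono fun _ hn => ⟨U, hU, hn⟩

/-!
The reflected path and its penalized approximations are treated as instances of one scheme: a path
`x = y + k` with `k t = ∫_{[0,t]} g dμ` whose density points inwards, `⟨z - x s, g s⟩ ≥ 0` for all
`z ∈ K = closure D`. For the penalized equation `μ` is Lebesgue measure and `g = -n (x - Π x)`; for
piecewise constant `y` it is the counting measure of the grid, `g` being the projection jumps; in
general `μ = |dk|`.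

Two estimates carry the proof. *Variation*: `K` contains a ball `B(a, r)`, so `r |g| ≤ ⟨a - x, g⟩`.
With the energy inequality `|∫ g|² ≤ 2 ∫ ⟨∫_{[0,s]} g, g s⟩` this bounds `∫ |g| dμ` by
`|x_s - a|² / r` on a time block with left end `s` where `y` oscillates by at most `r / 2`; a jump
at the right end adds at most the distance to `a` before reflection. A càdlàg path has finitely many
such blocks in a bounded interval, and their number is stable under time changes and small uniform
perturbations, so the bound is uniform along a `J₁`-convergent sequence
(`IsCadlag.exists_variation_bound`).

*Comparison*: for two such paths driven by the same measure with `⟨x₁ - x₂, g₁ - g₂⟩ ≤ 0` and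
`|y₁ - y₂| ≤ δ`, the energy inequality gives `|x₁ - x₂|² ≤ δ² + 4 δ ∫ (|g₁| + |g₂|)`
(`norm_sub_sq_le_of_monotone`).

The comparison with `δ = 0` is uniqueness, both solutions being written with densities with respect
to the sum of their variation measures. For existence the Skorokhod problem is solved explicitly
for piecewise constant paths, and by comparison these step solutions are uniformly Cauchy on compact
intervals; the inward condition passes to the limit (`exists_skorokhodSolution`). For the pointwise
convergence `y` is replaced by a step path on a grid `T`, and `yn n` by the time-changed step path
on the grid `lam n (T j)`. The penalized equation with a step path is a chain of exponential
relaxations towards `K`, which tends to the reflected step path off the grid, and up to a jump of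
size `δ` at grid points where `y` is continuous (`eventually_norm_penalizedStep_sub_le`); both
replacements cost a small error by comparison. For the `S` topology, the step approximations of
`yn n` plus the penalization terms have locally uniformly bounded variations and converge at all
but countably many times, which forces weak-* convergence (`weakStarTendsto_of_dense`).
-/

/-! ### Nearest-point projection onto a closed convex set -/

theorem inner_sub_nearestPoint_le {d : ℕ} {K : Set (EuclideanSpace ℝ (Fin d))} (hK : IsClosed K)
    (hne : K.Nonempty) (hc : Convex ℝ K) (x : EuclideanSpace ℝ (Fin d))
    {z : EuclideanSpace ℝ (Fin d)} (hz : z ∈ K) :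
    inner ℝ (x - nearestPoint K x) (z - nearestPoint K x) ≤ 0 := by
  obtain ⟨hp, hd⟩ := nearestPoint_spec hK hne x
  refine (norm_eq_iInf_iff_real_inner_le_zero hc hp).1 ?_ z hz
  rw [← dist_eq_norm, hd, Metric.infDist_eq_iInf]
  simp only [dist_eq_norm]

theorem nearestPoint_eq_of_inner_le {d : ℕ} {K : Set (EuclideanSpace ℝ (Fin d))} (hK : IsClosed K)
    (hc : Convex ℝ K) {x p : EuclideanSpace ℝ (Fin d)} (hp : p ∈ K)
    (h : ∀ z ∈ K, inner ℝ (x - p) (z - p) ≤ 0) : nearestPoint K x = p := by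
  have hne : K.Nonempty := ⟨p, hp⟩
  have h1 := inner_sub_nearestPoint_le hK hne hc x hp
  have h2 := h _ (nearestPoint_spec hK hne x).1
  set q := nearestPoint K x
  have : inner ℝ (p - q) (p - q) ≤ 0 := by
    have e : inner ℝ (p - q) (p - q) = inner ℝ (x - q) (p - q) + inner ℝ (x - p) (q - p) := by
      simp only [inner_sub_left, inner_sub_right]; ring
    rw [e]; linarith
  rw [real_inner_self_eq_norm_sq] at this
  have h0 : ‖p - q‖ = 0 := by nlinarith [norm_nonneg (p - q)]
  exact (sub_eq_zero.1 (norm_eq_zero.1 h0)).symm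

theorem nearestPoint_of_mem {d : ℕ} {K : Set (EuclideanSpace ℝ (Fin d))} (hK : IsClosed K)
    (hc : Convex ℝ K) {x : EuclideanSpace ℝ (Fin d)} (hx : x ∈ K) : nearestPoint K x = x :=
  nearestPoint_eq_of_inner_le hK hc hx fun z _ => by simp

theorem norm_nearestPoint_sub_sq_le {d : ℕ} {K : Set (EuclideanSpace ℝ (Fin d))} (hK : IsClosed K)
    (hne : K.Nonempty) (hc : Convex ℝ K) (x x' : EuclideanSpace ℝ (Fin d)) :
    ‖nearestPoint K x - nearestPoint K x'‖ ^ 2 ≤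
      inner ℝ (x - x') (nearestPoint K x - nearestPoint K x') := by
  have h1 := inner_sub_nearestPoint_le hK hne hc x (nearestPoint_spec hK hne x').1
  have h2 := inner_sub_nearestPoint_le hK hne hc x' (nearestPoint_spec hK hne x).1
  rw [← real_inner_self_eq_norm_sq]
  set p := nearestPoint K x
  set p' := nearestPoint K x'
  have e : inner ℝ (x - x') (p - p') - inner ℝ (p - p') (p - p')
      = - (inner ℝ (x - p) (p' - p) + inner ℝ (x' - p') (p - p')) := by
    simp only [inner_sub_left, inner_sub_right]; ring
  linarith

theorem norm_nearestPoint_sub_le {d : ℕ} {K : Set (EuclideanSpace ℝ (Fin d))} (hK : IsClosed K)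
    (hne : K.Nonempty) (hc : Convex ℝ K) (x x' : EuclideanSpace ℝ (Fin d)) :
    ‖nearestPoint K x - nearestPoint K x'‖ ≤ ‖x - x'‖ := by
  have h := (norm_nearestPoint_sub_sq_le hK hne hc x x').trans (real_inner_le_norm _ _)
  by_contra! hlt
  nlinarith [norm_nonneg (x - x'), norm_nonneg (nearestPoint K x - nearestPoint K x')]

theorem continuous_nearestPoint {d : ℕ} {K : Set (EuclideanSpace ℝ (Fin d))} (hK : IsClosed K)
    (hne : K.Nonempty) (hc : Convex ℝ K) : Continuous (nearestPoint K) := by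
  refine (LipschitzWith.of_dist_le_mul (K := 1) fun x y => ?_).continuous
  rw [dist_eq_norm, dist_eq_norm, NNReal.coe_one, one_mul]
  exact norm_nearestPoint_sub_le hK hne hc x y

/-- The map `x ↦ x - Π x` is monotone. -/
theorem inner_sub_residual_nonneg {d : ℕ} {K : Set (EuclideanSpace ℝ (Fin d))} (hK : IsClosed K)
    (hne : K.Nonempty) (hc : Convex ℝ K) (x x' : EuclideanSpace ℝ (Fin d)) :
    0 ≤ inner ℝ (x - x') ((x - nearestPoint K x) - (x' - nearestPoint K x')) := by
  have h := norm_nearestPoint_sub_le hK hne hc x x'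
  have h2 := real_inner_le_norm (x - x') (nearestPoint K x - nearestPoint K x')
  have e : inner ℝ (x - x') ((x - nearestPoint K x) - (x' - nearestPoint K x'))
      = ‖x - x'‖ ^ 2 - inner ℝ (x - x') (nearestPoint K x - nearestPoint K x') := by
    rw [← real_inner_self_eq_norm_sq, ← inner_sub_right]; congr 1; abel
  rw [e]; nlinarith [norm_nonneg (x - x')]

theorem inner_sub_residual_le {d : ℕ} {K : Set (EuclideanSpace ℝ (Fin d))} (hK : IsClosed K)
    (hne : K.Nonempty) (hc : Convex ℝ K) (x : EuclideanSpace ℝ (Fin d))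
    {z : EuclideanSpace ℝ (Fin d)} (hz : z ∈ K) :
    inner ℝ (z - x) (x - nearestPoint K x) ≤ 0 := by
  have h := inner_sub_nearestPoint_le hK hne hc x hz
  have e : inner ℝ (z - x) (x - nearestPoint K x) =
      inner ℝ (x - nearestPoint K x) (z - nearestPoint K x)
        - inner ℝ (x - nearestPoint K x) (x - nearestPoint K x) := by
    rw [← inner_sub_right, real_inner_comm]; congr 1; abel
  rw [e]; linarith [real_inner_self_nonneg (x := x - nearestPoint K x)]

/-- The projection is constant on the segment from a point to its projection. -/
theorem nearestPoint_segment {d : ℕ} {K : Set (EuclideanSpace ℝ (Fin d))} (hK : IsClosed K)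
    (hne : K.Nonempty) (hc : Convex ℝ K) (x : EuclideanSpace ℝ (Fin d)) {θ : ℝ} (hθ : 0 ≤ θ) :
    nearestPoint K (nearestPoint K x + θ • (x - nearestPoint K x)) = nearestPoint K x := by
  refine nearestPoint_eq_of_inner_le hK hc (nearestPoint_spec hK hne x).1 fun z hz => ?_
  rw [add_sub_cancel_left, inner_smul_left]
  exact mul_nonpos_of_nonneg_of_nonpos (by simpa using hθ)
    (inner_sub_nearestPoint_le hK hne hc x hz)

/-- A ball inside `K` turns the variational inequality into a coercivity estimate. -/
theorem mul_norm_le_inner_of_closedBall {E : Type*} [NormedAddCommGroup E] [InnerProductSpace ℝ E]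
    {K : Set E} {a x g : E} {r : ℝ} (hr : 0 ≤ r)
    (hb : Metric.closedBall a r ⊆ K) (h : ∀ z ∈ K, 0 ≤ inner ℝ (z - x) g) :
    r * ‖g‖ ≤ inner ℝ (a - x) g := by
  rcases eq_or_ne g 0 with rfl | hg
  · simp
  have hg' : 0 < ‖g‖ := norm_pos_iff.2 hg
  have hz : a - (r / ‖g‖) • g ∈ K := by
    apply hb
    rw [Metric.mem_closedBall, dist_eq_norm, sub_sub_cancel_left, norm_neg, norm_smul,
      Real.norm_of_nonneg (by positivity)]
    field_simp; exact le_rfl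
  have h1 := h _ hz
  rw [show a - (r / ‖g‖) • g - x = (a - x) - (r / ‖g‖) • g by abel, inner_sub_left,
    real_inner_smul_left, real_inner_self_eq_norm_sq] at h1
  have e : r / ‖g‖ * ‖g‖ ^ 2 = r * ‖g‖ := by field_simp
  linarith

/-! ### The energy inequality -/

theorem setIntegral_Iic_restrict {E : Type*} [NormedAddCommGroup E] [NormedSpace ℝ E]
    (μ : Measure ℝ≥0) (g : ℝ≥0 → E) {s t u : ℝ≥0} (hu : u ≤ t) :
    ∫ v in Iic u, g v ∂(μ.restrict (Ioc s t)) = ∫ v in Ioc s u, g v ∂μ := by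
  rw [Measure.restrict_restrict measurableSet_Iic]
  congr 2
  ext v; simp only [mem_inter_iff, mem_Iic, mem_Ioc]
  exact ⟨fun h => ⟨h.2.1, h.1⟩, fun h => ⟨h.2, h.1, h.2.trans hu⟩⟩

theorem setIntegral_Iic_restrict_Icc {E : Type*} [NormedAddCommGroup E] [NormedSpace ℝ E]
    (μ : Measure ℝ≥0) (g : ℝ≥0 → E) {t u : ℝ≥0} (hu : u ≤ t) :
    ∫ v in Iic u, g v ∂(μ.restrict (Icc 0 t)) = ∫ v in Icc 0 u, g v ∂μ := by
  rw [Measure.restrict_restrict measurableSet_Iic]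
  congr 2
  ext v; simp only [mem_inter_iff, mem_Iic, mem_Icc]
  exact ⟨fun h => ⟨h.2.1, h.1⟩, fun h => ⟨h.2, h.1, h.2.trans hu⟩⟩

section Energy
variable {E : Type*} [NormedAddCommGroup E] [InnerProductSpace ℝ E]

theorem integrable_inner_prod {μ : Measure ℝ≥0} [SFinite μ] {g : ℝ≥0 → E} (hg : Integrable g μ) :
    Integrable (fun p : ℝ≥0 × ℝ≥0 => (inner ℝ (g p.1) (g p.2) : ℝ)) (μ.prod μ) :=
  Integrable.op_fst_snd (op := fun x y : E => (inner ℝ x y : ℝ))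
    (continuous_inner (𝕜 := ℝ) (E := E))
    ⟨1, fun x y => by simpa using norm_inner_le_norm (𝕜 := ℝ) x y⟩ hg hg

variable [CompleteSpace E]

theorem integral_indicator_inner_prod {μ : Measure ℝ≥0} {g : ℝ≥0 → E}
    (hg : Integrable g μ) (u : ℝ≥0) :
    ∫ v, {p : ℝ≥0 × ℝ≥0 | p.2 ≤ p.1}.indicator
        (fun p : ℝ≥0 × ℝ≥0 => (inner ℝ (g p.1) (g p.2) : ℝ)) (u, v) ∂μ =
      inner ℝ (∫ v in Iic u, g v ∂μ) (g u) := by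
  rw [real_inner_comm, ← integral_inner hg.integrableOn, ← integral_indicator measurableSet_Iic]
  rfl

theorem integrable_inner_setIntegral {μ : Measure ℝ≥0} [SFinite μ] {g : ℝ≥0 → E}
    (hg : Integrable g μ) :
    Integrable (fun u => (inner ℝ (∫ v in Iic u, g v ∂μ) (g u) : ℝ)) μ := by
  have hA : MeasurableSet {p : ℝ≥0 × ℝ≥0 | p.2 ≤ p.1} :=
    measurableSet_le measurable_snd measurable_fst
  have := ((integrable_inner_prod hg).indicator hA).integral_prod_left
  simpa only [integral_indicator_inner_prod hg] using this

/-- Energy inequality: if `h_u = ∫_{[0,u]} g dμ` then `|h_∞|² ≤ 2 ∫ ⟨h, dh⟩`. By Fubini the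
difference is the contribution of the diagonal, that is of the atoms of `μ`. -/
theorem norm_integral_sq_le {μ : Measure ℝ≥0} [SFinite μ] {g : ℝ≥0 → E} (hg : Integrable g μ) :
    ‖∫ u, g u ∂μ‖ ^ 2 ≤ 2 * ∫ u, inner ℝ (∫ v in Iic u, g v ∂μ) (g u) ∂μ := by
  set F : ℝ≥0 × ℝ≥0 → ℝ := fun p => inner ℝ (g p.1) (g p.2) with hF
  set A : Set (ℝ≥0 × ℝ≥0) := {p | p.2 ≤ p.1} with hAdef
  have hA : MeasurableSet A := measurableSet_le measurable_snd measurable_fst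
  set B : Set (ℝ≥0 × ℝ≥0) := {p | p.1 ≤ p.2} with hBdef
  have hB : MeasurableSet B := measurableSet_le measurable_fst measurable_snd
  have hFi : Integrable F (μ.prod μ) := integrable_inner_prod hg
  have h1 : ∫ p, A.indicator F p ∂(μ.prod μ)
      = ∫ u, inner ℝ (∫ v in Iic u, g v ∂μ) (g u) ∂μ := by
    rw [integral_prod _ (hFi.indicator hA)]
    exact integral_congr_ae (Eventually.of_forall fun u => integral_indicator_inner_prod hg u)
  have h2 : ∫ p, B.indicator F p ∂(μ.prod μ) = ∫ p, A.indicator F p ∂(μ.prod μ) := by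
    rw [← integral_prod_swap (A.indicator F)]
    refine integral_congr_ae (Eventually.of_forall fun p => ?_)
    simp only [indicator, hAdef, hBdef, mem_ofPred_eq, hF, Prod.fst_swap, Prod.snd_swap]
    rw [real_inner_comm]
  have h3 : ∫ p, F p ∂(μ.prod μ) = ‖∫ u, g u ∂μ‖ ^ 2 := by
    rw [integral_prod _ hFi, ← real_inner_self_eq_norm_sq, ← integral_inner hg]
    refine integral_congr_ae (Eventually.of_forall fun u => ?_)
    simp only [hF]
    rw [integral_inner hg, real_inner_comm]
  have h4 : ∫ p, F p ∂(μ.prod μ) ≤ ∫ p, (A.indicator F p + B.indicator F p) ∂(μ.prod μ) := by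
    refine integral_mono hFi ((hFi.indicator hA).add (hFi.indicator hB)) fun p => ?_
    by_cases h : p.2 ≤ p.1 <;> by_cases h' : p.1 ≤ p.2
    · have e : p.1 = p.2 := le_antisymm h' h
      have : 0 ≤ F p := by simp only [hF, e]; exact real_inner_self_nonneg
      simp only [indicator, hAdef, hBdef, mem_ofPred_eq, h, h', if_true]; linarith
    · simp [indicator, hAdef, hBdef, h, h']
    · simp [indicator, hAdef, hBdef, h, h']
    · exact absurd (le_total p.1 p.2) (by tauto)
  rw [integral_add (hFi.indicator hA) (hFi.indicator hB), h2, h1, h3] at h4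
  linarith

/-- If `⟨h_u, g_u⟩` is dominated by an integrable `φ` on `(s, t]`, where `h` is the primitive of `g`
started at `s`, then `|h_t|² ≤ 2 ∫ φ`. -/
theorem norm_setIntegral_Ioc_sq_le {μ : Measure ℝ≥0} [SFinite μ] {g : ℝ≥0 → E} {s t : ℝ≥0}
    (hg : IntegrableOn g (Ioc s t) μ) {φ : ℝ≥0 → ℝ} (hφ : IntegrableOn φ (Ioc s t) μ)
    (h : ∀ᵐ u ∂μ.restrict (Ioc s t), inner ℝ (∫ v in Ioc s u, g v ∂μ) (g u) ≤ φ u) :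
    ‖∫ u in Ioc s t, g u ∂μ‖ ^ 2 ≤ 2 * ∫ u in Ioc s t, φ u ∂μ := by
  refine (norm_integral_sq_le hg).trans ?_
  gcongr 2 * ?_
  refine integral_mono_ae (integrable_inner_setIntegral hg) hφ ?_
  filter_upwards [h, ae_restrict_mem measurableSet_Ioc] with u hu hu'
  rwa [setIntegral_Iic_restrict μ g hu'.2]

theorem norm_setIntegral_Icc_sq_le {μ : Measure ℝ≥0} [SFinite μ] {g : ℝ≥0 → E} {t : ℝ≥0}
    (hg : IntegrableOn g (Icc 0 t) μ) {φ : ℝ≥0 → ℝ} (hφ : IntegrableOn φ (Icc 0 t) μ)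
    (h : ∀ᵐ u ∂μ.restrict (Icc 0 t), inner ℝ (∫ v in Icc 0 u, g v ∂μ) (g u) ≤ φ u) :
    ‖∫ u in Icc 0 t, g u ∂μ‖ ^ 2 ≤ 2 * ∫ u in Icc 0 t, φ u ∂μ := by
  refine (norm_integral_sq_le hg).trans ?_
  gcongr 2 * ?_
  refine integral_mono_ae (integrable_inner_setIntegral hg) hφ ?_
  filter_upwards [h, ae_restrict_mem measurableSet_Icc] with u hu hu'
  rwa [setIntegral_Iic_restrict_Icc μ g hu'.2]

/-- Comparison of two solutions driven by uniformly close paths. The reflection terms are written as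
densities with respect to one common measure; the monotonicity `hm` leaves, in the energy
inequality, only the contribution of `y₁ - y₂`. -/
theorem norm_sub_sq_le_of_monotone {μ : Measure ℝ≥0} [SFinite μ] {q : ℝ≥0} {δ : ℝ}
    {x₁ x₂ y₁ y₂ g₁ g₂ : ℝ≥0 → E}
    (hg₁ : IntegrableOn g₁ (Icc 0 q) μ) (hg₂ : IntegrableOn g₂ (Icc 0 q) μ)
    (h₁ : ∀ t ≤ q, x₁ t = y₁ t + ∫ s in Icc 0 t, g₁ s ∂μ)
    (h₂ : ∀ t ≤ q, x₂ t = y₂ t + ∫ s in Icc 0 t, g₂ s ∂μ)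
    (hm : ∀ᵐ s ∂μ.restrict (Icc 0 q), inner ℝ (x₁ s - x₂ s) (g₁ s - g₂ s) ≤ 0)
    (hy : ∀ t ≤ q, ‖y₁ t - y₂ t‖ ≤ δ) {t : ℝ≥0} (ht : t ≤ q) :
    ‖x₁ t - x₂ t‖ ^ 2 ≤
      δ ^ 2 + 4 * δ * ((∫ s in Icc 0 q, ‖g₁ s‖ ∂μ) + ∫ s in Icc 0 q, ‖g₂ s‖ ∂μ) := by
  have hsub : Icc 0 t ⊆ Icc 0 q := Icc_subset_Icc_right ht
  have hδ : 0 ≤ δ := (norm_nonneg _).trans (hy t ht)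
  have hgt₁ := hg₁.mono_set hsub
  have hgt₂ := hg₂.mono_set hsub
  set V := (∫ s in Icc 0 q, ‖g₁ s‖ ∂μ) + ∫ s in Icc 0 q, ‖g₂ s‖ ∂μ with hV
  have hφ : IntegrableOn (fun s => δ * (‖g₁ s‖ + ‖g₂ s‖)) (Icc 0 t) μ :=
    (hgt₁.norm.add hgt₂.norm).const_mul δ
  have hint : ∀ u ≤ q, x₁ u - x₂ u - (y₁ u - y₂ u) = ∫ v in Icc 0 u, (g₁ - g₂) v ∂μ := by
    intro u hu
    rw [h₁ u hu, h₂ u hu]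
    simp only [Pi.sub_apply]
    rw [integral_sub (hg₁.mono_set (Icc_subset_Icc_right hu))
      (hg₂.mono_set (Icc_subset_Icc_right hu))]
    abel
  have hVt : ∫ s in Icc 0 t, (‖g₁ s‖ + ‖g₂ s‖) ∂μ ≤ V := by
    rw [hV, ← integral_add hg₁.norm hg₂.norm]
    exact setIntegral_mono_set (hg₁.norm.add hg₂.norm)
      (Eventually.of_forall fun s => by positivity) (Eventually.of_forall hsub)
  have key := norm_setIntegral_Icc_sq_le (μ := μ) (g := g₁ - g₂) (hgt₁.sub hgt₂) hφ (by
    filter_upwards [ae_restrict_of_ae_restrict_of_subset hsub hm,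
      ae_restrict_mem measurableSet_Icc] with u hu hu'
    have huq : u ≤ q := hu'.2.trans ht
    rw [← hint u huq, inner_sub_left, Pi.sub_apply]
    have c1 := abs_real_inner_le_norm (y₁ u - y₂ u) (g₁ u - g₂ u)
    have c2 := norm_sub_le (g₁ u) (g₂ u)
    have c3 : ‖y₁ u - y₂ u‖ * ‖g₁ u - g₂ u‖ ≤ δ * (‖g₁ u‖ + ‖g₂ u‖) :=
      mul_le_mul (hy u huq) c2 (norm_nonneg _) hδ
    have := neg_abs_le (inner ℝ (y₁ u - y₂ u) (g₁ u - g₂ u))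
    linarith)
  rw [integral_const_mul] at key
  have hm0 : ‖∫ u in Icc 0 t, (g₁ - g₂) u ∂μ‖ ≤ V :=
    (norm_integral_le_integral_norm _).trans (le_trans (integral_mono_of_nonneg
      (Eventually.of_forall fun _ => norm_nonneg _) (hgt₁.norm.add hgt₂.norm)
      (Eventually.of_forall fun s => norm_sub_le _ _)) hVt)
  set m := ∫ u in Icc 0 t, (g₁ - g₂) u ∂μ with hmdef
  have e : x₁ t - x₂ t = (y₁ t - y₂ t) + m := by rw [hmdef, ← hint t ht]; abel
  rw [e, norm_add_sq_real]
  have c1 := real_inner_le_norm (y₁ t - y₂ t) m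
  have c2 : ‖y₁ t - y₂ t‖ * ‖m‖ ≤ δ * V := mul_le_mul (hy t ht) hm0 (norm_nonneg _) hδ
  have c3 : ‖y₁ t - y₂ t‖ ^ 2 ≤ δ ^ 2 := pow_le_pow_left₀ (norm_nonneg _) (hy t ht) 2
  have c4 : δ * ∫ s in Icc 0 t, (‖g₁ s‖ + ‖g₂ s‖) ∂μ ≤ δ * V := by gcongr
  linarith

/-! ### Variation estimates -/

/-- Variation over a block on which `y` oscillates by at most `r / 2`. The energy inequality is
applied to the primitive of `g` started at `s`, which equals `(a - x s) - (a - x u) - (y u - y s)`: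
the coercivity `r ‖g‖ ≤ ⟨a - x u, g⟩` absorbs the oscillation of `y`. -/
theorem integral_norm_Ioc_le {μ : Measure ℝ≥0} [SFinite μ] {K : Set E} {a : E} {r : ℝ}
    (hr : 0 < r) (hb : Metric.closedBall a r ⊆ K) {s t : ℝ≥0} {x y g : ℝ≥0 → E}
    (hg : IntegrableOn g (Ioc s t) μ)
    (hx : ∀ u ∈ Ioc s t, x u - x s = y u - y s + ∫ v in Ioc s u, g v ∂μ)
    (hn : ∀ u ∈ Ioc s t, ∀ z ∈ K, 0 ≤ inner ℝ (z - x u) (g u))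
    (hy : ∀ u ∈ Ioc s t, ‖y u - y s‖ ≤ r / 2) :
    ∫ u in Ioc s t, ‖g u‖ ∂μ ≤ ‖x s - a‖ ^ 2 / r := by
  have hin : IntegrableOn (fun u => (inner ℝ (a - x s) (g u) : ℝ)) (Ioc s t) μ :=
    hg.const_inner (a - x s)
  have hφ : IntegrableOn (fun u => -(r / 2) * ‖g u‖ + inner ℝ (a - x s) (g u)) (Ioc s t) μ :=
    (hg.norm.const_mul _).add hin
  have key := norm_setIntegral_Ioc_sq_le hg hφ (by
    filter_upwards [ae_restrict_mem measurableSet_Ioc] with u hu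
    have c1 := mul_norm_le_inner_of_closedBall hr.le hb (hn u hu)
    have c2 := abs_real_inner_le_norm (y u - y s) (g u)
    have c3 : ‖y u - y s‖ * ‖g u‖ ≤ r / 2 * ‖g u‖ := by gcongr; exact hy u hu
    have c4 := neg_abs_le (inner ℝ (y u - y s) (g u))
    have e : ∫ v in Ioc s u, g v ∂μ = (a - x s) - (a - x u) - (y u - y s) := by
      rw [show (a - x s) - (a - x u) = x u - x s by abel, hx u hu]; abel
    rw [e, inner_sub_left, inner_sub_left]
    linarith)
  rw [integral_add (hg.norm.const_mul _) hin, integral_const_mul, integral_inner hg] at key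
  set h := ∫ u in Ioc s t, g u ∂μ
  have c1 := real_inner_le_norm (a - x s) h
  rw [norm_sub_rev] at c1
  rw [le_div_iff₀ hr]
  nlinarith [sq_nonneg (‖x s - a‖ - ‖h‖)]

end Energy

section VariationBound
variable {E : Type*} [NormedAddCommGroup E] [InnerProductSpace ℝ E] [CompleteSpace E]

theorem setIntegral_Ioo_le_of_Ioc {μ : Measure ℝ≥0} {f : ℝ≥0 → ℝ} {s t : ℝ≥0} {C : ℝ}
    (hst : s < t) (hf : IntegrableOn f (Ioo s t) μ)
    (h : ∀ u ∈ Ioo s t, ∫ v in Ioc s u, f v ∂μ ≤ C) : ∫ v in Ioo s t, f v ∂μ ≤ C := by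
  obtain ⟨u, hu, hu', hlim⟩ := exists_seq_strictMono_tendsto' hst
  have hU : ⋃ n, Ioc s (u n) = Ioo s t := by
    ext v
    simp only [mem_iUnion, mem_Ioc, mem_Ioo]
    constructor
    · rintro ⟨n, h1, h2⟩; exact ⟨h1, h2.trans_lt (hu' n).2⟩
    · rintro ⟨h1, h2⟩
      obtain ⟨n, hn⟩ := (hlim.eventually (lt_mem_nhds h2)).exists
      exact ⟨n, h1, hn.le⟩
  have := tendsto_setIntegral_of_monotone (μ := μ) (f := f) (s := fun n => Ioc s (u n))
    (fun n => measurableSet_Ioc) (fun m n hmn => Ioc_subset_Ioc_right (hu.monotone hmn))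
    (by rwa [hU])
  rw [hU] at this
  exact le_of_tendsto' this fun n => h _ (hu' n)

/-- The variation produced on a block `(s, t]` at whose right end the driving path may jump. The
reflection `κ` at time `t` is at most the distance from `a` to the position just before it. -/
theorem integral_norm_Icc_block_le {μ : Measure ℝ≥0} [SFinite μ] {K : Set E} {a : E} {r B M C : ℝ}
    (hr : 0 < r) (hb : Metric.closedBall a r ⊆ K) {s t : ℝ≥0} (hst : s < t) {x y g : ℝ≥0 → E}
    (hg : IntegrableOn g (Icc 0 t) μ)
    (hx : ∀ u ≤ t, x u = y u + ∫ v in Icc 0 u, g v ∂μ)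
    (hn : ∀ u ≤ t, ∀ z ∈ K, 0 ≤ inner ℝ (z - x u) (g u))
    (hy : ∀ u ∈ Ioo s t, ‖y u - y s‖ ≤ r / 2) (hM : ‖y t - y s‖ ≤ M) (hB : ‖x s - a‖ ≤ B)
    (hC : ∫ v in Icc 0 s, ‖g v‖ ∂μ ≤ C) :
    ∫ v in Icc 0 t, ‖g v‖ ∂μ ≤ C + B ^ 2 / r + (B + M + B ^ 2 / r) := by
  have hsplit : ∀ u, s ≤ u → Icc 0 u = Icc 0 s ∪ Ioc s u := fun u hu =>
    (Icc_union_Ioc_eq_Icc zero_le hu).symm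
  have hdisj : ∀ u, Disjoint (Icc 0 s) (Ioc s u) := fun u =>
    Set.disjoint_left.2 fun v hv hv' => hv.2.not_gt hv'.1
  have hIoc : ∀ u, u ≤ t → IntegrableOn g (Ioc s u) μ := fun u hu =>
    hg.mono_set fun v hv => ⟨zero_le, hv.2.trans hu⟩
  have hIoo : IntegrableOn g (Ioo s t) μ := (hIoc t le_rfl).mono_set Ioo_subset_Ioc_self
  have hopen : ∫ v in Ioo s t, ‖g v‖ ∂μ ≤ B ^ 2 / r := by
    refine setIntegral_Ioo_le_of_Ioc hst hIoo.norm fun u hu => ?_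
    refine (integral_norm_Ioc_le hr hb (x := x) (y := y) (hIoc u hu.2.le) (fun v hv => ?_)
      (fun v hv => hn v (hv.2.trans hu.2.le))
      (fun v hv => hy v ⟨hv.1, hv.2.trans_lt hu.2⟩)).trans ?_
    · have hvt := hv.2.trans hu.2.le
      rw [hx v hvt, hx s hst.le, hsplit v hv.1.le, setIntegral_union (hdisj v) measurableSet_Ioc
        (hg.mono_set (Icc_subset_Icc_right hst.le)) (hIoc v hvt)]
      abel
    · gcongr
  have hIoc_eq : Ioc s t = Ioo s t ∪ {t} := (Ioo_union_right hst).symm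
  have hd2 : Disjoint (Ioo s t) {t} := by simp
  have hsing : IntegrableOn g {t} μ := hg.mono_set (by simp)
  set κ : E := ∫ v in ({t} : Set ℝ≥0), g v ∂μ with hκ
  have hκ' : κ = μ.real {t} • g t := by rw [hκ, integral_singleton]
  have hκn : ∫ v in ({t} : Set ℝ≥0), ‖g v‖ ∂μ = ‖κ‖ := by
    rw [integral_singleton, hκ', norm_smul, Real.norm_of_nonneg measureReal_nonneg, smul_eq_mul]
  -- the position just before the reflection at time `t`
  have hw : x t - κ - a = (x s - a) + (y t - y s) + ∫ v in Ioo s t, g v ∂μ := by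
    rw [hx t le_rfl, hx s hst.le, hsplit t hst.le, setIntegral_union (hdisj t) measurableSet_Ioc
        (hg.mono_set (Icc_subset_Icc_right hst.le)) (hIoc t le_rfl), hIoc_eq,
        setIntegral_union hd2 (measurableSet_singleton t) hIoo hsing]
    abel
  have hwn : ‖x t - κ - a‖ ≤ B + M + B ^ 2 / r := by
    rw [hw]
    exact norm_add₃_le.trans (add_le_add (add_le_add hB hM)
      ((norm_integral_le_integral_norm _).trans hopen))
  have hr0 : a ∈ K := hb (Metric.mem_closedBall_self hr.le)
  have hκle : ‖κ‖ ≤ ‖x t - κ - a‖ := by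
    have h0 : 0 ≤ inner ℝ (a - x t) κ := by
      rw [hκ', inner_smul_right]
      exact mul_nonneg measureReal_nonneg (hn t le_rfl a hr0)
    have e : inner ℝ (a - x t) κ = - inner ℝ (x t - κ - a) κ - ‖κ‖ ^ 2 := by
      rw [← real_inner_self_eq_norm_sq, ← inner_neg_left, ← inner_sub_left]; congr 1; abel
    have c := neg_le_of_abs_le (abs_real_inner_le_norm (x t - κ - a) κ)
    rcases eq_or_lt_of_le (norm_nonneg κ) with h | h
    · rw [← h]; exact norm_nonneg _
    · nlinarith
  rw [hsplit t hst.le, setIntegral_union (hdisj t) measurableSet_Ioc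
    (hg.mono_set (Icc_subset_Icc_right hst.le)).norm (hIoc t le_rfl).norm, hIoc_eq,
    setIntegral_union hd2 (measurableSet_singleton t) hIoo.norm hsing.norm, hκn]
  linarith

/-- A bound on the variation over finitely many blocks, on each of which `y` oscillates by at most
`r / 2`. It depends neither on the blocks nor on the driving measure. -/
theorem exists_integral_norm_le (K : Set E) (a : E) {r : ℝ} (hr : 0 < r)
    (hb : Metric.closedBall a r ⊆ K) (M A : ℝ) (N : ℕ) :
    ∃ C : ℝ, ∀ (μ : Measure ℝ≥0) [SFinite μ] (x y g : ℝ≥0 → E) (S : ℕ → ℝ≥0),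
      S 0 = 0 → StrictMono S → IntegrableOn g (Icc 0 (S N)) μ →
      (∀ u ≤ S N, x u = y u + ∫ v in Icc 0 u, g v ∂μ) →
      (∀ u ≤ S N, ∀ z ∈ K, 0 ≤ inner ℝ (z - x u) (g u)) →
      x 0 = y 0 → ‖x 0 - a‖ ≤ A → (∀ u ≤ S N, ∀ v ≤ S N, ‖y u - y v‖ ≤ M) →
      (∀ i < N, ∀ u ∈ Ico (S i) (S (i + 1)), ‖y u - y (S i)‖ ≤ r / 2) →
      ∫ v in Icc 0 (S N), ‖g v‖ ∂μ ≤ C := by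
  induction N with
  | zero =>
    refine ⟨0, fun μ _ x y g S h0 hS hg hx hn hx0 hA hM hy => ?_⟩
    have h1 := hx 0 zero_le
    rw [hx0, Icc_self, integral_singleton] at h1
    have h2 : μ.real {0} • g 0 = 0 := by simpa using h1
    rw [h0, Icc_self, integral_singleton]
    have h3 : ‖μ.real {0} • g 0‖ = 0 := by rw [h2, norm_zero]
    rw [norm_smul, Real.norm_of_nonneg measureReal_nonneg] at h3
    exact h3.le
  | succ N ih =>
    obtain ⟨C, hC⟩ := ih
    refine ⟨C + (A + M + C) ^ 2 / r + ((A + M + C) + M + (A + M + C) ^ 2 / r),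
      fun μ _ x y g S h0 hS hg hx hn hx0 hA hM hy => ?_⟩
    have hlt : S N < S (N + 1) := hS (Nat.lt_succ_self N)
    have hgN := hg.mono_set (Icc_subset_Icc_right hlt.le)
    have hCN := hC μ x y g S h0 hS hgN
      (fun u hu => hx u (hu.trans hlt.le)) (fun u hu => hn u (hu.trans hlt.le)) hx0 hA
      (fun u hu v hv => hM u (hu.trans hlt.le) v (hv.trans hlt.le))
      (fun i hi => hy i (hi.trans (Nat.lt_succ_self N)))
    refine integral_norm_Icc_block_le hr hb hlt hg hx hn
      (fun u hu => hy N (Nat.lt_succ_self N) u ⟨hu.1.le, hu.2⟩)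
      (hM _ le_rfl _ hlt.le) ?_ hCN
    have e : x (S N) - a = (x 0 - a) + (y (S N) - y 0) + ∫ v in Icc 0 (S N), g v ∂μ := by
      rw [hx _ hlt.le, hx0]; abel
    rw [e]
    exact norm_add₃_le.trans (add_le_add (add_le_add hA (hM _ hlt.le _ zero_le))
      ((norm_integral_le_integral_norm _).trans hCN))

end VariationBound

/-! ### Grids and piecewise constant approximation of càdlàg functions -/

/-- A partition of `[0, ∞)` into the intervals `[T j, T (j + 1))`. -/
structure IsGrid (T : ℕ → ℝ≥0) : Prop where
  zero : T 0 = 0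
  strictMono : StrictMono T
  tendsto : Tendsto T atTop atTop

/-- The index `j` with `t ∈ [T j, T (j + 1))`, for a grid `T`. -/
noncomputable def gridIndex (T : ℕ → ℝ≥0) (t : ℝ≥0) : ℕ := sInf {j | t < T (j + 1)}

namespace IsGrid
variable {T : ℕ → ℝ≥0}

theorem lt_succ (hT : IsGrid T) (t : ℝ≥0) : t < T (gridIndex T t + 1) := by
  have hne : {j | t < T (j + 1)}.Nonempty := by
    obtain ⟨j, hj⟩ := (hT.tendsto.eventually_gt_atTop t).exists
    exact ⟨j, hj.trans (hT.strictMono (Nat.lt_succ_self j))⟩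
  exact Nat.sInf_mem hne

theorem index_le (hT : IsGrid T) (t : ℝ≥0) : T (gridIndex T t) ≤ t := by
  rcases Nat.eq_zero_or_pos (gridIndex T t) with h | h
  · rw [h, hT.zero]; exact zero_le
  · obtain ⟨j, hj⟩ := Nat.exists_eq_succ_of_ne_zero h.ne'
    have : j ∉ {j | t < T (j + 1)} := Nat.notMem_of_lt_sInf (by
      change j < gridIndex T t; omega)
    rw [hj]; exact not_lt.1 this

theorem index_eq (hT : IsGrid T) {j : ℕ} {t : ℝ≥0} (h1 : T j ≤ t) (h2 : t < T (j + 1)) :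
    gridIndex T t = j := by
  have a1 := hT.strictMono.lt_iff_lt.1 ((hT.index_le t).trans_lt h2)
  have a2 := hT.strictMono.lt_iff_lt.1 (h1.trans_lt (hT.lt_succ t))
  omega

theorem index_self (hT : IsGrid T) (j : ℕ) : gridIndex T (T j) = j :=
  hT.index_eq le_rfl (hT.strictMono (Nat.lt_succ_self j))

theorem index_zero (hT : IsGrid T) : gridIndex T 0 = 0 := by
  have := hT.index_self 0
  rwa [hT.zero] at this

theorem monotone_index (hT : IsGrid T) : Monotone (gridIndex T) := by
  intro s t hst
  have := hT.strictMono.lt_iff_lt.1 (((hT.index_le s).trans hst).trans_lt (hT.lt_succ t))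
  omega

theorem eventually_index_eq (hT : IsGrid T) (t : ℝ≥0) :
    ∀ᶠ s in 𝓝[≥] t, gridIndex T s = gridIndex T t := by
  filter_upwards [self_mem_nhdsWithin, mem_nhdsWithin_of_mem_nhds (gt_mem_nhds (hT.lt_succ t))]
    with s hs hs'
  exact hT.index_eq ((hT.index_le t).trans hs) hs'

theorem le_iff (hT : IsGrid T) {j : ℕ} {t : ℝ≥0} : T j ≤ t ↔ j ≤ gridIndex T t := by
  constructor
  · intro h
    have := hT.strictMono.lt_iff_lt.1 (h.trans_lt (hT.lt_succ t))
    omega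
  · exact fun h => (hT.strictMono.monotone h).trans (hT.index_le t)

theorem measurable_index (hT : IsGrid T) : Measurable (gridIndex T) :=
  hT.monotone_index.measurable

/-- The image of a grid under a time change. -/
theorem comp_orderIso (hT : IsGrid T) (lam : ℝ≥0 ≃o ℝ≥0) : IsGrid (fun j => lam (T j)) where
  zero := by rw [hT.zero]; exact lam.map_bot
  strictMono := lam.strictMono.comp hT.strictMono
  tendsto := lam.tendsto_atTop.comp hT.tendsto

theorem index_comp_orderIso (hT : IsGrid T) (lam : ℝ≥0 ≃o ℝ≥0) (t : ℝ≥0) :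
    gridIndex (fun j => lam (T j)) (lam t) = gridIndex T t :=
  (hT.comp_orderIso lam).index_eq (lam.monotone (hT.index_le t)) (lam.strictMono (hT.lt_succ t))

end IsGrid

section Cadlag
variable {E : Type*} [PseudoMetricSpace E]

/-- The point `t` is maximal (up to distance `1`) such that `y` oscillates by at most `δ` on
`[s, t)`; maximality prevents the iterates from accumulating where `y` has a left limit. -/
theorem exists_next_grid_point {y : ℝ≥0 → E} (hy : IsCadlag y) {δ : ℝ} (hδ : 0 < δ) (s : ℝ≥0) :
    ∃ t, s < t ∧ (∀ u ∈ Ico s t, dist (y u) (y s) ≤ δ) ∧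
      ∀ t' ≤ s + 1, (∀ u ∈ Ico s t', dist (y u) (y s) ≤ δ) → t' ≤ t := by
  set R : Set ℝ≥0 := {t | t ≤ s + 1 ∧ ∀ u ∈ Ico s t, dist (y u) (y s) ≤ δ} with hR
  have hbdd : BddAbove R := ⟨s + 1, fun t ht => ht.1⟩
  have h1 : ∃ t ∈ R, s < t := by
    have hc := (hy s).1
    have : ∀ᶠ u in 𝓝[≥] s, dist (y u) (y s) < δ :=
      hc.eventually (Metric.ball_mem_nhds (y s) hδ)
    obtain ⟨t, ht, hts⟩ := (mem_nhdsGE_iff_exists_Ico_subset' (show s < s + 1 by simp)).1 this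
    refine ⟨min t (s + 1), ⟨min_le_right _ _, fun u hu => ?_⟩, lt_min ht (by simp)⟩
    have := hts (show u ∈ Ico s t from ⟨hu.1, hu.2.trans_le (min_le_left _ _)⟩)
    exact (show dist (y u) (y s) < δ from this).le
  obtain ⟨t0, ht0, hst0⟩ := h1
  refine ⟨sSup R, hst0.trans_le (le_csSup hbdd ht0), fun u hu => ?_, fun t' h1 h2 =>
    le_csSup hbdd ⟨h1, h2⟩⟩
  obtain ⟨t, ht, hut⟩ := exists_lt_of_lt_csSup ⟨t0, ht0⟩ hu.2
  exact ht.2 u ⟨hu.1, hut⟩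

/-- A càdlàg function oscillates by at most `δ` on each interval of a suitable grid. -/
theorem IsCadlag.exists_grid {y : ℝ≥0 → E} (hy : IsCadlag y) {δ : ℝ} (hδ : 0 < δ) :
    ∃ T : ℕ → ℝ≥0, IsGrid T ∧ ∀ t, dist (y t) (y (T (gridIndex T t))) ≤ δ := by
  choose next h1 h2 h3 using exists_next_grid_point hy hδ
  set T : ℕ → ℝ≥0 := fun j => next^[j] 0 with hTdef
  have hsucc : ∀ j, T (j + 1) = next (T j) := fun j => Function.iterate_succ_apply' _ _ _
  have hmono : StrictMono T := strictMono_nat_of_lt_succ fun j => by rw [hsucc]; exact h1 _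
  have htend : Tendsto T atTop atTop := by
    refine (tendsto_atTop_of_monotone hmono.monotone).resolve_right ?_
    rintro ⟨τ, hτ⟩
    have hle : ∀ j, T j < τ := fun j =>
      (hmono (Nat.lt_succ_self j)).trans_le (hmono.monotone.ge_of_tendsto hτ (j + 1))
    obtain ⟨l, hl⟩ := (hy τ).2
    have hev : ∀ᶠ u in 𝓝[<] τ, dist (y u) l < δ / 2 :=
      hl.eventually (Metric.ball_mem_nhds l (half_pos hδ))
    obtain ⟨c, hc, hcs⟩ := (mem_nhdsLT_iff_exists_Ioo_subset' (show T 0 < τ from hle 0)).1 hev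
    have e1 : ∀ᶠ j in atTop, c < T j := hτ.eventually (lt_mem_nhds hc)
    have e2 : ∀ᶠ j in atTop, τ < T j + 1 := by
      have : Tendsto (fun j => T j + 1) atTop (𝓝 (τ + 1)) := hτ.add tendsto_const_nhds
      exact this.eventually (lt_mem_nhds (by simp))
    obtain ⟨j, hj1, hj2⟩ := (e1.and e2).exists
    have hd : ∀ u ∈ Ico (T j) τ, dist (y u) l < δ / 2 := fun u hu => hcs ⟨hj1.trans_le hu.1, hu.2⟩
    have := h3 (T j) τ hj2.le fun u hu => by
      have a := hd u hu
      have b := hd (T j) ⟨le_rfl, hle j⟩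
      rw [dist_comm] at b
      linarith [dist_triangle (y u) l (y (T j))]
    rw [← hsucc] at this
    exact absurd (hle (j + 1)) this.not_gt
  have hG : IsGrid T := ⟨rfl, hmono, htend⟩
  refine ⟨T, hG, fun t => h2 _ _ ⟨hG.index_le t, ?_⟩⟩
  rw [← hsucc]; exact hG.lt_succ t

theorem IsCadlag.measurable [MeasurableSpace E] [BorelSpace E] {y : ℝ≥0 → E} (hy : IsCadlag y) :
    Measurable y := by
  choose T hT h using fun m : ℕ => hy.exists_grid (Nat.one_div_pos_of_nat (α := ℝ) (n := m))
  refine measurable_of_tendsto_metrizable' (f := fun m t => y (T m (gridIndex (T m) t))) atTop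
    (fun m => (measurable_from_nat (f := fun j => y (T m j))).comp (hT m).measurable_index) ?_
  rw [tendsto_pi_nhds]
  intro t
  rw [tendsto_iff_dist_tendsto_zero]
  refine squeeze_zero (fun _ => dist_nonneg) (fun m => ?_) tendsto_one_div_add_atTop_nhds_zero_nat
  rw [dist_comm]; exact h m t

theorem IsCadlag.exists_dist_le {y : ℝ≥0 → E} (hy : IsCadlag y) (q : ℝ≥0) :
    ∃ M : ℝ, ∀ t ≤ q, dist (y t) (y 0) ≤ M := by
  obtain ⟨T, hT, h⟩ := hy.exists_grid one_pos
  have hfin : (Finset.range (gridIndex T q + 1)).Nonempty := ⟨0, by simp⟩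
  refine ⟨1 + (Finset.range (gridIndex T q + 1)).sup' hfin (fun j => dist (y (T j)) (y 0)),
    fun t ht => ?_⟩
  have h1 := Finset.le_sup' (fun j => dist (y (T j)) (y 0))
    (show gridIndex T t ∈ Finset.range (gridIndex T q + 1) by
      have := hT.monotone_index ht; simp; omega)
  have h2 := dist_triangle (y t) (y (T (gridIndex T t))) (y 0)
  have h3 := h t
  linarith

end Cadlag

/-! ### A variation bound that is stable under time changes -/

/-- The variation bound for all paths which, after a time change, are uniformly close to a given
càdlàg path. -/
theorem IsCadlag.exists_variation_bound {E : Type*} [NormedAddCommGroup E] [InnerProductSpace ℝ E]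
    [CompleteSpace E] {y : ℝ≥0 → E} (hy : IsCadlag y) (K : Set E) (a : E) {r : ℝ} (hr : 0 < r)
    (hb : Metric.closedBall a r ⊆ K) (q : ℝ≥0) :
    ∃ Q : ℝ≥0, q ≤ Q ∧ ∃ C : ℝ, ∀ (lam : ℝ≥0 ≃o ℝ≥0) (μ : Measure ℝ≥0) [SFinite μ]
      (x y' g : ℝ≥0 → E), (∀ t ≤ Q, ‖y' (lam t) - y t‖ ≤ r / 8) →
      IntegrableOn g (Icc 0 (lam Q)) μ →
      (∀ u ≤ lam Q, x u = y' u + ∫ v in Icc 0 u, g v ∂μ) →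
      (∀ u ≤ lam Q, ∀ z ∈ K, 0 ≤ inner ℝ (z - x u) (g u)) →
      x 0 = y' 0 → ∫ v in Icc 0 (lam Q), ‖g v‖ ∂μ ≤ C := by
  obtain ⟨T, hT, hosc⟩ := hy.exists_grid (show 0 < r / 4 by positivity)
  obtain ⟨N, hN⟩ := (hT.tendsto.eventually_ge_atTop q).exists
  obtain ⟨M, hM⟩ := hy.exists_dist_le (T N)
  obtain ⟨C, hC⟩ := exists_integral_norm_le K a hr hb (2 * (M + r / 8)) (‖y 0 - a‖ + r / 8) N
  refine ⟨T N, hN, C, fun lam μ _ x y' g hclose hg hx hn hx0 => ?_⟩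
  have hG := hT.comp_orderIso lam
  have hcl : ∀ u ≤ lam (T N), ‖y' u - y (lam.symm u)‖ ≤ r / 8 := fun u hu => by
    have := hclose (lam.symm u) (by rwa [OrderIso.symm_apply_le])
    rwa [lam.apply_symm_apply] at this
  have h0 : lam 0 = 0 := lam.map_bot
  refine hC μ x y' g (fun j => lam (T j)) hG.zero hG.strictMono hg hx hn hx0 ?_ ?_ ?_
  · have h1 := hclose 0 zero_le
    rw [h0] at h1
    rw [hx0, show y' 0 - a = (y' 0 - y 0) + (y 0 - a) by abel]
    linarith [norm_add_le (y' 0 - y 0) (y 0 - a)]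
  · have hM' : ∀ u ≤ lam (T N), ‖y' u - y 0‖ ≤ M + r / 8 := fun u hu => by
      have h1 := hcl u hu
      have h2 := hM (lam.symm u) (by rwa [OrderIso.symm_apply_le])
      rw [dist_eq_norm] at h2
      rw [show y' u - y 0 = (y' u - y (lam.symm u)) + (y (lam.symm u) - y 0) by abel]
      linarith [norm_add_le (y' u - y (lam.symm u)) (y (lam.symm u) - y 0)]
    intro u hu v hv
    rw [show y' u - y' v = (y' u - y 0) - (y' v - y 0) by abel]
    linarith [norm_sub_le (y' u - y 0) (y' v - y 0), hM' u hu, hM' v hv]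
  · intro i hi u hu
    have hu1 : u ≤ lam (T N) := hu.2.le.trans (hG.strictMono.monotone hi)
    have hi1 : lam (T i) ≤ lam (T N) := hG.strictMono.monotone hi.le
    have h1 := hcl u hu1
    have h2 := hcl (lam (T i)) hi1
    rw [lam.symm_apply_apply] at h2
    have h3 := hosc (lam.symm u)
    rw [hT.index_eq (j := i) (by rw [lam.le_symm_apply]; exact hu.1)
      (by rw [OrderIso.symm_apply_lt]; exact hu.2), dist_eq_norm] at h3
    rw [show y' u - y' (lam (T i)) = (y' u - y (lam.symm u)) + (y (lam.symm u) - y (T i))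
      - (y' (lam (T i)) - y (T i)) by abel]
    have h4 := norm_sub_le ((y' u - y (lam.symm u)) + (y (lam.symm u) - y (T i)))
      (y' (lam (T i)) - y (T i))
    have h5 := norm_add_le (y' u - y (lam.symm u)) (y (lam.symm u) - y (T i))
    linarith

/-! ### Lebesgue measure on the half-line -/

/-- Lebesgue measure on `[0, ∞)`, as the image of Lebesgue measure on `ℝ`, so that integrals
against it are interval integrals. -/
noncomputable def halfLineVolume : Measure ℝ≥0 :=
  (volume.restrict (Ici (0 : ℝ))).map Real.toNNReal

instance : SFinite halfLineVolume := by unfold halfLineVolume; infer_instance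

theorem toNNReal_preimage_Icc_inter (t : ℝ≥0) :
    Real.toNNReal ⁻¹' (Icc 0 t) ∩ Ici (0 : ℝ) = Icc 0 (t : ℝ) := by
  ext s
  simp only [mem_inter_iff, mem_preimage, mem_Icc, zero_le, true_and, mem_Ici,
    Real.toNNReal_le_iff_le_coe]
  exact and_comm

theorem halfLineVolume_Icc (t : ℝ≥0) : halfLineVolume (Icc 0 t) = ENNReal.ofReal t := by
  rw [halfLineVolume, Measure.map_apply measurable_real_toNNReal measurableSet_Icc,
    Measure.restrict_apply (measurable_real_toNNReal measurableSet_Icc),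
    toNNReal_preimage_Icc_inter, Real.volume_Icc, sub_zero]

section
variable {E : Type*} [NormedAddCommGroup E]

theorem integrableOn_halfLineVolume {f : ℝ≥0 → E} (hf : StronglyMeasurable f) {q : ℝ≥0} {C : ℝ}
    (hC : ∀ t ≤ q, ‖f t‖ ≤ C) : IntegrableOn f (Icc 0 q) halfLineVolume := by
  refine IntegrableOn.of_bound (by rw [halfLineVolume_Icc]; exact ENNReal.ofReal_lt_top)
    hf.aestronglyMeasurable C ?_
  filter_upwards [ae_restrict_mem measurableSet_Icc] with t ht using hC t ht.2

theorem integrableOn_comp_toNNReal {f : ℝ≥0 → E} (hf : StronglyMeasurable f) {q : ℝ≥0} {C : ℝ}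
    (hC : ∀ t ≤ q, ‖f t‖ ≤ C) : IntegrableOn (fun s : ℝ => f s.toNNReal) (Icc 0 (q : ℝ)) := by
  refine IntegrableOn.of_bound (by simp)
    (hf.comp_measurable measurable_real_toNNReal).aestronglyMeasurable C ?_
  filter_upwards [ae_restrict_mem measurableSet_Icc] with t ht
  exact hC _ (Real.toNNReal_le_iff_le_coe.2 ht.2)

theorem setIntegral_halfLineVolume [NormedSpace ℝ E] {f : ℝ≥0 → E} (hf : StronglyMeasurable f)
    (t : ℝ≥0) :
    ∫ s in Icc 0 t, f s ∂halfLineVolume = ∫ s in (0 : ℝ)..t, f s.toNNReal := by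
  rw [halfLineVolume, setIntegral_map measurableSet_Icc hf.aestronglyMeasurable
    measurable_real_toNNReal.aemeasurable,
    Measure.restrict_restrict (measurable_real_toNNReal measurableSet_Icc),
    toNNReal_preimage_Icc_inter, intervalIntegral.integral_of_le t.coe_nonneg,
    integral_Icc_eq_integral_Ioc]

end

/-! ### Penalized equations -/

/-- The density `-n (x - Π x)` of the penalization term. -/
noncomputable def penaltyDensity {d : ℕ} (K : Set (EuclideanSpace ℝ (Fin d))) (n : ℕ)
    (x : ℝ≥0 → EuclideanSpace ℝ (Fin d)) (t : ℝ≥0) : EuclideanSpace ℝ (Fin d) :=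
  -((n : ℝ) • (x t - nearestPoint K (x t)))

section Penalty
variable {d : ℕ} {D : Set (EuclideanSpace ℝ (Fin d))}

theorem stronglyMeasurable_penaltyDensity {K : Set (EuclideanSpace ℝ (Fin d))} (hK : IsClosed K)
    (hne : K.Nonempty) (hc : Convex ℝ K) (n : ℕ) {x : ℝ≥0 → EuclideanSpace ℝ (Fin d)}
    (hx : Measurable x) : StronglyMeasurable (penaltyDensity K n x) := by
  have : Measurable fun t => nearestPoint K (x t) :=
    (continuous_nearestPoint hK hne hc).measurable.comp hx
  exact ((hx.sub this).const_smul (n : ℝ)).neg.stronglyMeasurable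

theorem inner_penaltyDensity_nonneg {K : Set (EuclideanSpace ℝ (Fin d))} (hK : IsClosed K)
    (hne : K.Nonempty) (hc : Convex ℝ K) (n : ℕ) (x : ℝ≥0 → EuclideanSpace ℝ (Fin d)) (t : ℝ≥0)
    {z : EuclideanSpace ℝ (Fin d)} (hz : z ∈ K) :
    0 ≤ inner ℝ (z - x t) (penaltyDensity K n x t) := by
  rw [penaltyDensity, inner_neg_right, inner_smul_right, neg_nonneg]
  exact mul_nonpos_of_nonneg_of_nonpos n.cast_nonneg (inner_sub_residual_le hK hne hc _ hz)

theorem inner_penaltyDensity_sub_le {K : Set (EuclideanSpace ℝ (Fin d))} (hK : IsClosed K)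
    (hne : K.Nonempty) (hc : Convex ℝ K) (n : ℕ) (x x' : ℝ≥0 → EuclideanSpace ℝ (Fin d))
    (t : ℝ≥0) :
    inner ℝ (x t - x' t) (penaltyDensity K n x t - penaltyDensity K n x' t) ≤ 0 := by
  rw [penaltyDensity, penaltyDensity,
    show ∀ u v : EuclideanSpace ℝ (Fin d), -((n : ℝ) • u) - -((n : ℝ) • v) = -((n : ℝ) • (u - v))
      from fun u v => by rw [smul_sub]; abel,
    inner_neg_right, inner_smul_right, neg_nonpos]
  exact mul_nonneg n.cast_nonneg (inner_sub_residual_nonneg hK hne hc _ _)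

theorem penaltyTerm_eq_setIntegral (hne : D.Nonempty) (hconv : Convex ℝ D) (n : ℕ)
    {x : ℝ≥0 → EuclideanSpace ℝ (Fin d)} (hx : Measurable x) (t : ℝ≥0) :
    penaltyTerm D n x t = ∫ s in Icc 0 t, penaltyDensity (closure D) n x s ∂halfLineVolume := by
  rw [setIntegral_halfLineVolume
    (stronglyMeasurable_penaltyDensity isClosed_closure hne.closure hconv.closure n hx)]
  simp only [penaltyDensity, penaltyTerm]
  rw [intervalIntegral.integral_neg, intervalIntegral.integral_smul]

theorem integrableOn_penaltyDensity {K : Set (EuclideanSpace ℝ (Fin d))} (hK : IsClosed K)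
    (hne : K.Nonempty) (hc : Convex ℝ K) (n : ℕ) {x : ℝ≥0 → EuclideanSpace ℝ (Fin d)}
    (hx : IsCadlag x) (q : ℝ≥0) : IntegrableOn (penaltyDensity K n x) (Icc 0 q) halfLineVolume := by
  obtain ⟨M, hM⟩ := hx.exists_dist_le q
  obtain ⟨p, hp⟩ := hne
  refine integrableOn_halfLineVolume
    (stronglyMeasurable_penaltyDensity hK ⟨p, hp⟩ hc n hx.measurable)
    (C := n * (M + dist (x 0) p)) fun t ht => ?_
  rw [penaltyDensity, norm_neg, norm_smul, Real.norm_of_nonneg n.cast_nonneg]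
  gcongr
  rw [← dist_eq_norm, (nearestPoint_spec hK ⟨p, hp⟩ (x t)).2]
  exact (Metric.infDist_le_dist_of_mem hp).trans
    ((dist_triangle _ (x 0) _).trans (by gcongr; exact hM t ht))

/-- The gradient flow of `n dist(·, K)² / 2`: exponential relaxation towards the projection. -/
noncomputable def relax (K : Set (EuclideanSpace ℝ (Fin d))) (n : ℕ) (z : EuclideanSpace ℝ (Fin d))
    (τ : ℝ) : EuclideanSpace ℝ (Fin d) :=
  nearestPoint K z + Real.exp (-(n * τ)) • (z - nearestPoint K z)

theorem nearestPoint_relax {K : Set (EuclideanSpace ℝ (Fin d))} (hK : IsClosed K)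
    (hne : K.Nonempty) (hc : Convex ℝ K) (n : ℕ) (z : EuclideanSpace ℝ (Fin d)) (τ : ℝ) :
    nearestPoint K (relax K n z τ) = nearestPoint K z :=
  nearestPoint_segment hK hne hc z (Real.exp_pos _).le

/-- The values, at the grid points, of the solution of the penalized equation driven by the
piecewise constant path with values `b` on the grid `S`. -/
noncomputable def penalizedStepValue (K : Set (EuclideanSpace ℝ (Fin d))) (n : ℕ) (S : ℕ → ℝ≥0)
    (b : ℕ → EuclideanSpace ℝ (Fin d)) : ℕ → EuclideanSpace ℝ (Fin d)
  | 0 => b 0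
  | j + 1 => relax K n (penalizedStepValue K n S b j) ((S (j + 1) : ℝ) - S j) + (b (j + 1) - b j)

/-- The solution of the penalized equation driven by the piecewise constant path with values `b` on
the grid `S`. -/
noncomputable def penalizedStep (K : Set (EuclideanSpace ℝ (Fin d))) (n : ℕ) (S : ℕ → ℝ≥0)
    (b : ℕ → EuclideanSpace ℝ (Fin d)) (t : ℝ≥0) : EuclideanSpace ℝ (Fin d) :=
  relax K n (penalizedStepValue K n S b (gridIndex S t)) ((t : ℝ) - S (gridIndex S t))

theorem measurable_penalizedStep (K : Set (EuclideanSpace ℝ (Fin d))) (n : ℕ) {S : ℕ → ℝ≥0}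
    (hS : IsGrid S) (b : ℕ → EuclideanSpace ℝ (Fin d)) : Measurable (penalizedStep K n S b) := by
  set z := penalizedStepValue K n S b with hz
  have hj : ∀ j, Measurable fun t : ℝ≥0 => relax K n (z j) ((t : ℝ) - S j) := fun j => by
    unfold relax
    generalize nearestPoint K (z j) = p
    generalize z j = w
    exact Continuous.measurable (by fun_prop)
  have h : Measurable (fun p : ℕ × ℝ≥0 => relax K n (z p.1) ((p.2 : ℝ) - S p.1)) :=
    measurable_from_prod_countable_right hj
  have hi : Measurable fun t => (gridIndex S t, t) := hS.measurable_index.prodMk measurable_id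
  have e : penalizedStep K n S b =
    (fun p : ℕ × ℝ≥0 => relax K n (z p.1) ((p.2 : ℝ) - S p.1)) ∘ fun t => (gridIndex S t, t) := rfl
  rw [e]
  generalize (fun p : ℕ × ℝ≥0 => relax K n (z p.1) ((p.2 : ℝ) - S p.1)) = F at h
  exact h.comp hi

theorem exists_norm_penalizedStep_sub_nearestPoint_le {K : Set (EuclideanSpace ℝ (Fin d))}
    (hK : IsClosed K)
    (hne : K.Nonempty) (hc : Convex ℝ K) (n : ℕ) {S : ℕ → ℝ≥0} (hS : IsGrid S)
    (b : ℕ → EuclideanSpace ℝ (Fin d)) (q : ℝ≥0) :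
    ∃ C : ℝ, ∀ t ≤ q, ‖penalizedStep K n S b t - nearestPoint K (penalizedStep K n S b t)‖ ≤ C := by
  set z := penalizedStepValue K n S b
  refine ⟨∑ j ∈ Finset.range (gridIndex S q + 1), ‖z j - nearestPoint K (z j)‖, fun t ht => ?_⟩
  rw [penalizedStep, nearestPoint_relax hK hne hc, relax, add_sub_cancel_left, norm_smul,
    Real.norm_of_nonneg (Real.exp_pos _).le]
  have h1 : Real.exp (-(n * ((t : ℝ) - S (gridIndex S t)))) ≤ 1 := by
    rw [Real.exp_le_one_iff, neg_nonpos]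
    exact mul_nonneg n.cast_nonneg (sub_nonneg.2 (NNReal.coe_le_coe.2 (hS.index_le t)))
  refine (mul_le_of_le_one_left (norm_nonneg _) h1).trans ?_
  refine Finset.single_le_sum (f := fun j => ‖z j - nearestPoint K (z j)‖)
    (fun _ _ => norm_nonneg _) ?_
  have := hS.monotone_index ht
  simp; omega

theorem integrableOn_penaltyDensity_penalizedStep {K : Set (EuclideanSpace ℝ (Fin d))}
    (hK : IsClosed K) (hne : K.Nonempty) (hc : Convex ℝ K) (n : ℕ) {S : ℕ → ℝ≥0} (hS : IsGrid S)
    (b : ℕ → EuclideanSpace ℝ (Fin d)) (q : ℝ≥0) :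
    IntegrableOn (penaltyDensity K n (penalizedStep K n S b)) (Icc 0 q) halfLineVolume := by
  obtain ⟨C, hC⟩ := exists_norm_penalizedStep_sub_nearestPoint_le hK hne hc n hS b q
  refine integrableOn_halfLineVolume (stronglyMeasurable_penaltyDensity hK hne hc n
    (measurable_penalizedStep K n hS b)) (C := n * C) fun t ht => ?_
  rw [penaltyDensity, norm_neg, norm_smul, Real.norm_of_nonneg n.cast_nonneg]
  gcongr
  exact hC t ht

theorem relax_zero (K : Set (EuclideanSpace ℝ (Fin d))) (n : ℕ) (z : EuclideanSpace ℝ (Fin d)) :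
    relax K n z 0 = z := by simp [relax]

/-- The penalization term over one interval of the grid, along an exponential relaxation. -/
theorem neg_smul_integral_exp (n : ℕ) (v : EuclideanSpace ℝ (Fin d)) (c t : ℝ) :
    -((n : ℝ) • ∫ s in c..t, Real.exp (-(n * (s - c))) • v) =
      Real.exp (-(n * (t - c))) • v - v := by
  have hd : ∀ s ∈ uIcc c t, HasDerivAt (fun s => Real.exp (-(n * (s - c))))
      (Real.exp (-(n * (s - c))) * (-(n * 1))) s := fun s _ =>
    ((((hasDerivAt_id s).sub_const c).const_mul (n : ℝ)).neg).exp
  have := intervalIntegral.integral_eq_sub_of_hasDerivAt hd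
    (Continuous.intervalIntegrable (by fun_prop) _ _)
  rw [intervalIntegral.integral_mul_const, sub_self, mul_zero, neg_zero, Real.exp_zero] at this
  rw [intervalIntegral.integral_smul_const, smul_smul, ← neg_smul,
    show -((n : ℝ) * ∫ s in c..t, Real.exp (-(n * (s - c)))) = Real.exp (-(n * (t - c))) - 1 by
      rw [← this]; ring, sub_smul, one_smul]

/-- `penalizedStep` solves the penalized equation driven by a piecewise constant path. -/
theorem penalizedStep_eq (hne : D.Nonempty) (hconv : Convex ℝ D) (n : ℕ) {S : ℕ → ℝ≥0}
    (hS : IsGrid S) (b : ℕ → EuclideanSpace ℝ (Fin d)) (t : ℝ≥0) :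
    penalizedStep (closure D) n S b t =
      b (gridIndex S t) + penaltyTerm D n (penalizedStep (closure D) n S b) t := by
  have hK : IsClosed (closure D) := isClosed_closure
  have hKne := hne.closure
  have hKc := hconv.closure
  set K := closure D
  set x := penalizedStep K n S b with hx
  set z := penalizedStepValue K n S b with hz
  set G : ℝ → EuclideanSpace ℝ (Fin d) := fun s => x s.toNNReal - nearestPoint K (x s.toNNReal)
    with hG
  have hxm := measurable_penalizedStep K n hS b
  have hm : StronglyMeasurable fun t => x t - nearestPoint K (x t) :=
    (hxm.sub ((continuous_nearestPoint hK hKne hKc).measurable.comp hxm)).stronglyMeasurable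
  have hii : ∀ a c : ℝ≥0, IntervalIntegrable G volume a c := by
    have : ∀ c : ℝ≥0, IntervalIntegrable G volume 0 c := fun c => by
      obtain ⟨C, hC⟩ := exists_norm_penalizedStep_sub_nearestPoint_le hK hKne hKc n hS b c
      rw [intervalIntegrable_iff_integrableOn_Icc_of_le c.coe_nonneg]
      exact integrableOn_comp_toNNReal hm hC
    exact fun a c => (this a).symm.trans (this c)
  -- the increment of the penalization term inside one interval of the grid
  have hblock : ∀ j, ∀ t, S j ≤ t → t ≤ S (j + 1) →
      penaltyTerm D n x t = penaltyTerm D n x (S j) + (relax K n (z j) ((t : ℝ) - S j) - z j) := by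
    intro j t h1 h2
    have hcongr : ∫ s in (S j : ℝ)..t, G s =
        ∫ s in (S j : ℝ)..t, Real.exp (-(n * (s - S j))) • (z j - nearestPoint K (z j)) := by
      rw [intervalIntegral.integral_of_le (NNReal.coe_le_coe.2 h1),
        intervalIntegral.integral_of_le (NNReal.coe_le_coe.2 h1),
        ← integral_Ico_eq_integral_Ioc, ← integral_Ico_eq_integral_Ioc]
      refine setIntegral_congr_fun measurableSet_Ico fun s hs => ?_
      have hs0 : 0 ≤ s := (S j).2.trans hs.1
      have hidx : gridIndex S s.toNNReal = j := by
        apply hS.index_eq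
        · rw [← NNReal.coe_le_coe, Real.coe_toNNReal s hs0]; exact hs.1
        · rw [← NNReal.coe_lt_coe, Real.coe_toNNReal s hs0]
          exact hs.2.trans_le (NNReal.coe_le_coe.2 h2)
      simp only [hG, hx, penalizedStep, hidx, nearestPoint_relax hK hKne hKc]
      rw [relax, add_sub_cancel_left, Real.coe_toNNReal s hs0]
    have e1 : penaltyTerm D n x t =
        -((n : ℝ) • ((∫ s in (0 : ℝ)..(S j : ℝ), G s) + ∫ s in (S j : ℝ)..t, G s)) := by
      rw [intervalIntegral.integral_add_adjacent_intervals (by simpa using hii 0 (S j))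
        (hii (S j) t)]
      rfl
    rw [e1, hcongr, smul_add, neg_add, neg_smul_integral_exp, relax]
    change -((n : ℝ) • ∫ s in (0 : ℝ)..(S j : ℝ), G s) + _ =
      -((n : ℝ) • ∫ s in (0 : ℝ)..(S j : ℝ), G s) + _
    abel
  have hgrid : ∀ j, z j = b j + penaltyTerm D n x (S j) := by
    intro j
    induction j with
    | zero => simp [hz, penalizedStepValue, hS.zero, penaltyTerm]
    | succ j ih =>
      rw [hblock j (S (j + 1)) (hS.strictMono (Nat.lt_succ_self j)).le le_rfl, hz,
        penalizedStepValue]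
      rw [← hz, sub_eq_add_neg (relax K n (z j) _) (z j)]
      nth_rewrite 3 [ih]
      abel
  rw [hblock (gridIndex S t) t (hS.index_le t) (hS.lt_succ t).le, ← add_assoc, ← hgrid, hx,
    penalizedStep]
  abel

end Penalty

/-! ### Measures on the half-line determined by their distribution functions -/

theorem iUnion_Icc_zero_nat : ⋃ n : ℕ, Icc (0 : ℝ≥0) n = univ := by
  refine eq_univ_of_forall fun t => ?_
  obtain ⟨n, hn⟩ := exists_nat_ge t
  exact mem_iUnion.2 ⟨n, zero_le, hn⟩

theorem Ioc_subset_Icc_zero (s t : ℝ≥0) : Ioc s t ⊆ Icc 0 t := fun _ hv => ⟨zero_le, hv.2⟩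

theorem disjoint_Icc_zero_Ioc (s t : ℝ≥0) : Disjoint (Icc 0 s) (Ioc s t) :=
  Set.disjoint_left.2 fun _ hv hv' => hv.2.not_gt hv'.1

theorem isLocallyFiniteMeasure_of_Icc {μ : Measure ℝ≥0} (h : ∀ t, μ (Icc 0 t) < ∞) :
    IsLocallyFiniteMeasure μ :=
  ⟨fun t => ⟨Iio (t + 1), Iio_mem_nhds (by simp),
    (measure_mono (t := Icc 0 (t + 1)) fun _ hs => ⟨zero_le, le_of_lt hs⟩).trans_lt (h (t + 1))⟩⟩

theorem measure_Icc_lt_top_of_isLocallyFinite {μ : Measure ℝ≥0}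
    (h : IsLocallyFiniteMeasure μ) (s t : ℝ≥0) :
    μ (Icc s t) < ∞ := isCompact_Icc.measure_lt_top

theorem measure_ext_of_Icc {μ ν : Measure ℝ≥0} (hfin : ∀ t, μ (Icc 0 t) ≠ ∞)
    (h : ∀ t, μ (Icc 0 t) = ν (Icc 0 t)) : μ = ν := by
  have e : ∀ t : ℝ≥0, Iic t = Icc 0 t := fun t => by ext s; simp
  refine Measure.ext_of_generateFrom_of_iUnion (range Iic) (fun n : ℕ => Iic (n : ℝ≥0))
    (BorelSpace.measurable_eq.trans (borel_eq_generateFrom_Iic ℝ≥0)) isPiSystem_Iic ?_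
    (fun n => mem_range_self _) (fun n => ?_) ?_
  · simp only [e]; exact iUnion_Icc_zero_nat
  · rw [e]; exact hfin _
  · rintro _ ⟨t, rfl⟩; rw [e]; exact h t

theorem ae_of_ae_restrict_Icc {μ : Measure ℝ≥0} {p : ℝ≥0 → Prop}
    (h : ∀ t : ℝ≥0, ∀ᵐ s ∂μ.restrict (Icc 0 t), p s) : ∀ᵐ s ∂μ, p s := by
  have := (ae_restrict_iUnion_iff (μ := μ) (fun n : ℕ => Icc (0 : ℝ≥0) n) p).2 fun n => h n
  rwa [iUnion_Icc_zero_nat, Measure.restrict_univ] at this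

/-- A right-continuous nondecreasing `F ≥ 0` is the distribution function of a measure, which has
mass `F 0` at `0`. -/
theorem exists_measure_Icc_eq {F : ℝ≥0 → ℝ} (hm : Monotone F)
    (hc : ∀ t, ContinuousWithinAt F (Ici t) t) (h0 : 0 ≤ F 0) :
    ∃ μ : Measure ℝ≥0, IsLocallyFiniteMeasure μ ∧ ∀ t, μ (Icc 0 t) = ENNReal.ofReal (F t) := by
  let f : StieltjesFunction ℝ≥0 := ⟨F, hm, hc⟩
  have key : ∀ t, (f.measure + ENNReal.ofReal (F 0) • Measure.dirac 0 : Measure ℝ≥0) (Icc 0 t) =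
      ENNReal.ofReal (F t) := by
    intro t
    have hbot : f.measure {0} = 0 := by
      have := f.measure_botSet
      rwa [botSet_eq_singleton_of_isBot (x := (0 : ℝ≥0))
        (fun _ => zero_le)] at this
    have h1 : f.measure (Icc 0 t) = ENNReal.ofReal (F t - F 0) := by
      refine le_antisymm ?_ ?_
      · rw [← Icc_union_Ioc_eq_Icc le_rfl (zero_le (a := t)), Icc_self]
        refine (measure_union_le _ _).trans ?_
        rw [hbot, zero_add, f.measure_Ioc]
      · rw [← show f.measure (Ioc 0 t) = ENNReal.ofReal (F t - F 0) from f.measure_Ioc 0 t]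
        exact measure_mono Ioc_subset_Icc_self
    rw [Measure.add_apply, h1, Measure.smul_apply, Measure.dirac_apply' _ measurableSet_Icc,
      indicator_of_mem (by simp), Pi.one_apply, smul_eq_mul, mul_one,
      ← ENNReal.ofReal_add (sub_nonneg.2 (hm zero_le)) h0, sub_add_cancel]
  exact ⟨_, isLocallyFiniteMeasure_of_Icc fun t => by rw [key]; exact ENNReal.ofReal_lt_top, key⟩

theorem continuousWithinAt_setIntegral_Iic {μ : Measure ℝ≥0} {f : ℝ≥0 → ℝ} (hf : Integrable f μ)
    (t : ℝ≥0) : ContinuousWithinAt (fun u => ∫ s in Iic u, f s ∂μ) (Ici t) t := by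
  rw [← continuousWithinAt_Ioi_iff_Ici]
  simp only [← integral_indicator (measurableSet_Iic (α := ℝ≥0)), ContinuousWithinAt]
  refine tendsto_integral_filter_of_dominated_convergence (fun s => ‖f s‖)
    (Eventually.of_forall fun u => hf.aestronglyMeasurable.indicator measurableSet_Iic)
    (Eventually.of_forall fun u => Eventually.of_forall fun s => norm_indicator_le_norm_self _ _)
    hf.norm (Eventually.of_forall fun s => ?_)
  refine tendsto_const_nhds.congr' ?_
  rcases le_or_gt s t with h | h
  · filter_upwards [self_mem_nhdsWithin] with u hu
    rw [indicator_of_mem (mem_Iic.2 h), indicator_of_mem (mem_Iic.2 (h.trans (le_of_lt hu)))]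
  · filter_upwards [mem_nhdsWithin_of_mem_nhds (Iio_mem_nhds h)] with u hu
    rw [indicator_of_notMem (by simpa using h), indicator_of_notMem (by simpa using hu)]

/-- A density with nonnegative integrals over all intervals `(s, t]` is almost everywhere
nonnegative: its distribution function is that of a (positive) measure. -/
theorem ae_nonneg_of_setIntegral_Ioc {μ : Measure ℝ≥0} {f : ℝ≥0 → ℝ} (hf : Integrable f μ)
    (h0 : 0 ≤ ∫ s in Iic 0, f s ∂μ) (h : ∀ s t, s ≤ t → 0 ≤ ∫ u in Ioc s t, f u ∂μ) :
    0 ≤ᵐ[μ] f := by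
  have hm : Monotone fun t => ∫ s in Iic t, f s ∂μ := by
    intro s t hst
    have : ∫ u in Iic t, f u ∂μ = (∫ u in Iic s, f u ∂μ) + ∫ u in Ioc s t, f u ∂μ := by
      rw [← setIntegral_union (Iic_disjoint_Ioc le_rfl)
        measurableSet_Ioc hf.integrableOn hf.integrableOn, Iic_union_Ioc_eq_Iic hst]
    simp only
    rw [this]; linarith [h s t hst]
  obtain ⟨ν, -, hν⟩ := exists_measure_Icc_eq hm (continuousWithinAt_setIntegral_Iic hf) h0
  have hIic : ∀ t : ℝ≥0, Iic t = Icc 0 t := fun t => by ext s; simp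
  have hp : ∀ A : Set ℝ≥0, ∫⁻ s in A, ENNReal.ofReal (f s) ∂μ ≠ ∞ := fun A =>
    (hf.integrableOn (s := A)).lintegral_lt_top.ne
  have hn : ∀ A : Set ℝ≥0, ∫⁻ s in A, ENNReal.ofReal (-f s) ∂μ ≠ ∞ := fun A =>
    (hf.neg.integrableOn (s := A)).lintegral_lt_top.ne
  have hdec : ∀ A : Set ℝ≥0, ∫ s in A, f s ∂μ = (∫⁻ s in A, ENNReal.ofReal (f s) ∂μ).toReal -
      (∫⁻ s in A, ENNReal.ofReal (-f s) ∂μ).toReal := fun A =>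
    integral_eq_lintegral_pos_part_sub_lintegral_neg_part hf.integrableOn
  have e : μ.withDensity (fun s => ENNReal.ofReal (f s)) =
      ν + μ.withDensity (fun s => ENNReal.ofReal (-f s)) := by
    refine measure_ext_of_Icc (fun t => ?_) fun t => ?_
    · rw [withDensity_apply _ measurableSet_Icc]; exact hp _
    · have hF : 0 ≤ ∫ s in Iic t, f s ∂μ := h0.trans (hm zero_le)
      rw [Measure.add_apply, hν, withDensity_apply _ measurableSet_Icc,
        withDensity_apply _ measurableSet_Icc, ← ENNReal.ofReal_toReal (hp _),
        ← ENNReal.ofReal_toReal (hn _), ← ENNReal.ofReal_add hF ENNReal.toReal_nonneg, hIic, hdec,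
        sub_add_cancel]
  refine ae_nonneg_of_forall_setIntegral_nonneg hf fun A hA _ => ?_
  rw [hdec, sub_nonneg]
  refine ENNReal.toReal_mono (hp A) ?_
  rw [← withDensity_apply _ hA, ← withDensity_apply _ hA, e, Measure.add_apply]
  exact le_add_self

theorem ae_nonneg_of_setIntegral_Ioc_of_integrableOn {μ : Measure ℝ≥0} {f : ℝ≥0 → ℝ}
    (hf : ∀ t, IntegrableOn f (Icc 0 t) μ) (h0 : μ {0} = 0)
    (h : ∀ s t, s ≤ t → 0 ≤ ∫ u in Ioc s t, f u ∂μ) : ∀ᵐ s ∂μ, 0 ≤ f s := by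
  refine ae_of_ae_restrict_Icc fun q => ?_
  refine ae_nonneg_of_setIntegral_Ioc (hf q) ?_ fun s t hst => ?_
  · rw [Measure.restrict_restrict measurableSet_Iic, setIntegral_measure_zero]
    refine measure_mono_null (fun s hs => ?_) h0
    exact le_antisymm hs.1 zero_le
  · rw [Measure.restrict_restrict measurableSet_Ioc]
    rcases le_total s q with hs | hs
    · convert! h s (min t q) (le_min hst hs) using 3
      ext u; simp only [mem_inter_iff, mem_Ioc, mem_Icc, zero_le, true_and, le_min_iff, and_assoc]
    · have : Ioc s t ∩ Icc 0 q = ∅ := by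
        ext u; simp only [mem_inter_iff, mem_Ioc, mem_Icc, mem_empty_iff_false, iff_false]
        rintro ⟨⟨h1, -⟩, -, h2⟩; exact absurd (h1.trans_le h2) hs.not_gt
      rw [this]; simp

/-! ### Polar decomposition of functions of locally bounded variation -/

section Variation
variable {d : ℕ}

theorem eVariationOn_le_integral_norm {E : Type*} [NormedAddCommGroup E] [NormedSpace ℝ E]
    {μ : Measure ℝ≥0} {k g : ℝ≥0 → E} {q : ℝ≥0} (hg : IntegrableOn g (Icc 0 q) μ)
    (hk : ∀ t ≤ q, k t = ∫ s in Icc 0 t, g s ∂μ) :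
    eVariationOn k (Icc 0 q) ≤ ENNReal.ofReal (∫ s in Icc 0 q, ‖g s‖ ∂μ) := by
  set F : ℝ≥0 → ℝ := fun t => ∫ s in Icc 0 t, ‖g s‖ ∂μ with hF
  have hinc : ∀ s t, s ≤ t → t ≤ q → F t = F s + ∫ u in Ioc s t, ‖g u‖ ∂μ ∧
      k t = k s + ∫ u in Ioc s t, g u ∂μ := by
    intro s t hst htq
    have hd := disjoint_Icc_zero_Ioc s t
    have i1 : IntegrableOn g (Icc 0 s) μ := hg.mono_set (Icc_subset_Icc_right (hst.trans htq))
    have i2 : IntegrableOn g (Ioc s t) μ := hg.mono_set fun v hv => ⟨zero_le, hv.2.trans htq⟩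
    rw [hk t htq, hk s (hst.trans htq), hF]
    simp only
    rw [← Icc_union_Ioc_eq_Icc zero_le hst, setIntegral_union hd measurableSet_Ioc i1 i2,
      setIntegral_union hd measurableSet_Ioc i1.norm i2.norm]
    exact ⟨rfl, rfl⟩
  have hmono : MonotoneOn F (Icc 0 q) := fun s hs t ht hst => by
    rw [(hinc s t hst ht.2).1]
    have : 0 ≤ ∫ u in Ioc s t, ‖g u‖ ∂μ := integral_nonneg fun _ => norm_nonneg _
    linarith
  have h1 : eVariationOn k (Icc 0 q) ≤ eVariationOn F (Icc 0 q) := by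
    refine iSup_le fun ⟨n, u, hu, us⟩ => le_trans (Finset.sum_le_sum fun i _ => ?_)
      (eVariationOn.sum_le hu us)
    have hle := hu (Nat.le_succ i)
    obtain ⟨e1, e2⟩ := hinc _ _ hle (us (i + 1)).2
    simp only
    rw [edist_dist, edist_dist, e1, e2, dist_eq_norm, dist_eq_norm, add_sub_cancel_left,
      add_sub_cancel_left, Real.norm_eq_abs]
    exact ENNReal.ofReal_le_ofReal ((norm_integral_le_integral_norm _).trans (le_abs_self _))
  refine h1.trans ?_
  have := hmono.eVariationOn_eq (a := 0) (b := q) (by simp) (by simp)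
  rw [inter_self] at this
  refine this.le.trans (ENNReal.ofReal_le_ofReal ?_)
  have : 0 ≤ F 0 := integral_nonneg fun _ => norm_nonneg _
  linarith

theorem continuousWithinAt_variationOnFromTo {E : Type*} [PseudoMetricSpace E] {k : ℝ≥0 → E}
    (hk : LocallyBoundedVariationOn k univ) (hc : ∀ t, ContinuousWithinAt k (Ici t) t) (t : ℝ≥0) :
    ContinuousWithinAt (variationOnFromTo k univ 0) (Ici t) t := by
  rw [← continuousWithinAt_Ioi_iff_Ici]
  have h := variationOnFromTo.tendsto_right (s := univ) (mem_univ 0) (mem_univ t) hk (l := k t)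
    (by rw [univ_inter]; exact (continuousWithinAt_Ioi_iff_Ici.2 (hc t)))
  rwa [univ_inter, dist_self, add_zero] at h

theorem dist_le_variationOnFromTo {E : Type*} [PseudoMetricSpace E] {k : ℝ≥0 → E}
    (hk : LocallyBoundedVariationOn k univ) {s t : ℝ≥0} (hst : s ≤ t) :
    dist (k t) (k s) ≤ variationOnFromTo k univ 0 t - variationOnFromTo k univ 0 s := by
  rw [← variationOnFromTo.add hk (mem_univ 0) (mem_univ s) (mem_univ t), add_sub_cancel_left,
    variationOnFromTo.eq_of_le _ _ hst]
  exact (hk s t (mem_univ _) (mem_univ _)).dist_le (by simp [hst]) (by simp [hst])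

/-- Polar decomposition: `dk = n d|k|` with `|n| = 1` almost everywhere. -/
theorem exists_polar_decomposition {k : ℝ≥0 → EuclideanSpace ℝ (Fin d)}
    (hk : LocallyBoundedVariationOn k univ) (hc : ∀ t, ContinuousWithinAt k (Ici t) t)
    (hk0 : k 0 = 0) :
    ∃ (μ : Measure ℝ≥0) (n : ℝ≥0 → EuclideanSpace ℝ (Fin d)), IsVariationMeasure k μ ∧
      StronglyMeasurable n ∧
      (∀ t, IntegrableOn n (Icc 0 t) μ ∧ k t = ∫ s in Icc 0 t, n s ∂μ) ∧ ∀ᵐ s ∂μ, ‖n s‖ = 1 := by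
  set V : ℝ≥0 → ℝ := variationOnFromTo k univ 0 with hV
  have hVm : Monotone V := fun s t hst =>
    variationOnFromTo.monotoneOn hk (mem_univ 0) (mem_univ s) (mem_univ t) hst
  have hV0 : V 0 = 0 := variationOnFromTo.self k univ 0
  have hVnn : ∀ t, 0 ≤ V t := fun t => hV0 ▸ hVm zero_le
  have hVc := continuousWithinAt_variationOnFromTo hk hc
  obtain ⟨μ, hμ, hμV⟩ := exists_measure_Icc_eq hVm hVc hV0.ge
  have hVvar : ∀ t, ENNReal.ofReal (V t) = variationUpTo k t := by
    intro t
    rw [hV, variationOnFromTo.eq_of_le _ _ zero_le, univ_inter, ENNReal.ofReal_toReal]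
    · rfl
    · have := hk 0 t (mem_univ _) (mem_univ _); rwa [univ_inter] at this
  have hinc : ∀ s t, s ≤ t → ‖k t - k s‖ ≤ V t - V s := fun s t hst => by
    rw [← dist_eq_norm]; exact dist_le_variationOnFromTo hk hst
  have hcoord : ∀ (v : EuclideanSpace ℝ (Fin d)) (i : Fin d), |v i| ≤ ‖v‖ := fun v i => by
    simpa using PiLp.norm_apply_le v i
  have hk0i : ∀ i, k 0 i = 0 := fun i => by rw [hk0]; rfl
  have hki : ∀ i t, ContinuousWithinAt (fun s => k s i) (Ici t) t := fun i t =>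
    (EuclideanSpace.proj (𝕜 := ℝ) i).continuous.continuousAt.comp_continuousWithinAt (hc t)
  -- `|k| ± k i` are distribution functions of measures with sum `2 d|k|`
  have hplus : ∀ i, ∃ ν : Measure ℝ≥0, IsLocallyFiniteMeasure ν ∧
      ∀ t, ν (Icc 0 t) = ENNReal.ofReal (V t + k t i) := fun i =>
    exists_measure_Icc_eq (fun s t hst => by
      have h1 := (hcoord (k t - k s) i).trans (hinc s t hst)
      rw [PiLp.sub_apply] at h1
      have := neg_abs_le (k t i - k s i); simp only; linarith)
      (fun t => (hVc t).add (hki i t)) (by rw [hV0, hk0i]; simp)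
  have hminus : ∀ i, ∃ ν : Measure ℝ≥0, IsLocallyFiniteMeasure ν ∧
      ∀ t, ν (Icc 0 t) = ENNReal.ofReal (V t - k t i) := fun i =>
    exists_measure_Icc_eq (fun s t hst => by
      have h1 := (hcoord (k t - k s) i).trans (hinc s t hst)
      rw [PiLp.sub_apply] at h1
      have := le_abs_self (k t i - k s i); simp only; linarith)
      (fun t => (hVc t).sub (hki i t)) (by rw [hV0, hk0i]; simp)
  choose ν hν hνV using hplus
  choose ν' hν' hνV' using hminus
  have hkV : ∀ i t, |k t i| ≤ V t := fun i t => by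
    have := (hcoord (k t - k 0) i).trans (hinc 0 t zero_le)
    rwa [hk0, hV0, sub_zero, sub_zero] at this
  have hsum : ∀ i, ν i + ν' i = μ + μ := fun i => by
    refine measure_ext_of_Icc (fun t => ?_) fun t => ?_
    · rw [Measure.add_apply, hνV, hνV']; finiteness
    · have h1 := abs_le.1 (hkV i t)
      rw [Measure.add_apply, Measure.add_apply, hνV, hνV', hμV,
        ← ENNReal.ofReal_add (by linarith) (by linarith),
        ← ENNReal.ofReal_add (hVnn t) (hVnn t)]
      congr 1; ring
  have hac : ∀ i, ν i ≪ μ := fun i A hA => by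
    have : (ν i + ν' i) A = 0 := by rw [hsum, Measure.add_apply, hA, add_zero]
    rw [Measure.add_apply] at this
    exact (add_eq_zero.1 this).1
  set n : ℝ≥0 → EuclideanSpace ℝ (Fin d) := fun s =>
    WithLp.toLp 2 fun i => ((ν i).rnDeriv μ s).toReal - 1 with hn
  have hnm : StronglyMeasurable n := by
    refine Measurable.stronglyMeasurable ?_
    refine (WithLp.measurable_toLp 2 _).comp (measurable_pi_lambda _ fun i => ?_)
    exact ((ν i).measurable_rnDeriv μ).ennreal_toReal.sub_const 1
  have hfin : ∀ t, μ (Icc 0 t) ≠ ∞ := fun t => by rw [hμV]; exact ENNReal.ofReal_ne_top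
  have hone : ∀ t, IntegrableOn (fun _ => (1 : ℝ)) (Icc 0 t) μ := fun t =>
    integrableOn_const (hfin t)
  have hrn : ∀ i t, IntegrableOn (fun s => ((ν i).rnDeriv μ s).toReal) (Icc 0 t) μ := fun i t =>
    Measure.integrableOn_toReal_rnDeriv (by rw [hνV]; exact ENNReal.ofReal_ne_top)
  have hni : ∀ t, IntegrableOn n (Icc 0 t) μ := fun t =>
    Integrable.of_eval_piLp fun i => (hrn i t).sub (hone t)
  have hμreal : ∀ t, μ.real (Icc 0 t) = V t := fun t => by
    rw [measureReal_def, hμV, ENNReal.toReal_ofReal (hVnn t)]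
  have hkn : ∀ t, k t = ∫ s in Icc 0 t, n s ∂μ := by
    intro t
    ext i
    have h1 := (EuclideanSpace.proj (𝕜 := ℝ) i).integral_comp_comm (hni t)
    rw [show (∫ s in Icc 0 t, n s ∂μ) i = EuclideanSpace.proj (𝕜 := ℝ) i (∫ s in Icc 0 t, n s ∂μ)
      from rfl, ← h1]
    have h2 : ∀ s, EuclideanSpace.proj (𝕜 := ℝ) i (n s) = ((ν i).rnDeriv μ s).toReal - 1 :=
      fun s => rfl
    simp only [h2]
    rw [integral_sub (hrn i t) (hone t), Measure.setIntegral_toReal_rnDeriv (hac i),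
      setIntegral_const, hμreal, measureReal_def, hνV,
      ENNReal.toReal_ofReal (by linarith [(abs_le.1 (hkV i t)).1])]
    simp
  have hμ0 : μ {0} = 0 := by rw [← Icc_self, hμV, hV0, ENNReal.ofReal_zero]
  have hIoc : ∀ s t, s ≤ t → IntegrableOn n (Ioc s t) μ ∧ k t - k s = ∫ u in Ioc s t, n u ∂μ ∧
      V t - V s = μ.real (Ioc s t) := by
    intro s t hst
    have hd := disjoint_Icc_zero_Ioc s t
    have i2 : IntegrableOn n (Ioc s t) μ := (hni t).mono_set (Ioc_subset_Icc_zero s t)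
    refine ⟨i2, ?_, ?_⟩
    · rw [hkn t, hkn s, ← Icc_union_Ioc_eq_Icc zero_le hst,
        setIntegral_union hd measurableSet_Ioc (hni s) i2, add_sub_cancel_left]
    · rw [← hμreal, ← hμreal, ← Icc_union_Ioc_eq_Icc zero_le hst,
        measureReal_union hd measurableSet_Ioc (hfin s)
          (measure_ne_top_of_subset (Ioc_subset_Icc_zero s t) (hfin t)), add_sub_cancel_left]
  -- `‖n‖ ≤ 1` since `⟨v, k t - k s⟩ ≤ ‖v‖ μ(s, t]` for `v` in a countable dense set; equality
  -- follows because the total variation of `k` is at most `∫ ‖n‖ dμ`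
  have hle1 : ∀ᵐ s ∂μ, ‖n s‖ ≤ 1 := by
    have hv : ∀ j : ℕ, ∀ᵐ s ∂μ, 0 ≤ ‖TopologicalSpace.denseSeq (EuclideanSpace ℝ (Fin d)) j‖ -
        inner ℝ (TopologicalSpace.denseSeq (EuclideanSpace ℝ (Fin d)) j) (n s) := by
      intro j
      set v := TopologicalSpace.denseSeq (EuclideanSpace ℝ (Fin d)) j
      refine ae_nonneg_of_setIntegral_Ioc_of_integrableOn
        (fun t => (integrableOn_const (hfin t)).sub ((hni t).const_inner v)) hμ0 fun s t hst => ?_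
      obtain ⟨i1, i2, i3⟩ := hIoc s t hst
      have hcs : IntegrableOn (fun _ => ‖v‖) (Ioc s t) μ :=
        integrableOn_const (measure_ne_top_of_subset (Ioc_subset_Icc_zero s t) (hfin t))
      rw [integral_sub hcs (i1.const_inner v),
        integral_inner i1, ← i2, setIntegral_const, ← i3, smul_eq_mul]
      have h1 := real_inner_le_norm v (k t - k s)
      have h2 := mul_le_mul_of_nonneg_left (hinc s t hst) (norm_nonneg v)
      linarith
    filter_upwards [ae_all_iff.2 hv] with s hs
    have hall : ∀ v : EuclideanSpace ℝ (Fin d), 0 ≤ ‖v‖ - inner ℝ v (n s) := fun v =>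
      (TopologicalSpace.denseRange_denseSeq (EuclideanSpace ℝ (Fin d))).induction_on
        (p := fun v => 0 ≤ ‖v‖ - inner ℝ v (n s)) v
        (isClosed_le continuous_const (by fun_prop)) hs
    have := hall (n s)
    rw [real_inner_self_eq_norm_sq] at this
    by_contra! hlt
    nlinarith
  refine ⟨μ, n, ⟨hμ, fun t => by rw [hμV, hVvar]⟩, hnm, fun t => ⟨hni t, hkn t⟩, ?_⟩
  refine ae_of_ae_restrict_Icc fun t => ?_
  have h1 := eVariationOn_le_integral_norm (hni t) (fun s _ => hkn s)
  rw [show eVariationOn k (Icc 0 t) = ENNReal.ofReal (V t) from (hVvar t).symm,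
    ENNReal.ofReal_le_ofReal_iff (integral_nonneg fun _ => norm_nonneg _)] at h1
  have h2 : ∫ s in Icc 0 t, (1 - ‖n s‖) ∂μ = V t - ∫ s in Icc 0 t, ‖n s‖ ∂μ := by
    rw [integral_sub (hone t) (hni t).norm, setIntegral_const, hμreal, smul_eq_mul, mul_one]
  have hnn : 0 ≤ᵐ[μ.restrict (Icc 0 t)] fun s => 1 - ‖n s‖ := by
    filter_upwards [ae_restrict_of_ae hle1] with s hs using sub_nonneg.2 hs
  have h3 : ∫ s in Icc 0 t, (1 - ‖n s‖) ∂μ = 0 :=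
    le_antisymm (by rw [h2]; linarith) (integral_nonneg_of_ae hnn)
  filter_upwards [(integral_eq_zero_iff_of_nonneg_ae hnn ((hone t).sub (hni t).norm)).1 h3]
    with s hs
  have : 1 - ‖n s‖ = 0 := hs
  linarith

end Variation

/-! ### The Skorokhod problem for piecewise constant paths -/

section Step
variable {d : ℕ}

/-- The values, at the grid points, of the solution of the Skorokhod problem associated with a
piecewise constant path with successive values `b`: each jump is followed by a projection. -/
noncomputable def skorokhodStepValue (K : Set (EuclideanSpace ℝ (Fin d)))
    (b : ℕ → EuclideanSpace ℝ (Fin d)) : ℕ → EuclideanSpace ℝ (Fin d)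
  | 0 => b 0
  | j + 1 => nearestPoint K (skorokhodStepValue K b j + (b (j + 1) - b j))

/-- The density, with respect to the counting measure of the grid `T`, of the reflection term of
the Skorokhod problem associated with the piecewise constant path with values `b`. -/
noncomputable def stepJump (K : Set (EuclideanSpace ℝ (Fin d))) (T : ℕ → ℝ≥0)
    (b : ℕ → EuclideanSpace ℝ (Fin d)) (s : ℝ≥0) : EuclideanSpace ℝ (Fin d) :=
  if T (gridIndex T s) = s then
    (skorokhodStepValue K b (gridIndex T s) - b (gridIndex T s)) -
      (skorokhodStepValue K b (gridIndex T s - 1) - b (gridIndex T s - 1))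
  else 0

theorem skorokhodStepValue_mem {K : Set (EuclideanSpace ℝ (Fin d))} (hK : IsClosed K)
    {b : ℕ → EuclideanSpace ℝ (Fin d)} (hb : b 0 ∈ K) (j : ℕ) : skorokhodStepValue K b j ∈ K := by
  cases j with
  | zero => exact hb
  | succ j => exact (nearestPoint_spec hK ⟨_, hb⟩ _).1

/-- The projection jumps point inwards: the variational characterization of the nearest point. -/
theorem inner_stepJump_nonneg {K : Set (EuclideanSpace ℝ (Fin d))} (hK : IsClosed K)
    (hc : Convex ℝ K) (T : ℕ → ℝ≥0) (b : ℕ → EuclideanSpace ℝ (Fin d)) (s : ℝ≥0)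
    {z : EuclideanSpace ℝ (Fin d)} (hz : z ∈ K) :
    0 ≤ inner ℝ (z - skorokhodStepValue K b (gridIndex T s)) (stepJump K T b s) := by
  unfold stepJump
  split_ifs with h
  · generalize gridIndex T s = i
    cases i with
    | zero => simp
    | succ j =>
      have h1 := inner_sub_nearestPoint_le hK ⟨z, hz⟩ hc
        (skorokhodStepValue K b j + (b (j + 1) - b j)) hz
      rw [Nat.add_sub_cancel,
        show (skorokhodStepValue K b (j + 1) - b (j + 1)) - (skorokhodStepValue K b j - b j) =
          -((skorokhodStepValue K b j + (b (j + 1) - b j)) - skorokhodStepValue K b (j + 1)) by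
          abel, inner_neg_right, real_inner_comm]
      exact neg_nonneg.2 h1
  · simp

theorem integrableOn_sum_dirac {E : Type*} [NormedAddCommGroup E] (F : Finset ℝ≥0) (f : ℝ≥0 → E)
    (A : Set ℝ≥0) : IntegrableOn f A (∑ s ∈ F, Measure.dirac s) :=
  (integrable_finsetSum_measure.2 fun s _ => integrable_dirac (by simp)).integrableOn

theorem setIntegral_sum_dirac {E : Type*} [NormedAddCommGroup E] [NormedSpace ℝ E]
    [CompleteSpace E] (F : Finset ℝ≥0) (f : ℝ≥0 → E) {A : Set ℝ≥0} (hA : MeasurableSet A) :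
    ∫ s in A, f s ∂(∑ s ∈ F, Measure.dirac s) = ∑ s ∈ F, A.indicator f s := by
  rw [← integral_indicator hA, integral_finsetSum_measure fun s _ => integrable_dirac (by simp)]
  simp only [integral_dirac]

/-- The jumps telescope to the reflection term of the step solution. Since `n - 1 = 0` for `n = 0`,
`stepJump` vanishes at time `0`. -/
theorem setIntegral_stepJump (K : Set (EuclideanSpace ℝ (Fin d))) {T : ℕ → ℝ≥0} (hT : IsGrid T)
    (b : ℕ → EuclideanSpace ℝ (Fin d)) {F : Finset ℝ≥0} {q t : ℝ≥0}
    (hF : ∀ j ≤ gridIndex T q, T j ∈ F) (ht : t ≤ q) :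
    ∫ s in Icc 0 t, stepJump K T b s ∂(∑ s ∈ F, Measure.dirac s) =
      skorokhodStepValue K b (gridIndex T t) - b (gridIndex T t) := by
  rw [setIntegral_sum_dirac F _ measurableSet_Icc]
  have himg : (Finset.range (gridIndex T t + 1)).image T ⊆ F := fun s hs => by
    obtain ⟨j, hj, rfl⟩ := Finset.mem_image.1 hs
    have h1 := hT.monotone_index ht
    have h2 := Finset.mem_range.1 hj
    exact hF j (by omega)
  rw [← Finset.sum_subset himg, Finset.sum_image fun _ _ _ _ h => hT.strictMono.injective h]
  · have h1 : ∀ j ∈ Finset.range (gridIndex T t + 1),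
        (Icc 0 t).indicator (stepJump K T b) (T j) =
          (skorokhodStepValue K b j - b j) - (skorokhodStepValue K b (j - 1) - b (j - 1)) := by
      intro j hj
      have h2 := Finset.mem_range.1 hj
      rw [indicator_of_mem (show T j ∈ Icc 0 t from ⟨zero_le, hT.le_iff.2 (by omega)⟩),
        stepJump, hT.index_self, if_pos rfl]
    rw [Finset.sum_congr rfl h1, Finset.sum_range_succ']
    simp only [Nat.add_sub_cancel]
    rw [Finset.sum_range_sub (fun j => skorokhodStepValue K b j - b j)]
    simp [skorokhodStepValue]
  · intro s _ hs
    by_cases hst : s ∈ Icc 0 t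
    · rw [indicator_of_mem hst, stepJump, if_neg]
      intro h
      refine hs (Finset.mem_image.2 ⟨gridIndex T s, ?_, h⟩)
      have := hT.monotone_index hst.2
      simp; omega
    · exact indicator_of_notMem hst _

/-- On `[0, q]`, uniformly over all sufficiently fine grids, the step solutions have bounded
reflection terms, and they form a Cauchy net for the uniform norm. -/
theorem exists_skorokhodStep_bound {y : ℝ≥0 → EuclideanSpace ℝ (Fin d)} (hy : IsCadlag y)
    {K : Set (EuclideanSpace ℝ (Fin d))} (hK : IsClosed K) (hc : Convex ℝ K)
    (hy0 : y 0 ∈ K) {a : EuclideanSpace ℝ (Fin d)} {r : ℝ} (hr : 0 < r)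
    (hb : Metric.closedBall a r ⊆ K) (q : ℝ≥0) :
    ∃ C : ℝ, 0 ≤ C ∧
      (∀ T : ℕ → ℝ≥0, IsGrid T → (∀ t, dist (y t) (y (T (gridIndex T t))) ≤ r / 8) →
        ∀ F : Finset ℝ≥0, (∀ j ≤ gridIndex T q, T j ∈ F) →
        ∫ s in Icc 0 q, ‖stepJump K T (fun j => y (T j)) s‖ ∂(∑ s ∈ F, Measure.dirac s) ≤ C) ∧
      ∀ (T T' : ℕ → ℝ≥0) (δ δ' : ℝ), IsGrid T → IsGrid T' → δ ≤ r / 8 → δ' ≤ r / 8 →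
        (∀ t, dist (y t) (y (T (gridIndex T t))) ≤ δ) →
        (∀ t, dist (y t) (y (T' (gridIndex T' t))) ≤ δ') →
        ∀ t ≤ q, ‖skorokhodStepValue K (fun j => y (T j)) (gridIndex T t) -
          skorokhodStepValue K (fun j => y (T' j)) (gridIndex T' t)‖ ^ 2 ≤
            (δ + δ') ^ 2 + 8 * C * (δ + δ') := by
  obtain ⟨Q, hQ, C, hC⟩ := hy.exists_variation_bound K a hr hb q
  have key : ∀ T : ℕ → ℝ≥0, IsGrid T → (∀ t, dist (y t) (y (T (gridIndex T t))) ≤ r / 8) →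
      ∀ F : Finset ℝ≥0, (∀ j ≤ gridIndex T Q, T j ∈ F) →
      ∫ s in Icc 0 Q, ‖stepJump K T (fun j => y (T j)) s‖ ∂(∑ s ∈ F, Measure.dirac s) ≤ C := by
    intro T hT hosc F hF
    refine hC (OrderIso.refl _) _
      (fun t => skorokhodStepValue K (fun j => y (T j)) (gridIndex T t))
      (fun t => y (T (gridIndex T t))) _ (fun t _ => ?_) (integrableOn_sum_dirac _ _ _)
      (fun t ht => ?_) (fun t _ z hz => inner_stepJump_nonneg hK hc T _ t hz) ?_
    · rw [norm_sub_rev, ← dist_eq_norm]; exact hosc t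
    · rw [setIntegral_stepJump K hT _ hF ht]; abel
    · simp only [hT.index_zero]; rfl
  have hC0 : 0 ≤ C := by
    obtain ⟨T, hT, hosc⟩ := hy.exists_grid (show 0 < r / 8 by positivity)
    exact (integral_nonneg fun _ => norm_nonneg _).trans (key T hT hosc
      ((Finset.range (gridIndex T Q + 1)).image T)
      fun j hj => Finset.mem_image_of_mem _ (by simp; omega))
  refine ⟨C, hC0, fun T hT hosc F hF => ?_, fun T T' δ δ' hT hT' hδ hδ' hosc hosc' t ht => ?_⟩
  · -- adding the remaining grid points of `[0, Q]` to `F` can only increase the integral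
    refine le_trans ?_ (key T hT hosc (F ∪ (Finset.range (gridIndex T Q + 1)).image T) fun j hj =>
      Finset.mem_union_right _ (Finset.mem_image_of_mem _ (by simp; omega)))
    rw [setIntegral_sum_dirac F _ measurableSet_Icc, setIntegral_sum_dirac _ _ measurableSet_Icc]
    refine le_trans (Finset.sum_le_sum fun s _ => ?_)
      (Finset.sum_le_sum_of_subset_of_nonneg Finset.subset_union_left fun s _ _ =>
        indicator_nonneg (fun _ _ => norm_nonneg _) _)
    exact indicator_le_indicator_of_subset (Icc_subset_Icc_right hQ) (fun _ => norm_nonneg _) s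
  · set F := (Finset.range (gridIndex T Q + 1)).image T ∪
      (Finset.range (gridIndex T' Q + 1)).image T' with hFdef
    have hF : ∀ j ≤ gridIndex T Q, T j ∈ F := fun j hj =>
      Finset.mem_union_left _ (Finset.mem_image_of_mem _ (by simp; omega))
    have hF' : ∀ j ≤ gridIndex T' Q, T' j ∈ F := fun j hj =>
      Finset.mem_union_right _ (Finset.mem_image_of_mem _ (by simp; omega))
    have hδδ : 0 ≤ δ + δ' := add_nonneg (dist_nonneg.trans (hosc 0)) (dist_nonneg.trans (hosc' 0))
    have := norm_sub_sq_le_of_monotone (μ := ∑ s ∈ F, Measure.dirac s) (q := Q) (δ := δ + δ')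
      (x₁ := fun t => skorokhodStepValue K (fun j => y (T j)) (gridIndex T t))
      (x₂ := fun t => skorokhodStepValue K (fun j => y (T' j)) (gridIndex T' t))
      (y₁ := fun t => y (T (gridIndex T t))) (y₂ := fun t => y (T' (gridIndex T' t)))
      (g₁ := stepJump K T (fun j => y (T j))) (g₂ := stepJump K T' (fun j => y (T' j)))
      (integrableOn_sum_dirac _ _ _) (integrableOn_sum_dirac _ _ _)
      (fun t ht => by rw [setIntegral_stepJump K hT _ hF ht]; abel)
      (fun t ht => by rw [setIntegral_stepJump K hT' _ hF' ht]; abel)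
      (Eventually.of_forall fun s => by
        have m1 := inner_stepJump_nonneg hK hc T (fun j => y (T j)) s
          (skorokhodStepValue_mem hK (b := fun j => y (T' j)) (by simpa [hT'.zero] using hy0)
            (gridIndex T' s))
        have m2 := inner_stepJump_nonneg hK hc T' (fun j => y (T' j)) s
          (skorokhodStepValue_mem hK (b := fun j => y (T j)) (by simpa [hT.zero] using hy0)
            (gridIndex T s))
        rw [inner_sub_right]
        rw [← neg_sub, inner_neg_left] at m1
        linarith)
      (fun t _ => by
        rw [← dist_eq_norm]
        have := dist_triangle_left (y (T (gridIndex T t))) (y (T' (gridIndex T' t))) (y t)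
        linarith [hosc t, hosc' t])
      (ht.trans hQ)
    refine this.trans ?_
    have b1 := key T hT (fun t => (hosc t).trans hδ) F hF
    have b2 := key T' hT' (fun t => (hosc' t).trans hδ') F hF'
    have : 4 * (δ + δ') * ((∫ s in Icc 0 Q, ‖stepJump K T (fun j => y (T j)) s‖
        ∂(∑ s ∈ F, Measure.dirac s)) + ∫ s in Icc 0 Q, ‖stepJump K T' (fun j => y (T' j)) s‖
        ∂(∑ s ∈ F, Measure.dirac s)) ≤ 4 * (δ + δ') * (C + C) := by gcongr
    linarith

/-- The uniform limit of the step solutions along finer and finer grids. -/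
theorem exists_limit_skorokhodStep {y : ℝ≥0 → EuclideanSpace ℝ (Fin d)} (hy : IsCadlag y)
    {K : Set (EuclideanSpace ℝ (Fin d))} (hK : IsClosed K) (hc : Convex ℝ K)
    (hy0 : y 0 ∈ K) {a : EuclideanSpace ℝ (Fin d)} {r : ℝ} (hr : 0 < r)
    (hb : Metric.closedBall a r ⊆ K) :
    ∃ x : ℝ≥0 → EuclideanSpace ℝ (Fin d), ∀ q : ℝ≥0, ∃ C : ℝ, 0 ≤ C ∧
      ∀ (T : ℕ → ℝ≥0) (δ : ℝ), IsGrid T → δ ≤ r / 8 →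
        (∀ t, dist (y t) (y (T (gridIndex T t))) ≤ δ) →
        (∀ F : Finset ℝ≥0, (∀ j ≤ gridIndex T q, T j ∈ F) →
          ∫ s in Icc 0 q, ‖stepJump K T (fun j => y (T j)) s‖ ∂(∑ s ∈ F, Measure.dirac s) ≤ C) ∧
        ∀ t ≤ q, ‖skorokhodStepValue K (fun j => y (T j)) (gridIndex T t) - x t‖ ^ 2 ≤
            δ ^ 2 + 8 * C * δ := by
  set ε : ℕ → ℝ := fun m => r / 8 * (1 / ((m : ℝ) + 1)) with hε
  have hε0 : ∀ m, 0 < ε m := fun m => mul_pos (by positivity) Nat.one_div_pos_of_nat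
  have hεle : ∀ m, ε m ≤ r / 8 := fun m => mul_le_of_le_one_right (by positivity) (by
    rw [div_le_one (by positivity)]; linarith [m.cast_nonneg (α := ℝ)])
  have hεmono : ∀ m n, m ≤ n → ε n ≤ ε m := fun m n h =>
    mul_le_mul_of_nonneg_left (Nat.one_div_le_one_div h) (by positivity)
  have hεlim : Tendsto ε atTop (𝓝 0) := by
    have := (tendsto_one_div_add_atTop_nhds_zero_nat (𝕜 := ℝ)).const_mul (r / 8)
    rwa [mul_zero] at this
  choose T hT hosc using fun m => hy.exists_grid (hε0 m)
  choose C hC0 hvar hcauchy using exists_skorokhodStep_bound hy hK hc hy0 hr hb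
  set X : ℕ → ℝ≥0 → EuclideanSpace ℝ (Fin d) := fun m t =>
    skorokhodStepValue K (fun j => y (T m j)) (gridIndex (T m) t) with hX
  have hlim : ∀ t, ∃ l, Tendsto (fun m => X m t) atTop (𝓝 l) := by
    intro t
    refine cauchySeq_tendsto_of_complete (cauchySeq_of_le_tendsto_0
      (fun N => Real.sqrt ((ε N + ε N) ^ 2 + 8 * C t * (ε N + ε N))) ?_ ?_)
    · intro n m N hn hm
      rw [dist_eq_norm]
      refine Real.le_sqrt_of_sq_le ((hcauchy t (T n) (T m) (ε N) (ε N) (hT n) (hT m) (hεle N)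
        (hεle N) (fun s => (hosc n s).trans (hεmono _ _ hn))
        (fun s => (hosc m s).trans (hεmono _ _ hm)) t le_rfl))
    · have h1 : Tendsto (fun N => (ε N + ε N) ^ 2 + 8 * C t * (ε N + ε N)) atTop
          (𝓝 ((0 + 0) ^ 2 + 8 * C t * (0 + 0))) :=
        ((hεlim.add hεlim).pow 2).add ((hεlim.add hεlim).const_mul _)
      have := h1.sqrt
      simpa using this
  choose x hx using hlim
  refine ⟨x, fun q => ⟨C q, hC0 q, fun S δ hS hδ hSosc => ⟨hvar q S hS fun t => (hSosc t).trans hδ,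
    fun t ht => ?_⟩⟩⟩
  have h1 : Tendsto (fun m => ‖skorokhodStepValue K (fun j => y (S j)) (gridIndex S t) - X m t‖ ^ 2)
      atTop (𝓝 (‖skorokhodStepValue K (fun j => y (S j)) (gridIndex S t) - x t‖ ^ 2)) :=
    ((tendsto_const_nhds.sub (hx t)).norm).pow 2
  have h2 : Tendsto (fun m => (δ + ε m) ^ 2 + 8 * C q * (δ + ε m)) atTop
      (𝓝 ((δ + 0) ^ 2 + 8 * C q * (δ + 0))) :=
    ((tendsto_const_nhds.add hεlim).pow 2).add ((tendsto_const_nhds.add hεlim).const_mul _)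
  rw [add_zero] at h2
  exact le_of_tendsto_of_tendsto' h1 h2 fun m =>
    hcauchy q S (T m) δ (ε m) hS (hT m) hδ (hεle m) hSosc (hosc m) t ht

end Step

/-! ### Passing to the limit in integrals of piecewise constant functions -/

section LowerSets
variable {E : Type*} [NormedAddCommGroup E] [InnerProductSpace ℝ E]

/-- Uniform closeness of two vector measures on all intervals `[0, t]` extends to all initial
segments, the half-open ones included. -/
theorem norm_setIntegral_sub_le_of_isLowerSet {μ ν : Measure ℝ≥0} {f g : ℝ≥0 → E} {q : ℝ≥0}
    {ε : ℝ} (hf : IntegrableOn f (Icc 0 q) μ) (hg : IntegrableOn g (Icc 0 q) ν)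
    (h : ∀ t ≤ q, ‖(∫ s in Icc 0 t, f s ∂μ) - ∫ s in Icc 0 t, g s ∂ν‖ ≤ ε)
    {J : Set ℝ≥0} (hJ : IsLowerSet J) (hJq : J ⊆ Icc 0 q) :
    ‖(∫ s in J, f s ∂μ) - ∫ s in J, g s ∂ν‖ ≤ ε := by
  have hε : 0 ≤ ε := (norm_nonneg _).trans (h 0 zero_le)
  rcases J.eq_empty_or_nonempty with rfl | hne
  · simpa using hε
  have hbdd : BddAbove J := ⟨q, fun s hs => (hJq hs).2⟩
  set w := sSup J with hw
  have hwq : w ≤ q := csSup_le hne fun s hs => (hJq hs).2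
  by_cases hwJ : w ∈ J
  · have e : J = Icc 0 w := by
      ext s
      exact ⟨fun hs => ⟨zero_le, le_csSup hbdd hs⟩, fun hs => hJ hs.2 hwJ⟩
    rw [e]; exact h w hwq
  · have e : J = Ico 0 w := by
      ext s
      constructor
      · exact fun hs => ⟨zero_le, lt_of_le_of_ne (le_csSup hbdd hs) fun h' => hwJ (h' ▸ hs)⟩
      · intro hs
        obtain ⟨t, ht, hst⟩ := exists_lt_of_lt_csSup hne hs.2
        exact hJ hst.le ht
    have hw0 : 0 < w := by
      obtain ⟨s, hs⟩ := hne
      rw [e] at hs; exact hs.1.trans_lt hs.2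
    obtain ⟨u, hu, hu', hlim⟩ := exists_seq_strictMono_tendsto' hw0
    have hU : ⋃ n, Icc 0 (u n) = Ico 0 w := by
      ext v
      simp only [mem_iUnion, mem_Icc, mem_Ico, zero_le, true_and]
      constructor
      · rintro ⟨n, h2⟩; exact h2.trans_lt (hu' n).2
      · intro h2
        obtain ⟨n, hn⟩ := (hlim.eventually (lt_mem_nhds h2)).exists
        exact ⟨n, hn.le⟩
    have hsub : Ico 0 w ⊆ Icc 0 q := e ▸ hJq
    have l1 := tendsto_setIntegral_of_monotone (μ := μ) (f := f) (s := fun n => Icc 0 (u n))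
      (fun n => measurableSet_Icc) (fun m n hmn => Icc_subset_Icc_right (hu.monotone hmn))
      (by rw [hU]; exact hf.mono_set hsub)
    have l2 := tendsto_setIntegral_of_monotone (μ := ν) (f := g) (s := fun n => Icc 0 (u n))
      (fun n => measurableSet_Icc) (fun m n hmn => Icc_subset_Icc_right (hu.monotone hmn))
      (by rw [hU]; exact hg.mono_set hsub)
    rw [hU] at l1 l2
    rw [e]
    exact le_of_tendsto' (l1.sub l2).norm fun n => h _ ((hu' n).2.le.trans hwq)

variable [CompleteSpace E]

theorem setIntegral_inner_step {μ : Measure ℝ≥0} {g : ℝ≥0 → E} {s t : ℝ≥0}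
    (hg : IntegrableOn g (Ioc s t) μ) {T : ℕ → ℝ≥0} (hT : IsGrid T) (c : ℕ → E) :
    IntegrableOn (fun u => (inner ℝ (c (gridIndex T u)) (g u) : ℝ)) (Ioc s t) μ ∧
    ∫ u in Ioc s t, inner ℝ (c (gridIndex T u)) (g u) ∂μ =
      ∑ j ∈ Finset.range (gridIndex T t + 1),
        inner ℝ (c j) (∫ u in Ioc s t ∩ Ico (T j) (T (j + 1)), g u ∂μ) := by
  have hU : Ioc s t = ⋃ j ∈ Finset.range (gridIndex T t + 1), Ioc s t ∩ Ico (T j) (T (j + 1)) := by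
    ext u
    simp only [mem_iUnion, Finset.mem_range, mem_inter_iff, exists_prop]
    refine ⟨fun hu => ⟨gridIndex T u, ?_, hu, hT.index_le u, hT.lt_succ u⟩, fun ⟨j, _, hu, _⟩ => hu⟩
    have := hT.monotone_index hu.2
    omega
  have hm : ∀ j ∈ Finset.range (gridIndex T t + 1),
      MeasurableSet (Ioc s t ∩ Ico (T j) (T (j + 1))) := fun j _ =>
    measurableSet_Ioc.inter measurableSet_Ico
  have hint : ∀ j, IntegrableOn g (Ioc s t ∩ Ico (T j) (T (j + 1))) μ := fun j =>
    hg.mono_set inter_subset_left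
  have heq : ∀ j, EqOn (fun u => (inner ℝ (c (gridIndex T u)) (g u) : ℝ))
      (fun u => (inner ℝ (c j) (g u) : ℝ)) (Ioc s t ∩ Ico (T j) (T (j + 1))) := fun j u hu => by
    simp only [hT.index_eq hu.2.1 hu.2.2]
  have hi : ∀ j ∈ Finset.range (gridIndex T t + 1),
      IntegrableOn (fun u => (inner ℝ (c (gridIndex T u)) (g u) : ℝ))
        (Ioc s t ∩ Ico (T j) (T (j + 1))) μ := fun j hj =>
    (integrableOn_congr_fun (heq j) (hm j hj)).2 ((hint j).const_inner (c j))
  constructor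
  · rw [hU]; exact (integrableOn_finset_iUnion).2 hi
  · conv_lhs => rw [hU]
    rw [integral_biUnion_finset _ hm ?_ hi]
    · refine Finset.sum_congr rfl fun j hj => ?_
      rw [setIntegral_congr_fun (hm j hj) (heq j), integral_inner (hint j)]
    · intro i _ j _ hij
      refine Set.disjoint_left.2 fun u hu hu' => hij ?_
      rw [← hT.index_eq hu.2.1 hu.2.2, ← hT.index_eq hu'.2.1 hu'.2.2]

/-- Uniform convergence of the distribution functions implies convergence of the integrals of
functions that are piecewise constant on a grid. -/
theorem tendsto_setIntegral_inner_step {μ : ℕ → Measure ℝ≥0} {ν : Measure ℝ≥0} {f : ℕ → ℝ≥0 → E}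
    {g : ℝ≥0 → E} {q : ℝ≥0} {ε : ℕ → ℝ} (hε : Tendsto ε atTop (𝓝 0))
    (hf : ∀ m, IntegrableOn (f m) (Icc 0 q) (μ m)) (hg : IntegrableOn g (Icc 0 q) ν)
    (h : ∀ m, ∀ t ≤ q, ‖(∫ s in Icc 0 t, f m s ∂(μ m)) - ∫ s in Icc 0 t, g s ∂ν‖ ≤ ε m)
    {T : ℕ → ℝ≥0} (hT : IsGrid T) (c : ℕ → E) {s t : ℝ≥0} (ht : t ≤ q) :
    Tendsto (fun m => ∫ u in Ioc s t, inner ℝ (c (gridIndex T u)) (f m u) ∂(μ m)) atTop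
      (𝓝 (∫ u in Ioc s t, inner ℝ (c (gridIndex T u)) (g u) ∂ν)) := by
  have hsub : Ioc s t ⊆ Icc 0 q := (Ioc_subset_Icc_zero s t).trans (Icc_subset_Icc_right ht)
  rw [(setIntegral_inner_step (hg.mono_set hsub) hT c).2]
  simp only [fun m => (setIntegral_inner_step ((hf m).mono_set hsub) hT c).2]
  refine tendsto_finsetSum _ fun j _ => tendsto_const_nhds.inner ?_
  -- the interval is a difference of two initial segments
  set J₁ : Set ℝ≥0 := Icc 0 t ∩ Iio (T (j + 1)) with hJ₁
  set J₂ : Set ℝ≥0 := J₁ ∩ (Iic s ∪ Iio (T j)) with hJ₂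
  have hJ : Ioc s t ∩ Ico (T j) (T (j + 1)) = J₁ \ J₂ := by
    ext u
    simp only [hJ₁, hJ₂, mem_inter_iff, mem_Ioc, mem_Ico, Set.mem_sdiff, mem_Icc, mem_Iio,
      mem_union, mem_Iic, zero_le, true_and, not_and, not_or, not_le, not_lt]
    tauto
  have hm₂ : MeasurableSet J₂ := by measurability
  have hl₁ : IsLowerSet J₁ := fun u v hvu hu => ⟨⟨zero_le, hvu.trans hu.1.2⟩, hvu.trans_lt hu.2⟩
  have hl₂ : IsLowerSet J₂ := fun u v hvu hu =>
    ⟨hl₁ hvu hu.1, hu.2.imp (fun h => hvu.trans h) fun h => hvu.trans_lt h⟩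
  have hs₁ : J₁ ⊆ Icc 0 q := inter_subset_left.trans (Icc_subset_Icc_right ht)
  have hs₂ : J₂ ⊆ Icc 0 q := inter_subset_left.trans hs₁
  have hconv : ∀ J, IsLowerSet J → J ⊆ Icc 0 q →
      Tendsto (fun m => ∫ u in J, f m u ∂(μ m)) atTop (𝓝 (∫ u in J, g u ∂ν)) := fun J hJ hJq => by
    rw [tendsto_iff_norm_sub_tendsto_zero]
    exact squeeze_zero (fun _ => norm_nonneg _)
      (fun m => norm_setIntegral_sub_le_of_isLowerSet (hf m) hg (h m) hJ hJq) hε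
  rw [hJ, setIntegral_sdiff hm₂ (hg.mono_set hs₁) inter_subset_left]
  simp only [fun m => setIntegral_sdiff hm₂ ((hf m).mono_set hs₁) inter_subset_left]
  exact (hconv J₁ hl₁ hs₁).sub (hconv J₂ hl₂ hs₂)

end LowerSets

/-! ### Existence and uniqueness for the Skorokhod problem -/

section Normals
variable {d : ℕ}

/-- An inward unit normal at a point of `closure D` forces this point to be on the boundary. -/
theorem mem_frontier_of_inner_nonneg {D : Set (EuclideanSpace ℝ (Fin d))} (hopen : IsOpen D)
    {x n : EuclideanSpace ℝ (Fin d)} (hx : x ∈ closure D) (hn : ‖n‖ = 1)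
    (h : ∀ z ∈ closure D, 0 ≤ inner ℝ (z - x) n) : x ∈ frontier D := by
  refine ⟨hx, fun hxi => ?_⟩
  rw [hopen.interior_eq] at hxi
  obtain ⟨ε, hε, hball⟩ := Metric.isOpen_iff.1 hopen x hxi
  have hz : x - (ε / 2) • n ∈ D := hball (by
    rw [Metric.mem_ball, dist_eq_norm, sub_sub_cancel_left, norm_neg, norm_smul, hn, mul_one,
      Real.norm_of_nonneg (by positivity)]
    linarith)
  have := h _ (subset_closure hz)
  rw [sub_sub_cancel_left, inner_neg_left, real_inner_smul_left, real_inner_self_eq_norm_sq, hn]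
    at this
  linarith

/-- Supporting hyperplanes exist at every boundary point. -/
theorem exists_mem_inwardUnitNormals {D : Set (EuclideanSpace ℝ (Fin d))} (hne : D.Nonempty)
    (hconv : Convex ℝ D) (hopen : IsOpen D) {x : EuclideanSpace ℝ (Fin d)} (hx : x ∈ frontier D) :
    (inwardUnitNormals D x).Nonempty := by
  have hxD : x ∉ D := fun h => hx.2 (by rwa [hopen.interior_eq])
  obtain ⟨f, hf⟩ := geometric_hahn_banach_open_point hconv hopen hxD
  set v := (InnerProductSpace.toDual ℝ (EuclideanSpace ℝ (Fin d))).symm f with hv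
  have hfv : ∀ z, f z = inner ℝ v z := fun z => (InnerProductSpace.toDual_symm_apply).symm
  have hv0 : v ≠ 0 := by
    rintro h
    obtain ⟨z, hz⟩ := hne
    have := hf z hz
    simp [hfv, h] at this
  refine ⟨-(‖v‖⁻¹ • v), ?_, fun z hz => ?_⟩
  · rw [norm_neg, norm_smul, norm_inv, norm_norm, inv_mul_cancel₀ (norm_ne_zero_iff.2 hv0)]
  · have hle : f z ≤ f x := closure_minimal (fun z hz => (hf z hz).le)
      (isClosed_le f.continuous continuous_const) hz
    rw [inner_neg_right, real_inner_smul_right, neg_nonneg, real_inner_comm, inner_sub_right,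
      ← hfv, ← hfv]
    exact mul_nonpos_of_nonneg_of_nonpos (by positivity) (by linarith)

/-- A solution of the Skorokhod problem from the variational inequality satisfied by the polar
decomposition of the reflection term. Unit vectors satisfying the inequality are inward normals at a
boundary point, so the support condition comes for free; on the exceptional null set the normal is
replaced by an arbitrary inward normal. -/
theorem isSkorokhodSolution_of_inner_nonneg {D : Set (EuclideanSpace ℝ (Fin d))} (hne : D.Nonempty)
    (hconv : Convex ℝ D) (hopen : IsOpen D) {y x k : SkorokhodSpace d}
    (hxy : ∀ t, x t = y t + k t) (hxD : ∀ t, x t ∈ closure D)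
    (hk : LocallyBoundedVariationOn k univ) (hk0 : k 0 = 0) {μ : Measure ℝ≥0}
    {n : ℝ≥0 → EuclideanSpace ℝ (Fin d)} (hμ : IsVariationMeasure k μ) (hn : StronglyMeasurable n)
    (hkn : ∀ t, IntegrableOn n (Icc 0 t) μ ∧ k t = ∫ s in Icc 0 t, n s ∂μ)
    (hn1 : ∀ᵐ s ∂μ, ‖n s‖ = 1)
    (hin : ∀ᵐ s ∂μ, ∀ z ∈ closure D, 0 ≤ inner ℝ (z - x s) (n s)) :
    IsSkorokhodSolution D y x k := by
  classical
  have hgood : ∀ᵐ s ∂μ, x s ∈ frontier D ∧ n s ∈ inwardUnitNormals D (x s) := by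
    filter_upwards [hn1, hin] with s h1 h2
    exact ⟨mem_frontier_of_inner_nonneg hopen (hxD s) h1 h2, h1, h2⟩
  choose! N hN using fun (v : EuclideanSpace ℝ (Fin d)) (hv : v ∈ frontier D) =>
    exists_mem_inwardUnitNormals hne hconv hopen hv
  set n' : ℝ≥0 → EuclideanSpace ℝ (Fin d) := fun s =>
    if n s ∈ inwardUnitNormals D (x s) then n s else N (x s) with hn'
  have hae : n =ᵐ[μ] n' := by
    filter_upwards [hgood] with s hs
    simp only [hn', if_pos hs.2]
  refine ⟨hxy, hxD, hk, hk0, μ, n', hμ, hn.aestronglyMeasurable.congr hae, fun s hs => ?_,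
    fun t => ⟨(hkn t).1.congr (ae_restrict_of_ae hae), ?_⟩, fun t => ?_⟩
  · simp only [hn']
    split_ifs with h
    · exact h
    · exact hN _ hs
  · rw [(hkn t).2]
    exact integral_congr_ae (ae_restrict_of_ae hae)
  · rw [← hμ.2 t, ← setLIntegral_one]
    refine lintegral_congr_ae (ae_restrict_of_ae ?_)
    filter_upwards [hgood] with s hs
    rw [indicator_of_mem (show s ∈ {s | x s ∈ frontier D} from hs.1)]

/-- The variational inequality satisfied by the reflection term of a solution. -/
theorem IsSkorokhodSolution.exists_measure {D : Set (EuclideanSpace ℝ (Fin d))}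
    {y x k : SkorokhodSpace d} (h : IsSkorokhodSolution D y x k) :
    ∃ (μ : Measure ℝ≥0) (n : ℝ≥0 → EuclideanSpace ℝ (Fin d)), IsLocallyFiniteMeasure μ ∧
      (∀ t, IntegrableOn n (Icc 0 t) μ ∧ x t = y t + ∫ s in Icc 0 t, n s ∂μ) ∧
      ∀ᵐ s ∂μ, ∀ z ∈ closure D, 0 ≤ inner ℝ (z - x s) (n s) := by
  obtain ⟨hxy, hxD, hk, hk0, μ, n, hμ, hnm, hn, hkn, hvar⟩ := h
  refine ⟨μ, n, hμ.1, fun t => ⟨(hkn t).1, by rw [hxy, (hkn t).2]⟩, ?_⟩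
  refine ae_of_ae_restrict_Icc fun t => ?_
  set A : Set ℝ≥0 := {s | x s ∈ frontier D} with hA
  have hAm : MeasurableSet A := x.isCadlag'.measurable isClosed_frontier.measurableSet
  have hfin : μ (Icc 0 t) ≠ ∞ := (measure_Icc_lt_top_of_isLocallyFinite hμ.1 0 t).ne
  have h1 : (μ.restrict (Icc 0 t)) A = μ.restrict (Icc 0 t) univ := by
    rw [Measure.restrict_apply_univ, hμ.2 t, hvar t, lintegral_indicator hAm, lintegral_one,
      Measure.restrict_apply_univ]
  have : IsFiniteMeasure (μ.restrict (Icc 0 t)) := ⟨by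
    rw [Measure.restrict_apply_univ]; exact hfin.lt_top⟩
  have h2 : ∀ᵐ s ∂μ.restrict (Icc 0 t), s ∈ A := by
    rw [ae_iff]
    exact (measure_compl hAm (measure_ne_top _ _)).trans (by rw [h1, tsub_self])
  filter_upwards [h2] with s hs z hz
  exact (hn s hs).2 z hz

theorem IsSkorokhodSolution.unique {D : Set (EuclideanSpace ℝ (Fin d))}
    {y x k x' k' : SkorokhodSpace d} (h : IsSkorokhodSolution D y x k)
    (h' : IsSkorokhodSolution D y x' k') : x' = x ∧ k' = k := by
  have key : ∀ t, x' t = x t := by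
    obtain ⟨μ, n, hμ, hn, hin⟩ := h.exists_measure
    obtain ⟨μ', n', hμ', hn', hin'⟩ := h'.exists_measure
    have hac : μ ≪ μ + μ' := Measure.absolutelyContinuous_of_le (Measure.le_add_right le_rfl)
    have hac' : μ' ≪ μ + μ' := Measure.absolutelyContinuous_of_le (Measure.le_add_left le_rfl)
    -- both solutions are written as integrals with respect to the sum of the two measures
    have dens : ∀ (ρ : Measure ℝ≥0) (m : ℝ≥0 → EuclideanSpace ℝ (Fin d)) (w : SkorokhodSpace d),
        IsLocallyFiniteMeasure ρ → ρ ≪ μ + μ' →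
        (∀ t, IntegrableOn m (Icc 0 t) ρ ∧ w t = y t + ∫ s in Icc 0 t, m s ∂ρ) →
        (∀ᵐ s ∂ρ, ∀ z ∈ closure D, 0 ≤ inner ℝ (z - w s) (m s)) →
        ∃ g : ℝ≥0 → EuclideanSpace ℝ (Fin d),
          (∀ t, IntegrableOn g (Icc 0 t) (μ + μ') ∧
            w t = y t + ∫ s in Icc 0 t, g s ∂(μ + μ')) ∧
          ∀ᵐ s ∂(μ + μ'), ∀ z ∈ closure D, 0 ≤ inner ℝ (z - w s) (g s) := by
      intro ρ m w hρ hac hm hin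
      have hind : ∀ t, (Icc 0 t).indicator (fun s => (ρ.rnDeriv (μ + μ') s).toReal • m s) =
          fun s => (ρ.rnDeriv (μ + μ') s).toReal • (Icc 0 t).indicator m s := fun t => by
        ext1 s; rw [indicator_smul_apply]
      refine ⟨fun s => (ρ.rnDeriv (μ + μ') s).toReal • m s, fun t => ⟨?_, ?_⟩, ?_⟩
      · rw [← integrable_indicator_iff measurableSet_Icc, hind t, integrable_rnDeriv_smul_iff hac,
          integrable_indicator_iff measurableSet_Icc]
        exact (hm t).1
      · rw [(hm t).2, ← integral_indicator
          (f := fun s => (ρ.rnDeriv (μ + μ') s).toReal • m s) measurableSet_Icc, hind t,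
          integral_rnDeriv_smul hac, integral_indicator measurableSet_Icc]
      · have e := Measure.withDensity_rnDeriv_eq ρ (μ + μ') hac
        rw [← e, ae_withDensity_iff (Measure.measurable_rnDeriv _ _)] at hin
        filter_upwards [hin] with s hs z hz
        rw [inner_smul_right]
        rcases eq_or_ne (ρ.rnDeriv (μ + μ') s) 0 with h0 | h0
        · simp [h0]
        · exact mul_nonneg ENNReal.toReal_nonneg (hs h0 z hz)
    obtain ⟨g, hg, hgin⟩ := dens μ n x hμ hac hn hin
    obtain ⟨g', hg', hgin'⟩ := dens μ' n' x' hμ' hac' hn' hin'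
    intro t
    have := norm_sub_sq_le_of_monotone (δ := 0) (hg' t).1 (hg t).1 (fun s _ => (hg' s).2)
      (fun s _ => (hg s).2) (ae_restrict_of_ae (by
        filter_upwards [hgin, hgin'] with s h1 h2
        have a1 := h1 _ (h'.2.1 s)
        have a2 := h2 _ (h.2.1 s)
        rw [← neg_sub, inner_neg_left] at a2
        rw [inner_sub_right]; linarith)) (fun s _ => by rw [sub_self, norm_zero]) le_rfl
    have h0 : ‖x' t - x t‖ ^ 2 ≤ 0 := by simpa using this
    exact sub_eq_zero.1 (norm_eq_zero.1 (pow_eq_zero_iff two_ne_zero |>.1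
      (le_antisymm h0 (by positivity))))
  have hx : x' = x := by
    cases x; cases x'; congr 1; exact funext key
  refine ⟨hx, ?_⟩
  have hk : ∀ t, k' t = k t := fun t => by
    have h1 := h.1 t
    have h2 := h'.1 t
    rw [key t, h1] at h2
    exact (add_left_cancel h2).symm
  cases k; cases k'; congr 1; exact funext hk

end Normals

section Existence
variable {d : ℕ}

theorem continuousWithinAt_of_uniform_limit {E : Type*} [NormedAddCommGroup E] {f : ℝ≥0 → E}
    {t : ℝ≥0}
    (h : ∀ ε > 0, ∃ g : ℝ≥0 → E, ContinuousWithinAt g (Ici t) t ∧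
      ∀ s ≤ t + 1, ‖g s - f s‖ ≤ ε) : ContinuousWithinAt f (Ici t) t := by
  rw [ContinuousWithinAt, Metric.tendsto_nhds]
  intro ε hε
  obtain ⟨g, hg, hgf⟩ := h (ε / 4) (by positivity)
  filter_upwards [(Metric.tendsto_nhds.1 hg) (ε / 4) (by positivity),
    mem_nhdsWithin_of_mem_nhds (Iio_mem_nhds (show t < t + 1 by simp))] with s hs hs'
  have h1 := hgf s (le_of_lt hs')
  have h2 := hgf t (by simp)
  rw [← dist_eq_norm] at h1 h2
  rw [dist_comm] at h1
  linarith [dist_triangle4 (f s) (g s) (g t) (f t)]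

theorem IsGrid.continuousWithinAt_comp_index {E : Type*} [TopologicalSpace E] {T : ℕ → ℝ≥0}
    (hT : IsGrid T) (c : ℕ → E) (t : ℝ≥0) :
    ContinuousWithinAt (fun s => c (gridIndex T s)) (Ici t) t :=
  tendsto_const_nhds.congr' ((hT.eventually_index_eq t).mono fun s hs => by simp only [hs])

/-- Existence for the Skorokhod problem; the solution is approximated, uniformly on compact
intervals, by the step solutions. -/
theorem exists_skorokhodSolution {D : Set (EuclideanSpace ℝ (Fin d))} (hne : D.Nonempty)
    (hconv : Convex ℝ D) (hopen : IsOpen D) (y : SkorokhodSpace d) (hy0 : y 0 ∈ closure D) :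
    ∃ x k : SkorokhodSpace d, IsSkorokhodSolution D y x k ∧ ∀ q : ℝ≥0, ∃ C δ₀ : ℝ, 0 ≤ C ∧ 0 < δ₀ ∧
      ∀ (T : ℕ → ℝ≥0) (δ : ℝ), IsGrid T → δ ≤ δ₀ →
        (∀ t, dist (y t) (y (T (gridIndex T t))) ≤ δ) →
        ∀ t ≤ q, ‖skorokhodStepValue (closure D) (fun j => y (T j)) (gridIndex T t) - x t‖ ^ 2 ≤
          δ ^ 2 + 8 * C * δ := by
  obtain ⟨a, ha⟩ := hne
  obtain ⟨r₀, hr₀, hball⟩ := Metric.isOpen_iff.1 hopen a ha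
  set K := closure D with hKdef
  have hK : IsClosed K := isClosed_closure
  have hc : Convex ℝ K := hconv.closure
  set r := r₀ / 2 with hrdef
  have hr : 0 < r := by positivity
  have hb : Metric.closedBall a r ⊆ K :=
    (Metric.closedBall_subset_ball (by rw [hrdef]; linarith)).trans (hball.trans subset_closure)
  obtain ⟨X, hX⟩ := exists_limit_skorokhodStep y.isCadlag' hK hc hy0 hr hb
  choose C hC0 hC using hX
  -- step solutions along grids on whose intervals the oscillation of `y` tends to zero
  set ε : ℕ → ℝ := fun m => r / 8 * (1 / ((m : ℝ) + 1)) with hε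
  have hε0 : ∀ m, 0 < ε m := fun m => mul_pos (by positivity) Nat.one_div_pos_of_nat
  have hεle : ∀ m, ε m ≤ r / 8 := fun m => mul_le_of_le_one_right (by positivity) (by
    rw [div_le_one (by positivity)]; linarith [m.cast_nonneg (α := ℝ)])
  have hεlim : Tendsto ε atTop (𝓝 0) := by
    have := (tendsto_one_div_add_atTop_nhds_zero_nat (𝕜 := ℝ)).const_mul (r / 8)
    rwa [mul_zero] at this
  choose T hT hosc using fun m => y.isCadlag'.exists_grid (hε0 m)
  set c : ℕ → ℕ → EuclideanSpace ℝ (Fin d) := fun m =>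
    skorokhodStepValue K (fun j => y (T m j)) with hcdef
  set η : ℝ≥0 → ℕ → ℝ := fun q m => Real.sqrt (ε m ^ 2 + 8 * C q * ε m) with hη
  have hηlim : ∀ q, Tendsto (η q) atTop (𝓝 0) := fun q => by
    have := ((hεlim.pow 2).add (hεlim.const_mul (8 * C q))).sqrt
    simpa using this
  have hXη : ∀ q m, ∀ t ≤ q, ‖c m (gridIndex (T m) t) - X t‖ ≤ η q m := fun q m t ht =>
    Real.le_sqrt_of_sq_le ((hC q (T m) (ε m) (hT m) (hεle m) (hosc m)).2 t ht)
  have hptw : ∀ t, Tendsto (fun m => c m (gridIndex (T m) t)) atTop (𝓝 (X t)) := fun t => by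
    rw [tendsto_iff_norm_sub_tendsto_zero]
    exact squeeze_zero (fun _ => norm_nonneg _) (fun m => hXη t m t le_rfl) (hηlim t)
  have hyptw : ∀ t, Tendsto (fun m => y (T m (gridIndex (T m) t))) atTop (𝓝 (y t)) := fun t => by
    rw [tendsto_iff_dist_tendsto_zero]
    refine squeeze_zero (fun _ => dist_nonneg) (fun m => ?_) hεlim
    rw [dist_comm]; exact hosc m t
  have hXK : ∀ t, X t ∈ K := fun t => hK.mem_of_tendsto (hptw t) (Eventually.of_forall fun m =>
    skorokhodStepValue_mem hK (by simpa [(hT m).zero] using hy0) _)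
  have hXc : ∀ t, ContinuousWithinAt X (Ici t) t := fun t =>
    continuousWithinAt_of_uniform_limit fun e he => by
      obtain ⟨m, hm⟩ := ((hηlim (t + 1)).eventually (gt_mem_nhds he)).exists
      exact ⟨_, (hT m).continuousWithinAt_comp_index (c m) t,
        fun s hs => (hXη (t + 1) m s hs).trans hm.le⟩
  set k : ℝ≥0 → EuclideanSpace ℝ (Fin d) := fun t => X t - y t with hk
  have hkc : ∀ t, ContinuousWithinAt k (Ici t) t := fun t => (hXc t).sub (y.isCadlag' t).1
  have hk0 : k 0 = 0 := by
    have h0 : ∀ m, c m (gridIndex (T m) 0) = y 0 := fun m => by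
      rw [(hT m).index_zero]
      simp only [hcdef, skorokhodStepValue, (hT m).zero]
    have : X 0 = y 0 := tendsto_nhds_unique (hptw 0) (by simp only [h0]; exact tendsto_const_nhds)
    rw [hk]; simp only; rw [this, sub_self]
  set F : ℝ≥0 → ℕ → Finset ℝ≥0 := fun q m =>
    (Finset.range (gridIndex (T m) q + 1)).image (T m) with hF
  have hFm : ∀ q m, ∀ j ≤ gridIndex (T m) q, T m j ∈ F q m := fun q m j hj =>
    Finset.mem_image_of_mem _ (by simp; omega)
  have hCint : ∀ q m, ∫ s in Icc 0 q, ‖stepJump K (T m) (fun j => y (T m j)) s‖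
      ∂(∑ s ∈ F q m, Measure.dirac s) ≤ C q := fun q m =>
    (hC q (T m) (ε m) (hT m) (hεle m) (hosc m)).1 _ (hFm q m)
  have hkvar : ∀ q, eVariationOn k (Icc 0 q) ≤ ENNReal.ofReal (C q) := by
    intro q
    by_contra! hlt
    have hpt : ∀ t ∈ Icc 0 q, Tendsto
        (fun m => c m (gridIndex (T m) t) - y (T m (gridIndex (T m) t))) atTop (𝓝 (k t)) :=
      fun t _ => (hptw t).sub (hyptw t)
    obtain ⟨m, hm⟩ := (eVariationOn.lowerSemicontinuous_aux
      (F := fun m t => c m (gridIndex (T m) t) - y (T m (gridIndex (T m) t))) hpt hlt).exists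
    refine absurd hm (not_lt.2 ?_)
    refine (eVariationOn_le_integral_norm (integrableOn_sum_dirac (F q m) _ _) fun t ht =>
      (setIntegral_stepJump K (hT m) (fun j => y (T m j)) (hFm q m) ht).symm).trans
      (ENNReal.ofReal_le_ofReal (hCint q m))
  have hkbv : LocallyBoundedVariationOn k univ := fun a b _ _ =>
    ne_top_of_le_ne_top ENNReal.ofReal_ne_top ((eVariationOn.mono k
      (show univ ∩ Icc a b ⊆ Icc 0 b from fun t ht => ⟨zero_le, ht.2.2⟩)).trans (hkvar b))
  have hkl : ∀ t, ∃ l, Tendsto k (𝓝[<] t) (𝓝 l) := fun t => by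
    have h1 : BoundedVariationOn k (Icc 0 t) := by
      have := hkbv 0 t (mem_univ _) (mem_univ _)
      rwa [univ_inter] at this
    obtain ⟨l, hl⟩ := h1.exists_tendsto_left t
    have e : Icc 0 t ∩ Iio t = Iio t := by
      ext s; simp only [mem_inter_iff, mem_Icc, mem_Iio, zero_le, true_and, and_iff_right_iff_imp]
      exact le_of_lt
    rw [e] at hl
    exact ⟨l, hl⟩
  have hXcad : IsCadlag X := fun t => ⟨hXc t, by
    obtain ⟨l, hl⟩ := hkl t
    obtain ⟨l', hl'⟩ := (y.isCadlag' t).2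
    refine ⟨l + l', (hl.add hl').congr fun s => ?_⟩
    simp [hk]⟩
  obtain ⟨μ, n, hμ, hnm, hn, hn1⟩ := exists_polar_decomposition hkbv hkc hk0
  have hμ0 : μ {0} = 0 := by
    rw [← Icc_self, hμ.2, variationUpTo, Icc_self]
    exact eVariationOn.subsingleton k subsingleton_singleton
  have hμfin : ∀ t, μ (Icc 0 t) ≠ ∞ := fun t => (measure_Icc_lt_top_of_isLocallyFinite hμ.1 0 t).ne
  have hnle : ∀ᵐ s ∂μ, ‖n s‖ ≤ 1 := hn1.mono fun s hs => hs.le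
  -- integrability of bounded functions against `n dμ`
  have hint : ∀ (f : ℝ≥0 → EuclideanSpace ℝ (Fin d)), IsCadlag f → ∀ t,
      IntegrableOn (fun s => (inner ℝ (f s) (n s) : ℝ)) (Icc 0 t) μ := by
    intro f hf t
    obtain ⟨M, hM⟩ := hf.exists_dist_le t
    refine IntegrableOn.of_bound (hμfin t).lt_top
      (hf.measurable.inner hnm.measurable).aestronglyMeasurable (M + ‖f 0‖) ?_
    filter_upwards [ae_restrict_mem measurableSet_Icc, ae_restrict_of_ae hn1] with s hs hs1
    have h1 := hM s hs.2
    rw [dist_eq_norm] at h1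
    calc ‖inner ℝ (f s) (n s)‖ ≤ ‖f s‖ * ‖n s‖ := norm_inner_le_norm _ _
      _ = ‖(f s - f 0) + f 0‖ := by rw [hs1, mul_one, sub_add_cancel]
      _ ≤ M + ‖f 0‖ := (norm_add_le _ _).trans (by linarith)
  have hvi : ∀ z ∈ K, ∀ s t, s ≤ t → 0 ≤ ∫ u in Ioc s t, inner ℝ (z - X u) (n u) ∂μ := by
    intro z hz s t hst
    have hsub := Ioc_subset_Icc_zero s t
    have hzcad : IsCadlag fun u => z - X u := fun u =>
      ⟨continuousWithinAt_const.sub (hXcad u).1, by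
        obtain ⟨l, hl⟩ := (hXcad u).2
        exact ⟨z - l, tendsto_const_nhds.sub hl⟩⟩
    -- comparison with the step function `c m₀`, in the limit `m → ∞`
    have key : ∀ m₀, -(C t * η t m₀) - μ.real (Icc 0 t) * η t m₀ ≤
        ∫ u in Ioc s t, inner ℝ (z - X u) (n u) ∂μ := by
      intro m₀
      set ψ : ℝ≥0 → EuclideanSpace ℝ (Fin d) := fun u => z - c m₀ (gridIndex (T m₀) u) with hψ
      have hstepn := setIntegral_inner_step ((hn t).1.mono_set hsub) (hT m₀) (fun j => z - c m₀ j)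
      have hlimψ := tendsto_setIntegral_inner_step (q := t) (s := s) (t := t)
        (μ := fun m => ∑ s ∈ F t m, Measure.dirac s)
        (f := fun m => stepJump K (T m) (fun j => y (T m j)))
        (ε := fun m => η t m + ε m) (by simpa using (hηlim t).add hεlim)
        (fun m => integrableOn_sum_dirac _ _ _) (hn t).1 (fun m u hu => by
          rw [setIntegral_stepJump K (hT m) (fun j => y (T m j)) (hFm t m) hu, ← (hn u).2]
          have h1 := hXη t m u hu
          have h2 := hosc m u
          rw [dist_eq_norm] at h2
          rw [show skorokhodStepValue K (fun j => y (T m j)) (gridIndex (T m) u)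
            - y (T m (gridIndex (T m) u)) - k u =
            (c m (gridIndex (T m) u) - X u) + (y u - y (T m (gridIndex (T m) u))) by
              rw [hk, hcdef]; simp only; abel]
          exact (norm_add_le _ _).trans (add_le_add h1 h2)) (hT m₀) (fun j => z - c m₀ j) le_rfl
      have hlow : ∀ m, -(C t * (η t m + η t m₀)) ≤
          ∫ u in Ioc s t, inner ℝ (z - c m₀ (gridIndex (T m₀) u))
            (stepJump K (T m) (fun j => y (T m j)) u) ∂(∑ s ∈ F t m, Measure.dirac s) := by
        intro m
        set g := stepJump K (T m) (fun j => y (T m j)) with hg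
        set P : Measure ℝ≥0 := ∑ s ∈ F t m, Measure.dirac s with hP
        have i1 : IntegrableOn (fun u => -((η t m + η t m₀) * ‖g u‖)) (Ioc s t) P :=
          integrableOn_sum_dirac _ _ _
        have h1 : ∫ u in Ioc s t, -((η t m + η t m₀) * ‖g u‖) ∂P ≤
            ∫ u in Ioc s t, inner ℝ (z - c m₀ (gridIndex (T m₀) u)) (g u) ∂P := by
          refine setIntegral_mono_on i1 (integrableOn_sum_dirac _ _ _) measurableSet_Ioc
            fun u hu => ?_
          have b1 := inner_stepJump_nonneg hK hc (T m) (fun j => y (T m j)) u hz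
          have b2 : ‖c m (gridIndex (T m) u) - c m₀ (gridIndex (T m₀) u)‖ ≤ η t m + η t m₀ := by
            rw [← sub_sub_sub_cancel_right _ _ (X u)]
            exact (norm_sub_le _ _).trans (add_le_add (hXη t m u hu.2) (hXη t m₀ u hu.2))
          have b3 := neg_le_of_abs_le (abs_real_inner_le_norm
            (c m (gridIndex (T m) u) - c m₀ (gridIndex (T m₀) u)) (g u))
          have b4 := mul_le_mul_of_nonneg_right b2 (norm_nonneg (g u))
          rw [show z - c m₀ (gridIndex (T m₀) u) = (z - c m (gridIndex (T m) u)) +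
            (c m (gridIndex (T m) u) - c m₀ (gridIndex (T m₀) u)) by abel, inner_add_left]
          have b5 : 0 ≤ inner ℝ (z - c m (gridIndex (T m) u)) (g u) := b1
          linarith
        refine le_trans ?_ h1
        rw [integral_neg, integral_const_mul, neg_le_neg_iff, mul_comm (C t)]
        have hη0 : 0 ≤ η t m + η t m₀ := add_nonneg (Real.sqrt_nonneg _) (Real.sqrt_nonneg _)
        refine mul_le_mul_of_nonneg_left (le_trans ?_ (hCint t m)) hη0
        exact setIntegral_mono_set (integrableOn_sum_dirac _ _ _)
          (Eventually.of_forall fun _ => norm_nonneg _) (Eventually.of_forall hsub)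
      have hlim2 : Tendsto (fun m => -(C t * (η t m + η t m₀))) atTop
          (𝓝 (-(C t * (0 + η t m₀)))) :=
        (((hηlim t).add tendsto_const_nhds).const_mul _).neg
      have h3 := le_of_tendsto_of_tendsto' hlim2 hlimψ hlow
      rw [zero_add] at h3
      -- replacing the step function by `X`
      have i2 : IntegrableOn (fun _ => η t m₀) (Ioc s t) μ :=
        integrableOn_const (measure_ne_top_of_subset hsub (hμfin t))
      have h4 : ∫ u in Ioc s t, (inner ℝ (z - c m₀ (gridIndex (T m₀) u)) (n u) - η t m₀) ∂μ ≤
          ∫ u in Ioc s t, inner ℝ (z - X u) (n u) ∂μ := by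
        refine integral_mono_ae (hstepn.1.sub i2) ((hint _ hzcad t).mono_set hsub) ?_
        filter_upwards [ae_restrict_mem measurableSet_Ioc, ae_restrict_of_ae hn1] with u hu hu1
        have b1 := hXη t m₀ u hu.2
        have b2 := neg_le_of_abs_le (abs_real_inner_le_norm
          (c m₀ (gridIndex (T m₀) u) - X u) (n u))
        rw [hu1, mul_one] at b2
        rw [show z - X u = (z - c m₀ (gridIndex (T m₀) u)) +
          (c m₀ (gridIndex (T m₀) u) - X u) by abel, inner_add_left]
        linarith
      rw [integral_sub hstepn.1 i2, setIntegral_const, smul_eq_mul] at h4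
      have h5 : μ.real (Ioc s t) * η t m₀ ≤ μ.real (Icc 0 t) * η t m₀ :=
        mul_le_mul_of_nonneg_right (measureReal_mono hsub (hμfin t)) (Real.sqrt_nonneg _)
      linarith
    have hl : Tendsto (fun m₀ => -(C t * η t m₀) - μ.real (Icc 0 t) * η t m₀) atTop
        (𝓝 (-(C t * 0) - μ.real (Icc 0 t) * 0)) :=
      ((hηlim t).const_mul _).neg.sub ((hηlim t).const_mul _)
    simp only [mul_zero, neg_zero, sub_zero] at hl
    exact le_of_tendsto' hl key
  have hin : ∀ᵐ s ∂μ, ∀ z ∈ K, 0 ≤ inner ℝ (z - X s) (n s) := by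
    obtain ⟨S, hSsub, hScount, hSdense⟩ :=
      (TopologicalSpace.IsSeparable.of_separableSpace K).exists_countable_dense_subset
    have h1 : ∀ z ∈ S, ∀ᵐ s ∂μ, 0 ≤ (inner ℝ (z - X s) (n s) : ℝ) := fun z hz => by
      have hzcad : IsCadlag fun u => z - X u := fun u =>
        ⟨continuousWithinAt_const.sub (hXcad u).1, by
          obtain ⟨l, hl⟩ := (hXcad u).2
          exact ⟨z - l, tendsto_const_nhds.sub hl⟩⟩
      exact ae_nonneg_of_setIntegral_Ioc_of_integrableOn (hint _ hzcad) hμ0 (hvi z (hSsub hz))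
    filter_upwards [(ae_ball_iff hScount).2 h1] with s hs z hz
    exact closure_minimal (t := {z | 0 ≤ (inner ℝ (z - X s) (n s) : ℝ)}) hs
      (isClosed_le continuous_const (by fun_prop)) (hSdense hz)
  refine ⟨⟨X, hXcad⟩, ⟨k, fun t => ⟨hkc t, hkl t⟩⟩, ?_, fun q => ⟨C q, r / 8, hC0 q,
    by positivity, fun S δ hS hδ hSosc => (hC q S δ hS hδ hSosc).2⟩⟩
  exact isSkorokhodSolution_of_inner_nonneg ⟨a, ha⟩ hconv hopen
    (x := ⟨X, hXcad⟩) (k := ⟨k, fun t => ⟨hkc t, hkl t⟩⟩)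
    (fun t => by simp [hk]) hXK hkbv hk0 hμ hnm hn hn1 hin

end Existence

/-! ### Functions of locally bounded variation -/

theorem eVariationOn_add_le {α E : Type*} [LinearOrder α] [SeminormedAddCommGroup E]
    (f g : α → E) (s : Set α) :
    eVariationOn (fun t => f t + g t) s ≤ eVariationOn f s + eVariationOn g s := by
  refine iSup_le fun p => ?_
  calc ∑ i ∈ Finset.range p.1, edist (f (p.2.1 (i + 1)) + g (p.2.1 (i + 1)))
        (f (p.2.1 i) + g (p.2.1 i))
      ≤ ∑ i ∈ Finset.range p.1, (edist (f (p.2.1 (i + 1))) (f (p.2.1 i)) +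
          edist (g (p.2.1 (i + 1))) (g (p.2.1 i))) :=
        Finset.sum_le_sum fun i _ => edist_add_add_le _ _ _ _
    _ ≤ eVariationOn f s + eVariationOn g s := by
        rw [Finset.sum_add_distrib]
        exact add_le_add (eVariationOn.sum_le p.2.2.1 p.2.2.2)
          (eVariationOn.sum_le p.2.2.1 p.2.2.2)

theorem eVariationOn_coord_le {d : ℕ} (f : ℝ≥0 → EuclideanSpace ℝ (Fin d)) (i : Fin d)
    (s : Set ℝ≥0) : eVariationOn (fun t => f t i) s ≤ eVariationOn f s := by
  have h : LipschitzWith 1 fun v : EuclideanSpace ℝ (Fin d) => v i :=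
    LipschitzWith.of_dist_le_mul fun u v => by
      rw [NNReal.coe_one, one_mul, dist_eq_norm, dist_eq_norm]
      simpa using PiLp.norm_apply_le (u - v) i
  simpa [Function.comp_def] using
    (h.lipschitzOnWith (s := univ)).comp_eVariationOn_le (g := f) (s := s) fun _ _ => mem_univ _

theorem locallyBoundedVariationOn_of_Icc_zero {E : Type*} [PseudoEMetricSpace E] {f : ℝ≥0 → E}
    (h : ∀ q, eVariationOn f (Icc 0 q) ≠ ∞) : LocallyBoundedVariationOn f univ := fun _ t _ _ =>
  ne_top_of_le_ne_top (h t) (eVariationOn.mono f fun _ hu => ⟨zero_le, hu.2.2⟩)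

theorem eVariationOn_Iic_nat_ne_top {E : Type*} [PseudoMetricSpace E] (b : ℕ → E) (N : ℕ) :
    eVariationOn b (Iic N) ≠ ∞ := BoundedVariationOn.of_finite b _

theorem eVariationOn_comp_monotone_le {E : Type*} [PseudoEMetricSpace E] (b : ℕ → E)
    {φ : ℝ≥0 → ℕ} (hφ : Monotone φ) {q : ℝ≥0} {N : ℕ} (hN : φ q ≤ N) :
    eVariationOn (fun t => b (φ t)) (Icc 0 q) ≤ eVariationOn b (Iic N) :=
  eVariationOn.comp_le_of_monotoneOn b φ (hφ.monotoneOn _)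
    fun _ ht => (hφ ht.2).trans hN

/-- A function which depends only on the value of a monotone integer-valued function has locally
bounded variation. -/
theorem locallyBoundedVariationOn_of_factorsThrough {E : Type*} [PseudoMetricSpace E] [Nonempty E]
    {f : ℝ≥0 → E} {φ : ℝ≥0 → ℕ} (hφ : Monotone φ) (hf : Function.FactorsThrough f φ) :
    LocallyBoundedVariationOn f univ := by
  obtain ⟨b, rfl⟩ : ∃ b : ℕ → E, f = fun t => b (φ t) :=
    ⟨Function.extend φ f fun _ => Classical.arbitrary E, by
      ext1 t; rw [hf.extend_apply]⟩
  exact locallyBoundedVariationOn_of_Icc_zero fun q => ne_top_of_le_ne_top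
    (eVariationOn_Iic_nat_ne_top b (φ q)) (eVariationOn_comp_monotone_le b hφ le_rfl)

/-! ### Weak-* convergence of functions of locally bounded variation -/

/-- Decomposition `v = (|v 0| + W) - (|v 0| + W - v)` with `W` the variation function of `v`,
together with a bound on the masses. -/
theorem exists_isStieltjesPair {v : ℝ≥0 → ℝ} (hv : LocallyBoundedVariationOn v univ)
    (hc : ∀ t, ContinuousWithinAt v (Ici t) t) :
    ∃ μ ν : Measure ℝ≥0, IsStieltjesPair v μ ν ∧ ∀ t,
      μ.real (Icc 0 t) + ν.real (Icc 0 t) ≤ 3 * (|v 0| + (eVariationOn v (Icc 0 t)).toReal) := by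
  set W := variationOnFromTo v univ 0 with hW
  have hW0 : W 0 = 0 := variationOnFromTo.self v univ 0
  have hWc := continuousWithinAt_variationOnFromTo hv hc
  have hinc : ∀ s t, s ≤ t → |v t - v s| ≤ W t - W s := fun s t hst => by
    rw [← Real.dist_eq]; exact dist_le_variationOnFromTo hv hst
  have hWv : ∀ t, W t = (eVariationOn v (Icc 0 t)).toReal := fun t => by
    rw [hW, variationOnFromTo.eq_of_le _ _ zero_le, univ_inter]
  have hWm : Monotone W := fun s t hst => by linarith [hinc s t hst, abs_nonneg (v t - v s)]
  have hvb : ∀ t, |v t| ≤ |v 0| + W t := fun t => by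
    have h1 := hinc 0 t zero_le
    have h2 := abs_add_le (v t - v 0) (v 0)
    rw [sub_add_cancel] at h2
    linarith
  obtain ⟨μ, hμ, hμW⟩ := exists_measure_Icc_eq (F := fun t => |v 0| + W t)
    (fun s t hst => by simpa using hWm hst) (fun t => continuousWithinAt_const.add (hWc t))
    (by simp [hW0])
  obtain ⟨ν, hν, hνW⟩ := exists_measure_Icc_eq (F := fun t => |v 0| + W t - v t)
    (fun s t hst => by
      have := (le_abs_self _).trans (hinc s t hst)
      simp only; linarith)
    (fun t => (continuousWithinAt_const.add (hWc t)).sub (hc t))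
    (by simp [hW0, le_abs_self])
  have hμr : ∀ t, μ.real (Icc 0 t) = |v 0| + W t := fun t => by
    rw [Measure.real, hμW, ENNReal.toReal_ofReal ((abs_nonneg _).trans (hvb t))]
  have hνr : ∀ t, ν.real (Icc 0 t) = |v 0| + W t - v t := fun t => by
    rw [Measure.real, hνW, ENNReal.toReal_ofReal (by linarith [(abs_le.1 (hvb t)).2])]
  refine ⟨μ, ν, ⟨hμ, hν, fun t => ?_⟩, fun t => ?_⟩
  · rw [hμr, hνr]; ring
  · rw [hμr, hνr, ← hWv]
    linarith [(abs_le.1 (hvb t)).1]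

/-- Riemann–Stieltjes approximation of an integral. -/
theorem abs_setIntegral_sub_sum_le {μ : Measure ℝ≥0} (hμ : IsLocallyFiniteMeasure μ)
    {f : ℝ≥0 → ℝ} (hf : Continuous f) {t : ℕ → ℝ≥0} (ht : Monotone t) (ht0 : t 0 = 0) {ε : ℝ}
    (hosc : ∀ j, ∀ s ∈ Ioc (t j) (t (j + 1)), |f s - f (t (j + 1))| ≤ ε) (hε : 0 ≤ ε) (N : ℕ) :
    |∫ s in Icc 0 (t N), f s ∂μ - (f 0 * μ.real (Icc 0 0) + ∑ j ∈ Finset.range N,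
      f (t (j + 1)) * (μ.real (Icc 0 (t (j + 1))) - μ.real (Icc 0 (t j))))| ≤
      ε * μ.real (Icc 0 (t N)) := by
  have hfin : ∀ s, μ (Icc 0 s) ≠ ∞ := fun s => (measure_Icc_lt_top_of_isLocallyFinite hμ 0 s).ne
  have hint : ∀ s, IntegrableOn f (Icc 0 s) μ := fun s =>
    hf.continuousOn.integrableOn_compact isCompact_Icc
  induction N with
  | zero =>
    rw [ht0, Icc_self, Finset.sum_range_zero, add_zero, integral_singleton, smul_eq_mul,
      mul_comm, sub_self, abs_zero]
    positivity
  | succ N ih =>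
    have hU : Icc 0 (t (N + 1)) = Icc 0 (t N) ∪ Ioc (t N) (t (N + 1)) :=
      (Icc_union_Ioc_eq_Icc zero_le (ht N.le_succ)).symm
    have hsub := Ioc_subset_Icc_zero (t N) (t (N + 1))
    have hfin' : μ (Ioc (t N) (t (N + 1))) ≠ ∞ := measure_ne_top_of_subset hsub (hfin _)
    have e1 : ∫ s in Icc 0 (t (N + 1)), f s ∂μ =
        ∫ s in Icc 0 (t N), f s ∂μ + ∫ s in Ioc (t N) (t (N + 1)), f s ∂μ := by
      rw [hU, setIntegral_union (disjoint_Icc_zero_Ioc _ _) measurableSet_Ioc (hint _)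
        ((hint _).mono_set hsub)]
    have e2 : μ.real (Icc 0 (t (N + 1))) =
        μ.real (Icc 0 (t N)) + μ.real (Ioc (t N) (t (N + 1))) := by
      rw [hU, measureReal_union (disjoint_Icc_zero_Ioc _ _) measurableSet_Ioc (hfin _) hfin']
    have e3 : |∫ s in Ioc (t N) (t (N + 1)), f s ∂μ -
        f (t (N + 1)) * μ.real (Ioc (t N) (t (N + 1)))| ≤
        ε * μ.real (Ioc (t N) (t (N + 1))) := by
      have h1 : ∫ s in Ioc (t N) (t (N + 1)), (f s - f (t (N + 1))) ∂μ =
          ∫ s in Ioc (t N) (t (N + 1)), f s ∂μ -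
            f (t (N + 1)) * μ.real (Ioc (t N) (t (N + 1))) := by
        rw [integral_sub ((hint _).mono_set hsub) (integrableOn_const hfin'), setIntegral_const,
          smul_eq_mul, mul_comm]
      rw [← h1, ← Real.norm_eq_abs]
      exact norm_setIntegral_le_of_norm_le_const hfin'.lt_top fun s hs => hosc N s hs
    rw [Finset.sum_range_succ, e1, e2, add_sub_cancel_left]
    have := abs_add_le (∫ s in Icc 0 (t N), f s ∂μ - (f 0 * μ.real (Icc 0 0) +
      ∑ j ∈ Finset.range N, f (t (j + 1)) * (μ.real (Icc 0 (t (j + 1))) - μ.real (Icc 0 (t j)))))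
      (∫ s in Ioc (t N) (t (N + 1)), f s ∂μ - f (t (N + 1)) * μ.real (Ioc (t N) (t (N + 1))))
    rw [mul_add]
    refine le_trans (le_of_eq ?_) (this.trans (add_le_add ih e3))
    congr 1; ring

/-- Right-continuous functions with locally uniformly bounded variations which converge pointwise on
a dense set containing `0` converge weakly-*. -/
theorem weakStarTendsto_of_dense {vn : ℕ → ℝ≥0 → ℝ} {v : ℝ≥0 → ℝ}
    (hvn : ∀ n, LocallyBoundedVariationOn (vn n) univ)
    (hvnc : ∀ n t, ContinuousWithinAt (vn n) (Ici t) t)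
    (hv : LocallyBoundedVariationOn v univ) (hvc : ∀ t, ContinuousWithinAt v (Ici t) t)
    (hbd : ∀ q, ∃ C : ℝ≥0, ∀ᶠ n in atTop, eVariationOn (vn n) (Icc 0 q) ≤ C)
    {S : Set ℝ≥0} (hS : Dense S) (h0 : 0 ∈ S)
    (hlim : ∀ t ∈ S, Tendsto (fun n => vn n t) atTop (𝓝 (v t))) : WeakStarTendsto vn v := by
  choose μn νn hpn hmn using fun n => exists_isStieltjesPair (hvn n) (hvnc n)
  obtain ⟨μ, ν, hp, -⟩ := exists_isStieltjesPair hv hvc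
  refine ⟨μn, νn, μ, ν, hpn, hp, fun f => ?_⟩
  have hfc : Continuous f := f.continuous
  obtain ⟨q, hq⟩ : ∃ q : ℝ≥0, tsupport f ⊆ Icc 0 q := by
    obtain ⟨q, hq⟩ := f.hasCompactSupport.isCompact.bddAbove
    exact ⟨q, fun s hs => ⟨zero_le, hq hs⟩⟩
  -- eventual bound for the masses, including those of the limit
  obtain ⟨C₁, hC₁⟩ := hbd (q + 2)
  set C : ℝ := 3 * (|v 0| + 1 + C₁) + (μ.real (Icc 0 (q + 2)) + ν.real (Icc 0 (q + 2))) with hC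
  have hCpos : 0 < C := by positivity
  have hmass : ∀ᶠ n in atTop,
      (μn n).real (Icc 0 (q + 2)) + (νn n).real (Icc 0 (q + 2)) ≤ C := by
    have h2 : ∀ᶠ n in atTop, |vn n 0| < |v 0| + 1 :=
      (hlim 0 h0).abs.eventually (gt_mem_nhds (by linarith))
    filter_upwards [hC₁, h2] with n h1 h2
    have h3 : (eVariationOn (vn n) (Icc 0 (q + 2))).toReal ≤ C₁ :=
      ENNReal.toReal_le_coe_of_le_coe h1
    have : (0 : ℝ) ≤ μ.real (Icc 0 (q + 2)) + ν.real (Icc 0 (q + 2)) := by positivity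
    linarith [hmn n (q + 2)]
  rw [Metric.tendsto_atTop']
  intro ε hε
  set ε' := ε / (4 * C) with hε'
  have hε'pos : 0 < ε' := by positivity
  -- a grid of points of `S` on which `f` oscillates by at most `ε'`
  obtain ⟨η, hη, hfη⟩ := Metric.uniformContinuous_iff.1
    (f.hasCompactSupport.uniformContinuous_of_continuous hfc) ε' hε'pos
  obtain ⟨h, hh0, hh1, hhη⟩ : ∃ h : ℝ≥0, 0 < h ∧ h ≤ 1 ∧ 2 * (h : ℝ) ≤ η := by
    refine ⟨min 1 (η / 2).toNNReal, by simp [hη], min_le_left _ _, ?_⟩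
    have : ((min 1 (η / 2).toNNReal : ℝ≥0) : ℝ) ≤ ((η / 2).toNNReal : ℝ≥0) :=
      NNReal.coe_le_coe.2 (min_le_right _ _)
    rw [Real.coe_toNNReal _ (by positivity)] at this
    linarith
  have hpt : ∀ j : ℕ, ∃ s ∈ S, j * h < s ∧ s < (j + 1 : ℕ) * h := fun j => by
    obtain ⟨s, hs, hs'⟩ := hS.exists_between
      (show (j : ℝ≥0) * h < (j + 1 : ℕ) * h by gcongr; exact j.lt_succ_self)
    exact ⟨s, hs, hs'⟩
  choose p hpS hp1 hp2 using hpt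
  set t : ℕ → ℝ≥0 := fun j => Nat.casesOn j 0 p with ht
  have htS : ∀ j, t j ∈ S := fun j => by cases j with
    | zero => exact h0
    | succ j => exact hpS j
  have htm : Monotone t := monotone_nat_of_le_succ fun j => by cases j with
    | zero => exact zero_le
    | succ j => exact (hp2 j).le.trans (hp1 (j + 1)).le
  have hgap : ∀ j, (t (j + 1) : ℝ) - t j < η := fun j => by
    have h2 : (t (j + 1) : ℝ) < (j + 1 : ℕ) * h := by exact_mod_cast hp2 j
    have h1 : ((j : ℝ) - 1) * h ≤ t j := by cases j with
      | zero =>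
        have : (0 : ℝ) < h := hh0
        simp only [Nat.cast_zero, zero_sub, ht]; linarith
      | succ j =>
        have : (j : ℝ) * h < p j := by exact_mod_cast hp1 j
        simp only [Nat.cast_succ, add_sub_cancel_right]; exact this.le
    push_cast at h2
    linarith
  have hosc : ∀ j, ∀ s ∈ Ioc (t j) (t (j + 1)), |f s - f (t (j + 1))| ≤ ε' := fun j s hs => by
    refine (hfη ?_).le
    have h1 : (t j : ℝ) < s := hs.1
    have h2 : (s : ℝ) ≤ t (j + 1) := hs.2
    rw [dist_comm, NNReal.dist_eq, abs_of_nonneg (by linarith)]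
    linarith [hgap j]
  obtain ⟨N, hN, hN'⟩ : ∃ N, q ≤ t N ∧ t N ≤ q + 2 := by
    refine ⟨⌈q / h⌉₊ + 1, ?_, ?_⟩
    · refine le_trans ?_ (hp1 _).le
      rw [← div_le_iff₀ hh0]; exact Nat.le_ceil _
    · refine (hp2 _).le.trans ?_
      have : ((⌈q / h⌉₊ : ℝ≥0)) ≤ q / h + 1 := (Nat.ceil_lt_add_one zero_le).le
      calc ((⌈q / h⌉₊ + 1 : ℕ) : ℝ≥0) * h ≤ (q / h + 1 + 1) * h := by push_cast; gcongr
        _ = q + 2 * h := by field_simp; ring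
        _ ≤ q + 2 := by gcongr; simpa using mul_le_mul_right hh1 2
  set L : (ℝ≥0 → ℝ) → ℝ := fun w => f 0 * w 0 + ∑ j ∈ Finset.range N,
    f (t (j + 1)) * (w (t (j + 1)) - w (t j)) with hL
  have happ : ∀ (w : ℝ≥0 → ℝ) (ρ σ : Measure ℝ≥0), IsStieltjesPair w ρ σ →
      ρ.real (Icc 0 (q + 2)) + σ.real (Icc 0 (q + 2)) ≤ C →
      |(∫ s, f s ∂ρ - ∫ s, f s ∂σ) - L w| ≤ ε / 4 := by
    intro w ρ σ hw hm
    have hfull : ∀ τ : Measure ℝ≥0, ∫ s, f s ∂τ = ∫ s in Icc 0 (t N), f s ∂τ := fun τ => by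
      rw [setIntegral_eq_integral_of_forall_compl_eq_zero fun s hs => ?_]
      exact image_eq_zero_of_notMem_tsupport fun h' => hs ⟨zero_le, (hq h').2.trans hN⟩
    have a1 := abs_setIntegral_sub_sum_le hw.1 hfc htm rfl hosc hε'pos.le N
    have a2 := abs_setIntegral_sub_sum_le hw.2.1 hfc htm rfl hosc hε'pos.le N
    rw [← hfull] at a1 a2
    have hLw : L w = (f 0 * ρ.real (Icc 0 0) + ∑ j ∈ Finset.range N,
          f (t (j + 1)) * (ρ.real (Icc 0 (t (j + 1))) - ρ.real (Icc 0 (t j)))) -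
        (f 0 * σ.real (Icc 0 0) + ∑ j ∈ Finset.range N,
          f (t (j + 1)) * (σ.real (Icc 0 (t (j + 1))) - σ.real (Icc 0 (t j)))) := by
      rw [add_sub_add_comm, ← Finset.sum_sub_distrib, hL]
      simp only [hw.2.2]
      congr 1
      · ring
      · exact Finset.sum_congr rfl fun j _ => by ring
    have m1 : ρ.real (Icc 0 (t N)) ≤ ρ.real (Icc 0 (q + 2)) :=
      measureReal_mono (Icc_subset_Icc_right hN')
        (measure_Icc_lt_top_of_isLocallyFinite hw.1 _ _).ne
    have m2 : σ.real (Icc 0 (t N)) ≤ σ.real (Icc 0 (q + 2)) :=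
      measureReal_mono (Icc_subset_Icc_right hN')
        (measure_Icc_lt_top_of_isLocallyFinite hw.2.1 _ _).ne
    have m3 : ε' * (ρ.real (Icc 0 (t N)) + σ.real (Icc 0 (t N))) ≤ ε / 4 := by
      calc ε' * (ρ.real (Icc 0 (t N)) + σ.real (Icc 0 (t N))) ≤ ε' * C := by gcongr; linarith
        _ = ε / 4 := by rw [hε']; field_simp
    rw [hLw]
    rw [mul_add] at m3
    rw [abs_le] at a1 a2 ⊢
    constructor <;> linarith [a1.1, a1.2, a2.1, a2.2]
  have hLlim : Tendsto (fun n => L (vn n)) atTop (𝓝 (L v)) :=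
    ((hlim 0 h0).const_mul _).add (tendsto_finsetSum _ fun j _ =>
      (((hlim _ (htS (j + 1))).sub (hlim _ (htS j))).const_mul _))
  have hv0 := happ v μ ν hp (by rw [hC]; have : 0 ≤ |v 0| := abs_nonneg _; nlinarith [C₁.2])
  obtain ⟨n₀, hn₀⟩ := eventually_atTop.1 (hmass.and (hLlim.eventually
    (Metric.ball_mem_nhds _ (show 0 < ε / 4 by positivity))))
  refine ⟨n₀, fun n hn => ?_⟩
  obtain ⟨b1, b2⟩ := hn₀ n hn.le
  have b3 := happ (vn n) _ _ (hpn n) b1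
  rw [Real.dist_eq, abs_lt] at b2
  rw [abs_le] at b3 hv0
  rw [Real.dist_eq, abs_lt]
  constructor <;> linarith [b3.1, b3.2, hv0.1, hv0.2, b2.1, b2.2]

/-! ### Consequences of convergence in the Skorokhod topology -/

/-- A bound for all but finitely many members of a sequence of individually bounded objects. -/
theorem exists_forall_of_eventually {P : ℕ → ℝ → Prop} (hP : ∀ n, Monotone (P n))
    (h : ∃ C, ∀ᶠ n in atTop, P n C) (h' : ∀ n, ∃ C, P n C) : ∃ C, ∀ n, P n C := by
  obtain ⟨C, hC⟩ := h
  obtain ⟨N, hN⟩ := eventually_atTop.1 hC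
  choose c hc using h'
  have hs : 0 ≤ ∑ i ∈ Finset.range N, |c i| := Finset.sum_nonneg fun _ _ => abs_nonneg _
  refine ⟨|C| + ∑ i ∈ Finset.range N, |c i|, fun n => ?_⟩
  rcases le_or_gt N n with h | h
  · exact hP n (by linarith [le_abs_self C]) (hN n h)
  · refine hP n ?_ (hc n)
    have := Finset.single_le_sum (f := fun i => |c i|) (fun i _ => abs_nonneg (c i))
      (Finset.mem_range.2 h)
    linarith [le_abs_self (c n), abs_nonneg C]

section TimeChange
variable {lam : ℕ → (ℝ≥0 ≃o ℝ≥0)}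

theorem eventually_le_add_one
    (hlam : TendstoUniformly (fun (n : ℕ) (t : ℝ≥0) => lam n t) (fun t => t) atTop) :
    ∀ᶠ n in atTop, ∀ t, lam n t ≤ t + 1 ∧ t ≤ lam n t + 1 ∧ (lam n).symm t ≤ t + 1 := by
  filter_upwards [Metric.tendstoUniformly_iff.1 hlam 1 one_pos] with n hn
  have h : ∀ t, lam n t ≤ t + 1 ∧ t ≤ lam n t + 1 := fun t => by
    have h1 := hn t
    rw [NNReal.dist_eq, abs_lt] at h1
    constructor <;> rw [← NNReal.coe_le_coe] <;> push_cast <;> linarith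
  refine fun t => ⟨(h t).1, (h t).2, ?_⟩
  have h2 := (h ((lam n).symm t)).2
  rwa [OrderIso.apply_symm_apply] at h2

theorem tendsto_orderIso
    (hlam : TendstoUniformly (fun (n : ℕ) (t : ℝ≥0) => lam n t) (fun t => t) atTop) (t : ℝ≥0) :
    Tendsto (fun n => lam n t) atTop (𝓝 t) := hlam.tendsto_at t

theorem tendsto_orderIso_symm
    (hlam : TendstoUniformly (fun (n : ℕ) (t : ℝ≥0) => lam n t) (fun t => t) atTop) (t : ℝ≥0) :
    Tendsto (fun n => (lam n).symm t) atTop (𝓝 t) := by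
  rw [Metric.tendsto_nhds]
  intro ε hε
  filter_upwards [Metric.tendstoUniformly_iff.1 hlam ε hε] with n hn
  have := hn ((lam n).symm t)
  rwa [OrderIso.apply_symm_apply] at this

theorem tendsto_of_continuousAt {E : Type*} [PseudoMetricSpace E] {yn : ℕ → ℝ≥0 → E} {y : ℝ≥0 → E}
    (hlam : TendstoUniformly (fun (n : ℕ) (t : ℝ≥0) => lam n t) (fun t => t) atTop)
    (hy : ∀ q : ℝ≥0, TendstoUniformlyOn (fun (n : ℕ) (t : ℝ≥0) => yn n (lam n t)) y atTop (Iic q))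
    {t : ℝ≥0} (ht : ContinuousAt y t) : Tendsto (fun n => yn n t) atTop (𝓝 (y t)) := by
  rw [Metric.tendsto_nhds]
  intro ε hε
  filter_upwards [eventually_le_add_one hlam,
    Metric.tendstoUniformlyOn_iff.1 (hy (t + 1)) (ε / 2) (by positivity),
    Metric.tendsto_nhds.1 (ht.tendsto.comp (tendsto_orderIso_symm hlam t)) (ε / 2)
      (by positivity)] with n h1 h2 h3
  have h4 := h2 ((lam n).symm t) (h1 t).2.2
  rw [OrderIso.apply_symm_apply, dist_comm] at h4
  have := dist_triangle (yn n t) (y ((lam n).symm t)) (y t)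
  simp only [Function.comp_apply] at h3
  linarith

/-- `J₁`-convergent sequences are locally uniformly bounded. -/
theorem exists_uniform_bound {E : Type*} [SeminormedAddCommGroup E] {yn : ℕ → ℝ≥0 → E}
    {y : ℝ≥0 → E}
    (hlam : TendstoUniformly (fun (n : ℕ) (t : ℝ≥0) => lam n t) (fun t => t) atTop)
    (hy : ∀ q : ℝ≥0, TendstoUniformlyOn (fun (n : ℕ) (t : ℝ≥0) => yn n (lam n t)) y atTop (Iic q))
    (hyn : ∀ n, IsCadlag (yn n)) (hyc : IsCadlag y) (q : ℝ≥0) :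
    ∃ C, ∀ n, ∀ t ≤ q, ‖yn n t‖ ≤ C := by
  refine exists_forall_of_eventually (P := fun n C => ∀ t ≤ q, ‖yn n t‖ ≤ C)
    (fun n C C' hC h t ht => (h t ht).trans hC) ?_ fun n => ?_
  · obtain ⟨M, hM⟩ := hyc.exists_dist_le (q + 1)
    refine ⟨1 + M + ‖y 0‖, ?_⟩
    filter_upwards [eventually_le_add_one hlam,
      Metric.tendstoUniformlyOn_iff.1 (hy (q + 1)) 1 one_pos] with n h1 h2 t ht
    have h3 : (lam n).symm t ≤ q + 1 := (h1 t).2.2.trans (by gcongr)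
    have h4 := h2 _ h3
    rw [OrderIso.apply_symm_apply, dist_comm, dist_eq_norm] at h4
    have h5 := hM _ h3
    rw [dist_eq_norm] at h5
    have h6 := norm_add₃_le (a := yn n t - y ((lam n).symm t)) (b := y ((lam n).symm t) - y 0)
      (c := y 0)
    rw [show yn n t - y ((lam n).symm t) + (y ((lam n).symm t) - y 0) + y 0 = yn n t by abel] at h6
    linarith
  · obtain ⟨M, hM⟩ := (hyn n).exists_dist_le q
    refine ⟨M + ‖yn n 0‖, fun t ht => ?_⟩
    have h5 := hM t ht
    rw [dist_eq_norm] at h5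
    have h6 := norm_add_le (yn n t - yn n 0) (yn n 0)
    rw [sub_add_cancel] at h6
    linarith

end TimeChange

/-- A càdlàg function is continuous outside a countable set. -/
theorem IsCadlag.exists_countable_continuousAt {E : Type*} [PseudoMetricSpace E] {y : ℝ≥0 → E}
    (hy : IsCadlag y) : ∃ A : Set ℝ≥0, A.Countable ∧ ∀ t ∉ A, ContinuousAt y t := by
  choose T hT hosc using fun m : ℕ => hy.exists_grid (show (0 : ℝ) < 1 / (m + 1) by positivity)
  refine ⟨⋃ m, range (T m), countable_iUnion fun m => countable_range _, fun t ht => ?_⟩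
  simp only [mem_iUnion, mem_range, not_exists] at ht
  rw [Metric.continuousAt_iff']
  intro ε hε
  obtain ⟨m, hm⟩ := exists_nat_one_div_lt (half_pos hε)
  have hlt : T m (gridIndex (T m) t) < t := lt_of_le_of_ne ((hT m).index_le t) (ht m _)
  filter_upwards [lt_mem_nhds hlt, gt_mem_nhds ((hT m).lt_succ t)] with s h1 h2
  have h3 := hosc m s
  have h4 := hosc m t
  rw [(hT m).index_eq h1.le h2] at h3
  have := dist_triangle_right (y s) (y t) (y (T m (gridIndex (T m) t)))
  linarith

theorem dense_compl_of_countable {A : Set ℝ≥0} (hA : A.Countable) : Dense Aᶜ := by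
  rw [← biUnion_of_singleton A, compl_iUnion₂]
  exact dense_biInter_of_isOpen (fun t _ => isOpen_compl_singleton) hA
    fun t _ => dense_compl_singleton t

/-! ### Convergence of the penalized step paths -/

section PenalizedStep
variable {d : ℕ} {K : Set (EuclideanSpace ℝ (Fin d))}

theorem norm_relax_sub_le (n : ℕ) (z : EuclideanSpace ℝ (Fin d)) {τ : ℝ} (hτ : 0 ≤ τ) :
    ‖relax K n z τ - nearestPoint K z‖ ≤ ‖z - nearestPoint K z‖ := by
  rw [relax, add_sub_cancel_left, norm_smul, Real.norm_of_nonneg (Real.exp_pos _).le]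
  refine mul_le_of_le_one_left (norm_nonneg _) (Real.exp_le_one_iff.2 ?_)
  have : 0 ≤ n * τ := by positivity
  linarith

theorem tendsto_relax (hK : IsClosed K) (hne : K.Nonempty) (hc : Convex ℝ K)
    {z : ℕ → EuclideanSpace ℝ (Fin d)} {w : EuclideanSpace ℝ (Fin d)} {τ : ℕ → ℝ} {τ₀ : ℝ}
    (hz : Tendsto z atTop (𝓝 w)) (hτ : Tendsto τ atTop (𝓝 τ₀)) (hτ₀ : 0 < τ₀) :
    Tendsto (fun n => relax K n (z n) (τ n)) atTop (𝓝 (nearestPoint K w)) := by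
  have h1 : Tendsto (fun n => nearestPoint K (z n)) atTop (𝓝 (nearestPoint K w)) :=
    ((continuous_nearestPoint hK hne hc).tendsto w).comp hz
  have h2 : Tendsto (fun n : ℕ => Real.exp (-(n * τ n))) atTop (𝓝 0) :=
    Real.tendsto_exp_neg_atTop_nhds_zero.comp
      (tendsto_natCast_atTop_atTop.atTop_mul_pos hτ₀ hτ)
  simpa [relax] using h1.add (h2.smul (hz.sub h1))

/-- Limits of the values of the penalized step paths: the projection of the limit is the value of
the reflected step path. -/
theorem exists_tendsto_penalizedStepValue (hK : IsClosed K) (hne : K.Nonempty) (hc : Convex ℝ K)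
    {T : ℕ → ℝ≥0} (hT : IsGrid T) {S : ℕ → ℕ → ℝ≥0}
    (hST : ∀ j, Tendsto (fun n => S n j) atTop (𝓝 (T j)))
    {b : ℕ → EuclideanSpace ℝ (Fin d)} (hb : b 0 ∈ K) (j : ℕ) :
    ∃ w, Tendsto (fun n => penalizedStepValue K n (S n) b j) atTop (𝓝 w) ∧
      nearestPoint K w = skorokhodStepValue K b j ∧
      ∀ i, j = i + 1 → w = skorokhodStepValue K b i + (b (i + 1) - b i) := by
  induction j with
  | zero => exact ⟨b 0, tendsto_const_nhds, nearestPoint_of_mem hK hc hb, by simp⟩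
  | succ j ih =>
    obtain ⟨w, hw, hwc, -⟩ := ih
    refine ⟨skorokhodStepValue K b j + (b (j + 1) - b j), ?_, rfl, fun i hi => by
      obtain rfl : j = i := by omega
      rfl⟩
    have hτ : Tendsto (fun n => (S n (j + 1) : ℝ) - S n j) atTop (𝓝 ((T (j + 1) : ℝ) - T j)) :=
      (NNReal.tendsto_coe.2 (hST _)).sub (NNReal.tendsto_coe.2 (hST _))
    rw [← hwc]
    exact (tendsto_relax hK hne hc hw hτ
      (sub_pos.2 (NNReal.coe_lt_coe.2 (hT.strictMono j.lt_succ_self)))).add_const _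

/-- The penalized step paths on grids converging to `T` are, for large penalization, close to the
reflected step path on `T`; at a grid point up to the size of the jump there. -/
theorem eventually_norm_penalizedStep_sub_le (hK : IsClosed K) (hne : K.Nonempty)
    (hc : Convex ℝ K) {T : ℕ → ℝ≥0} (hT : IsGrid T) {S : ℕ → ℕ → ℝ≥0} (hS : ∀ n, IsGrid (S n))
    (hST : ∀ j, Tendsto (fun n => S n j) atTop (𝓝 (T j)))
    {b : ℕ → EuclideanSpace ℝ (Fin d)} (hb : b 0 ∈ K) (t : ℝ≥0) {δ : ℝ} (hδ : 0 < δ)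
    (hjump : ∀ i, t = T (i + 1) → ‖b (i + 1) - b i‖ ≤ δ) :
    ∀ᶠ n in atTop, ‖penalizedStep K n (S n) b t - skorokhodStepValue K b (gridIndex T t)‖ ≤
      2 * δ := by
  choose w hw hwc hws using exists_tendsto_penalizedStepValue hK hne hc hT hST hb
  have hτ : ∀ j, Tendsto (fun n => (t : ℝ) - S n j) atTop (𝓝 ((t : ℝ) - T j)) := fun j =>
    tendsto_const_nhds.sub (NNReal.tendsto_coe.2 (hST j))
  have hrel : ∀ j, T j < t → Tendsto (fun n => relax K n (penalizedStepValue K n (S n) b j)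
      ((t : ℝ) - S n j)) atTop (𝓝 (skorokhodStepValue K b j)) := fun j hj => by
    rw [← hwc]
    exact tendsto_relax hK hne hc (hw j) (hτ j) (sub_pos.2 (NNReal.coe_lt_coe.2 hj))
  have hnext : ∀ᶠ n in atTop, t < S n (gridIndex T t + 1) :=
    (hST _).eventually (lt_mem_nhds (hT.lt_succ t))
  rcases (hT.index_le t).lt_or_eq with hlt | heq
  · filter_upwards [hnext, (hST _).eventually (gt_mem_nhds hlt),
      Metric.tendsto_nhds.1 (hrel _ hlt) (2 * δ) (by positivity)] with n h1 h2 h3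
    rw [penalizedStep, (hS n).index_eq h2.le h1, ← dist_eq_norm]
    exact h3.le
  · rcases Nat.eq_zero_or_pos (gridIndex T t) with h0 | h0
    · have ht : t = 0 := by rw [← heq, h0, hT.zero]
      refine Eventually.of_forall fun n => ?_
      rw [penalizedStep, ht, (hS n).index_zero, hT.index_zero, (hS n).zero, sub_self, relax_zero]
      simp only [penalizedStepValue, skorokhodStepValue, sub_self, norm_zero]
      positivity
    · obtain ⟨i, hi⟩ := Nat.exists_eq_succ_of_ne_zero h0.ne'
      rw [Nat.succ_eq_add_one] at hi
      rw [hi] at hnext heq ⊢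
      have hJ := hjump i heq.symm
      have hlt : T i < t := heq ▸ hT.strictMono i.lt_succ_self
      have hwi := hws (i + 1) i rfl
      have hci := skorokhodStepValue_mem hK hb i
      -- consecutive values of the reflected step path differ by at most the jump
      have hcc : ‖skorokhodStepValue K b i - skorokhodStepValue K b (i + 1)‖ ≤ δ := by
        rw [← hwc (i + 1), ← nearestPoint_of_mem hK hc hci, norm_sub_rev]
        refine (norm_nearestPoint_sub_le hK hne hc _ _).trans ?_
        rw [hwi, add_sub_cancel_left]
        exact hJ
      have hww : ‖w (i + 1) - nearestPoint K (w (i + 1))‖ ≤ δ := by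
        rw [← dist_eq_norm, (nearestPoint_spec hK hne _).2]
        refine (Metric.infDist_le_dist_of_mem hci).trans ?_
        rw [dist_eq_norm, hwi, add_sub_cancel_left]
        exact hJ
      have hP : Tendsto (fun n => nearestPoint K (penalizedStepValue K n (S n) b (i + 1))) atTop
          (𝓝 (nearestPoint K (w (i + 1)))) :=
        ((continuous_nearestPoint hK hne hc).tendsto _).comp (hw (i + 1))
      have hres := ((hw (i + 1)).sub hP).norm.eventually
        (gt_mem_nhds (show ‖w (i + 1) - nearestPoint K (w (i + 1))‖ < δ + δ / 2 by linarith))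
      rw [hwc] at hP
      filter_upwards [hnext, (hST _).eventually (gt_mem_nhds hlt),
        Metric.tendsto_nhds.1 (hrel _ hlt) δ hδ, hres,
        Metric.tendsto_nhds.1 hP (δ / 2) (by positivity)] with n h1 h2 h3 h4 h5
      rw [dist_eq_norm] at h3 h5
      rcases lt_or_ge t (S n (i + 1)) with h6 | h6
      · rw [penalizedStep, (hS n).index_eq h2.le h6]
        have := norm_sub_le_norm_sub_add_norm_sub
          (relax K n (penalizedStepValue K n (S n) b i) ((t : ℝ) - S n i))
          (skorokhodStepValue K b i) (skorokhodStepValue K b (i + 1))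
        linarith
      · rw [penalizedStep, (hS n).index_eq h6 h1]
        have h7 := norm_relax_sub_le (K := K) n (penalizedStepValue K n (S n) b (i + 1))
          (sub_nonneg.2 (NNReal.coe_le_coe.2 h6))
        have := norm_sub_le_norm_sub_add_norm_sub
          (relax K n (penalizedStepValue K n (S n) b (i + 1)) ((t : ℝ) - S n (i + 1)))
          (nearestPoint K (penalizedStepValue K n (S n) b (i + 1)))
          (skorokhodStepValue K b (i + 1))
        linarith

end PenalizedStep

/-! ### Convergence of the penalized solutions -/

section Limit
variable {d : ℕ} {D : Set (EuclideanSpace ℝ (Fin d))}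

theorem IsCadlag.continuousAt_zero {E : Type*} [TopologicalSpace E] {y : ℝ≥0 → E}
    (hy : IsCadlag y) : ContinuousAt y 0 := by
  have h := (hy 0).1
  rwa [show Ici (0 : ℝ≥0) = univ from Ici_bot, continuousWithinAt_univ] at h

theorem penaltyTerm_zero (D : Set (EuclideanSpace ℝ (Fin d))) (n : ℕ)
    (x : ℝ≥0 → EuclideanSpace ℝ (Fin d)) : penaltyTerm D n x 0 = 0 := by simp [penaltyTerm]

/-- The penalization terms of all paths which, after a time change, are uniformly close to `y` have
a common bound for their variations, independent of the penalization parameter. -/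
theorem IsCadlag.exists_penalization_bound {y : ℝ≥0 → EuclideanSpace ℝ (Fin d)} (hy : IsCadlag y)
    (hne : D.Nonempty) (hconv : Convex ℝ D) (hopen : IsOpen D) (q : ℝ≥0) :
    ∃ Q ≥ q, ∃ r > (0 : ℝ), ∃ C ≥ (0 : ℝ), ∀ (lam : ℝ≥0 ≃o ℝ≥0) (n : ℕ)
      (x y' : ℝ≥0 → EuclideanSpace ℝ (Fin d)), (∀ t ≤ Q, ‖y' (lam t) - y t‖ ≤ r) →
      Measurable x →
      IntegrableOn (penaltyDensity (closure D) n x) (Icc 0 (lam Q)) halfLineVolume →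
      (∀ t, x t = y' t + penaltyTerm D n x t) →
      ∫ s in Icc 0 (lam Q), ‖penaltyDensity (closure D) n x s‖ ∂halfLineVolume ≤ C := by
  obtain ⟨a, ha⟩ := hne
  obtain ⟨r, hr, hb⟩ := Metric.nhds_basis_closedBall.mem_iff.1 (hopen.mem_nhds ha)
  obtain ⟨Q, hQ, C, hC⟩ := hy.exists_variation_bound (closure D) a hr (hb.trans subset_closure) q
  refine ⟨Q, hQ, r / 8, by positivity, max C 0, le_max_right _ _,
    fun lam n x y' hclose hxm hint hx => (hC lam halfLineVolume x y' _ hclose hint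
      (fun u _ => ?_) (fun u _ z hz => ?_) ?_).trans (le_max_left _ _)⟩
  · rw [← penaltyTerm_eq_setIntegral ⟨a, ha⟩ hconv n hxm, hx u]
  · exact inner_penaltyDensity_nonneg isClosed_closure ⟨a, subset_closure ha⟩ hconv.closure n x u hz
  · rw [hx 0, penaltyTerm_zero, add_zero]

variable {yn : ℕ → SkorokhodSpace d} {y : SkorokhodSpace d} {lam : ℕ → (ℝ≥0 ≃o ℝ≥0)}
  {xn : ℕ → SkorokhodSpace d}

theorem exists_integral_penaltyDensity_le
    (hne : D.Nonempty) (hconv : Convex ℝ D) (hopen : IsOpen D)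
    (hlam : TendstoUniformly (fun (n : ℕ) (t : ℝ≥0) => lam n t) (fun t => t) atTop)
    (hy : ∀ q : ℝ≥0, TendstoUniformlyOn (fun (n : ℕ) (t : ℝ≥0) => yn n (lam n t)) y atTop (Iic q))
    (hxn : ∀ n, IsPenalizedSolution D n (yn n) (xn n)) (q : ℝ≥0) :
    ∃ C : ℝ, ∀ n, ∫ s in Icc 0 q, ‖penaltyDensity (closure D) n (xn n) s‖ ∂halfLineVolume ≤ C := by
  refine exists_forall_of_eventually (P := fun n C =>
    ∫ s in Icc 0 q, ‖penaltyDensity (closure D) n (xn n) s‖ ∂halfLineVolume ≤ C)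
    (fun n C C' hC h => h.trans hC) ?_ fun n => ⟨_, le_rfl⟩
  obtain ⟨Q, hQ, r, hr, C, -, hC⟩ := y.isCadlag'.exists_penalization_bound hne hconv hopen (q + 1)
  refine ⟨C, ?_⟩
  filter_upwards [eventually_le_add_one hlam, Metric.tendstoUniformlyOn_iff.1 (hy Q) r hr]
    with n h1 h2
  have hint := integrableOn_penaltyDensity isClosed_closure hne.closure hconv.closure n
    (xn n).isCadlag' (lam n Q)
  have hq : q ≤ lam n Q := le_of_add_le_add_right (hQ.trans (h1 Q).2.1)
  refine (setIntegral_mono_set hint.norm (ae_of_all _ fun _ => norm_nonneg _)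
    (Icc_subset_Icc_right hq).eventuallyLE).trans
    (hC (lam n) n (xn n) (yn n) (fun t ht => ?_) (xn n).isCadlag'.measurable hint (hxn n))
  rw [← dist_eq_norm, dist_comm]
  exact (h2 t ht).le

theorem mem_closure_of_timeChange
    (hlam : TendstoUniformly (fun (n : ℕ) (t : ℝ≥0) => lam n t) (fun t => t) atTop)
    (hy : ∀ q : ℝ≥0, TendstoUniformlyOn (fun (n : ℕ) (t : ℝ≥0) => yn n (lam n t)) y atTop (Iic q))
    (hy0 : ∀ n, yn n 0 ∈ closure D) : y 0 ∈ closure D :=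
  isClosed_closure.mem_of_tendsto
    (tendsto_of_continuousAt hlam hy y.isCadlag'.continuousAt_zero) (Eventually.of_forall hy0)

/-- The penalized solutions converge at the continuity points of `y` to any path which is
approximated by the reflected step paths. -/
theorem tendsto_penalizedSolution
    (hne : D.Nonempty) (hconv : Convex ℝ D) (hopen : IsOpen D)
    (hlam : TendstoUniformly (fun (n : ℕ) (t : ℝ≥0) => lam n t) (fun t => t) atTop)
    (hy : ∀ q : ℝ≥0, TendstoUniformlyOn (fun (n : ℕ) (t : ℝ≥0) => yn n (lam n t)) y atTop (Iic q))
    (hy0 : y 0 ∈ closure D)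
    (hxn : ∀ n, IsPenalizedSolution D n (yn n) (xn n)) {x : SkorokhodSpace d}
    {t : ℝ≥0} (ht : ContinuousAt y t) {C δ₀ : ℝ} (hδ₀ : 0 < δ₀)
    (hx : ∀ (T : ℕ → ℝ≥0) (δ : ℝ), IsGrid T → δ ≤ δ₀ →
      (∀ s, dist (y s) (y (T (gridIndex T s))) ≤ δ) →
      ‖skorokhodStepValue (closure D) (fun j => y (T j)) (gridIndex T t) - x t‖ ^ 2 ≤
        δ ^ 2 + 8 * C * δ) :
    Tendsto (fun n => xn n t) atTop (𝓝 (x t)) := by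
  have hK : IsClosed (closure D) := isClosed_closure
  have hKne := hne.closure
  have hKc := hconv.closure
  set K := closure D
  obtain ⟨Q, hQ, r, hr, C', hC'0, hC'⟩ :=
    y.isCadlag'.exists_penalization_bound hne hconv hopen (t + 1)
  rw [Metric.tendsto_nhds]
  intro ε hε
  obtain ⟨δ, hδ, hδδ₀, hδr, hδε⟩ : ∃ δ : ℝ, 0 < δ ∧ δ ≤ δ₀ ∧ δ ≤ r ∧
      √((2 * δ) ^ 2 + 4 * (2 * δ) * (C' + C')) + 2 * δ + √(δ ^ 2 + 8 * C * δ) < ε := by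
    have hF : Tendsto (fun δ : ℝ => √((2 * δ) ^ 2 + 4 * (2 * δ) * (C' + C')) + 2 * δ +
        √(δ ^ 2 + 8 * C * δ)) (𝓝[>] 0) (𝓝 0) := by
      have : Continuous fun δ : ℝ => √((2 * δ) ^ 2 + 4 * (2 * δ) * (C' + C')) + 2 * δ +
        √(δ ^ 2 + 8 * C * δ) := by fun_prop
      simpa using (this.tendsto 0).mono_left nhdsWithin_le_nhds
    have hpos : ∀ᶠ δ : ℝ in 𝓝[>] 0, 0 < δ := self_mem_nhdsWithin
    have hlt : ∀ {c : ℝ}, 0 < c → ∀ᶠ δ : ℝ in 𝓝[>] 0, δ < c := fun hc =>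
      mem_nhdsWithin_of_mem_nhds (gt_mem_nhds hc)
    obtain ⟨δ, h1, h2, h3, h4⟩ := (hpos.and
      ((hlt hδ₀).and ((hlt hr).and (hF.eventually (gt_mem_nhds hε))))).exists
    exact ⟨δ, h1, h2.le, h3.le, h4⟩
  obtain ⟨T, hT, hosc⟩ := y.isCadlag'.exists_grid hδ
  set b : ℕ → EuclideanSpace ℝ (Fin d) := fun j => y (T j) with hb
  set S : ℕ → ℕ → ℝ≥0 := fun n j => lam n (T j) with hS
  have hSg : ∀ n, IsGrid (S n) := fun n => hT.comp_orderIso (lam n)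
  have hb0 : b 0 ∈ K := by
    change y (T 0) ∈ K; rw [hT.zero]; exact hy0
  -- at a continuity point of `y` on the grid the jump of the step path is at most `δ`
  have hjump : ∀ i, t = T (i + 1) → ‖b (i + 1) - b i‖ ≤ δ := fun i hi => by
    have hlt : T i < t := hi ▸ hT.strictMono i.lt_succ_self
    have h1 : Tendsto (fun s => ‖y s - b i‖) (𝓝[<] t) (𝓝 ‖y t - b i‖) :=
      ((ht.tendsto.mono_left nhdsWithin_le_nhds).sub_const _).norm
    have : (𝓝[<] t).NeBot := nhdsLT_neBot_of_exists_lt ⟨_, hlt⟩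
    rw [hb] at h1 ⊢
    simp only [← hi]
    refine le_of_tendsto h1 ?_
    filter_upwards [self_mem_nhdsWithin, mem_nhdsWithin_of_mem_nhds (lt_mem_nhds hlt)] with s h2 h3
    have h4 := hosc s
    rwa [hT.index_eq (j := i) h3.le (hi ▸ h2), dist_eq_norm] at h4
  filter_upwards [eventually_le_add_one hlam,
    Metric.tendstoUniformlyOn_iff.1 (hy Q) δ hδ,
    eventually_norm_penalizedStep_sub_le hK hKne hKc hT hSg
      (fun j => tendsto_orderIso hlam (T j)) hb0 t hδ hjump] with n h1 h2 h3
  have htq : t ≤ lam n Q := le_of_add_le_add_right (hQ.trans (h1 Q).2.1)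
  have hyn : ∀ s ≤ Q, ‖yn n (lam n s) - y s‖ ≤ δ := fun s hs => by
    rw [← dist_eq_norm, dist_comm]; exact (h2 s hs).le
  have hbs : ∀ s, ‖b (gridIndex (S n) (lam n s)) - y s‖ ≤ δ := fun s => by
    rw [hS, hT.index_comp_orderIso, ← dist_eq_norm, dist_comm]
    exact hosc s
  have hxm := (xn n).isCadlag'.measurable
  have hsm := measurable_penalizedStep K n (hSg n) b
  have i1 := integrableOn_penaltyDensity hK hKne hKc n (xn n).isCadlag' (lam n Q)
  have i2 := integrableOn_penaltyDensity_penalizedStep hK hKne hKc n (hSg n) b (lam n Q)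
  have v1 := hC' (lam n) n (xn n) (yn n) (fun s hs => (hyn s hs).trans hδr) hxm i1 (hxn n)
  have v2 := hC' (lam n) n (penalizedStep K n (S n) b) (fun s => b (gridIndex (S n) s))
    (fun s _ => (hbs s).trans hδr) hsm i2 (penalizedStep_eq hne hconv n (hSg n) b)
  have hcmp := norm_sub_sq_le_of_monotone (δ := 2 * δ) i1 i2
    (fun s _ => by rw [← penaltyTerm_eq_setIntegral hne hconv n hxm]; exact hxn n s)
    (fun s _ => by
      rw [← penaltyTerm_eq_setIntegral hne hconv n hsm]
      exact penalizedStep_eq hne hconv n (hSg n) b s)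
    (ae_of_all _ fun s => inner_penaltyDensity_sub_le hK hKne hKc n _ _ s)
    (fun u hu => by
      have h4 := hyn ((lam n).symm u) (by rwa [OrderIso.symm_apply_le])
      have h5 := hbs ((lam n).symm u)
      rw [OrderIso.apply_symm_apply] at h4 h5
      rw [norm_sub_rev] at h5
      have := norm_sub_le_norm_sub_add_norm_sub (yn n u) (y ((lam n).symm u))
        (b (gridIndex (S n) u))
      linarith) htq
  have e1 : ‖xn n t - penalizedStep K n (S n) b t‖ ≤
      √((2 * δ) ^ 2 + 4 * (2 * δ) * (C' + C')) :=
    Real.le_sqrt_of_sq_le (hcmp.trans (by gcongr))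
  have e2 := Real.le_sqrt_of_sq_le (hx T δ hT hδδ₀ hosc)
  rw [dist_eq_norm]
  have e3 := norm_sub_le_norm_sub_add_norm_sub (xn n t) (penalizedStep K n (S n) b t) (x t)
  have e4 := norm_sub_le_norm_sub_add_norm_sub (penalizedStep K n (S n) b t)
    (skorokhodStepValue K b (gridIndex T t)) (x t)
  linarith

end Limit

/-! ### Convergence in the `S` topology -/

/-- `J₁`-convergent paths are uniformly approximated by step paths with locally uniformly bounded
variations which converge pointwise outside a countable set. -/
theorem exists_locallyBoundedVariationOn_approx {E : Type*} [NormedAddCommGroup E]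
    {yn : ℕ → ℝ≥0 → E} {y : ℝ≥0 → E} {lam : ℕ → (ℝ≥0 ≃o ℝ≥0)}
    (hyn : ∀ n, IsCadlag (yn n)) (hyc : IsCadlag y)
    (hlam : TendstoUniformly (fun (n : ℕ) (t : ℝ≥0) => lam n t) (fun t => t) atTop)
    (hy : ∀ q : ℝ≥0, TendstoUniformlyOn (fun (n : ℕ) (t : ℝ≥0) => yn n (lam n t)) y atTop (Iic q))
    {ε : ℝ} (hε : 0 < ε) :
    ∃ (Yn : ℕ → ℝ≥0 → E) (Y : ℝ≥0 → E), (∀ n t, ‖yn n t - Yn n t‖ ≤ ε) ∧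
      (∀ t, ‖y t - Y t‖ ≤ ε) ∧
      (∀ n, LocallyBoundedVariationOn (Yn n) univ) ∧ LocallyBoundedVariationOn Y univ ∧
      (∀ n t, ContinuousWithinAt (Yn n) (Ici t) t) ∧ (∀ t, ContinuousWithinAt Y (Ici t) t) ∧
      (∀ q, ∃ C : ℝ≥0, ∀ᶠ n in atTop, eVariationOn (Yn n) (Icc 0 q) ≤ C) ∧
      ∃ A : Set ℝ≥0, A.Countable ∧ 0 ∉ A ∧
        ∀ t ∉ A, Tendsto (fun n => Yn n t) atTop (𝓝 (Y t)) := by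
  classical
  obtain ⟨T, hT, hosc⟩ := hyc.exists_grid (half_pos hε)
  choose G hG hGosc using fun n => (hyn n).exists_grid hε
  set b : ℕ → E := fun j => y (T j) with hb
  set S : ℕ → ℕ → ℝ≥0 := fun n j => lam n (T j) with hS
  have hSg : ∀ n, IsGrid (S n) := fun n => hT.comp_orderIso (lam n)
  have hSidx : ∀ n t, gridIndex (S n) t = gridIndex T ((lam n).symm t) := fun n t => by
    rw [← hT.index_comp_orderIso (lam n), OrderIso.apply_symm_apply]
  -- `p n t`: the time change of `y` is still close to `yn n` slightly after `t`; from the first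
  -- time where this fails, `yn n` is approximated by its own steps
  set p : ℕ → ℝ≥0 → Prop := fun n t =>
    ∃ u, t < u ∧ ∀ s ≤ u, ‖yn n s - y ((lam n).symm s)‖ ≤ ε / 2 with hp
  have hpanti : ∀ n s t, s ≤ t → p n t → p n s := fun n s t hst ⟨u, hu, h⟩ =>
    ⟨u, hst.trans_lt hu, h⟩
  have hpev : ∀ q, ∀ᶠ n in atTop, p n q := fun q => by
    filter_upwards [eventually_le_add_one hlam,
      Metric.tendstoUniformlyOn_iff.1 (hy (q + 1 + 1)) (ε / 2) (half_pos hε)] with n h1 h2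
    refine ⟨q + 1, lt_add_one q, fun s hs => ?_⟩
    have h3 := h2 ((lam n).symm s) ((h1 s).2.2.trans (by gcongr))
    rw [OrderIso.apply_symm_apply, dist_comm, dist_eq_norm] at h3
    exact h3.le
  set Y : ℝ≥0 → E := fun t => b (gridIndex T t) with hY
  set Yn : ℕ → ℝ≥0 → E := fun n t =>
    if p n t then b (gridIndex (S n) t) else yn n (G n (gridIndex (G n) t)) with hYn
  -- all three summands are monotone, so their sum determines each of them
  set φ : ℕ → ℝ≥0 → ℕ := fun n t =>
    gridIndex (S n) t + gridIndex (G n) t + if p n t then 0 else 1 with hφ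
  have hpm : ∀ n, Monotone fun t => if p n t then 0 else 1 := fun n s t hst => by
    have := hpanti n s t hst
    clear_value p
    by_cases h : p n t
    · simp [h, this h]
    · by_cases h' : p n s <;> simp [h, h']
  have hφm : ∀ n, Monotone (φ n) := fun n =>
    ((hSg n).monotone_index.add (hG n).monotone_index).add (hpm n)
  have hfac : ∀ n, Function.FactorsThrough (Yn n) (φ n) := fun n => by
    have key : ∀ s t, s ≤ t → φ n s = φ n t → Yn n s = Yn n t := fun s t hst h => by
      have h1 := (hSg n).monotone_index hst
      have h2 := (hG n).monotone_index hst
      have h3 := hpm n hst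
      simp only [hφ] at h h3
      have e1 : gridIndex (S n) s = gridIndex (S n) t := by omega
      have e2 : gridIndex (G n) s = gridIndex (G n) t := by omega
      have e3 : (if p n s then 0 else 1 : ℕ) = if p n t then 0 else 1 := by omega
      have e4 : p n s ↔ p n t := by
        clear_value p
        by_cases hs : p n s <;> by_cases ht : p n t <;> simp [hs, ht] at e3 ⊢
      simp only [hYn, e1, e2, e4]
    intro s t h
    rcases le_total s t with hst | hst
    · exact key s t hst h
    · exact (key t s hst h.symm).symm
  have hφr : ∀ n t, ∀ᶠ s in 𝓝[≥] t, φ n s = φ n t := fun n t => by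
    have h3 : ∀ᶠ s in 𝓝[≥] t, (p n s ↔ p n t) := by
      by_cases h : p n t
      · obtain ⟨u, hu, hu'⟩ := h
        filter_upwards [mem_nhdsWithin_of_mem_nhds (gt_mem_nhds hu)] with s hs
        exact ⟨fun _ => ⟨u, hu, hu'⟩, fun _ => ⟨u, hs, hu'⟩⟩
      · filter_upwards [self_mem_nhdsWithin] with s hs
        exact ⟨fun hps => hpanti n t s hs hps, fun hpt => (h hpt).elim⟩
    filter_upwards [(hSg n).eventually_index_eq t, (hG n).eventually_index_eq t, h3]
      with s h1 h2 h3
    simp only [hφ, h1, h2, h3]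
  refine ⟨Yn, Y, fun n t => ?_, fun t => ?_,
    fun n => locallyBoundedVariationOn_of_factorsThrough (hφm n) (hfac n),
    locallyBoundedVariationOn_of_factorsThrough hT.monotone_index fun s t h => by
      simp only [hY, h],
    fun n t => tendsto_const_nhds.congr' ((hφr n t).mono fun s hs => (hfac n hs).symm),
    fun t => hT.continuousWithinAt_comp_index b t, fun q => ?_, range T \ {0},
    (countable_range T).mono sdiff_subset, by simp, fun t ht => ?_⟩
  · by_cases h : p n t
    · obtain ⟨u, hu, hu'⟩ := h
      have h1 := hu' t hu.le
      have h2 := hosc ((lam n).symm t)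
      rw [dist_eq_norm, ← hSidx] at h2
      simp only [hYn, if_pos (show p n t from ⟨u, hu, hu'⟩)]
      have := norm_sub_le_norm_sub_add_norm_sub (yn n t) (y ((lam n).symm t))
        (b (gridIndex (S n) t))
      linarith
    · simp only [hYn, if_neg h]
      rw [← dist_eq_norm]
      exact hGosc n t
  · rw [← dist_eq_norm]
    exact (hosc t).trans (by linarith)
  · have hfin := eVariationOn_Iic_nat_ne_top b (gridIndex T (q + 1))
    refine ⟨(eVariationOn b (Iic (gridIndex T (q + 1)))).toNNReal, ?_⟩
    rw [ENNReal.coe_toNNReal hfin]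
    filter_upwards [hpev q, eventually_le_add_one hlam] with n h1 h2
    rw [eVariationOn.congr (g := fun t => b (gridIndex (S n) t)) fun t ht => by
      simp only [hYn, if_pos (hpanti n t q ht.2 h1)]]
    refine eVariationOn_comp_monotone_le b (hSg n).monotone_index ?_
    rw [hSidx]
    exact hT.monotone_index (h2 q).2.2
  · have hidx : ∀ᶠ n in atTop, gridIndex (S n) t = gridIndex T t := by
      rcases eq_or_ne t 0 with rfl | h0
      · exact Eventually.of_forall fun n => by rw [(hSg n).index_zero, hT.index_zero]
      · have hlt : T (gridIndex T t) < t := lt_of_le_of_ne (hT.index_le t) fun h =>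
          ht ⟨⟨_, h⟩, h0⟩
        filter_upwards [(tendsto_orderIso hlam (T (gridIndex T t))).eventually (gt_mem_nhds hlt),
          (tendsto_orderIso hlam (T (gridIndex T t + 1))).eventually
            (lt_mem_nhds (hT.lt_succ t))] with n h1 h2
        exact (hSg n).index_eq (le_of_lt h1) h2
    refine tendsto_const_nhds.congr' ?_
    filter_upwards [hidx, hpev t] with n h1 h2
    simp only [hYn, if_pos h2, h1, hY]

/-- If the free parts converge in `J₁`, the reflection terms have locally uniformly bounded
variations and the sums converge at the continuity points of `y`, then the sums satisfy the
condition generating the `S` topology. -/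
theorem sGeneratingTendsto_of_continuousAt {yn xn : ℕ → SkorokhodSpace d} {y x k : SkorokhodSpace d}
    {lam : ℕ → (ℝ≥0 ≃o ℝ≥0)} {kn : ℕ → ℝ≥0 → EuclideanSpace ℝ (Fin d)}
    (hlam : TendstoUniformly (fun (n : ℕ) (t : ℝ≥0) => lam n t) (fun t => t) atTop)
    (hy : ∀ q : ℝ≥0, TendstoUniformlyOn (fun (n : ℕ) (t : ℝ≥0) => yn n (lam n t)) y atTop (Iic q))
    (hxn : ∀ n t, xn n t = yn n t + kn n t) (hx : ∀ t, x t = y t + k t)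
    (hkn : ∀ q, ∃ C : ℝ≥0, ∀ n, eVariationOn (kn n) (Icc 0 q) ≤ C)
    (hk : LocallyBoundedVariationOn k univ)
    (hlim : ∀ t, ContinuousAt y t → Tendsto (fun n => xn n t) atTop (𝓝 (x t))) :
    SGeneratingTendsto xn x := by
  intro ε hε
  obtain ⟨Yn, Y, hYn, hY, hYnv, hYv, hYnc, hYc, hbd, A, hA, hA0, hYlim⟩ :=
    exists_locallyBoundedVariationOn_approx (fun n => (yn n).isCadlag') y.isCadlag' hlam hy hε
  obtain ⟨B, hB, hBc⟩ := y.isCadlag'.exists_countable_continuousAt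
  have hknc : ∀ n t, ContinuousWithinAt (kn n) (Ici t) t := fun n t => by
    rw [show kn n = fun s => xn n s - yn n s from funext fun s => by rw [hxn]; abel]
    exact ((xn n).isCadlag' t).1.sub ((yn n).isCadlag' t).1
  have hcoord : ∀ (u v : ℝ≥0 → EuclideanSpace ℝ (Fin d)) (i : Fin d) (q : ℝ≥0),
      eVariationOn (fun t => (u t + v t) i) (Icc 0 q) ≤
        eVariationOn u (Icc 0 q) + eVariationOn v (Icc 0 q) := fun u v i q =>
    (eVariationOn_coord_le _ i _).trans (eVariationOn_add_le _ _ _)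
  have hfin : ∀ u : ℝ≥0 → EuclideanSpace ℝ (Fin d), LocallyBoundedVariationOn u univ →
      ∀ q, eVariationOn u (Icc 0 q) ≠ ∞ := fun u hu q => by
    have := hu 0 q (mem_univ _) (mem_univ _)
    rwa [univ_inter] at this
  have hknfin : ∀ n q, eVariationOn (kn n) (Icc 0 q) ≠ ∞ := fun n q => by
    obtain ⟨C, hC⟩ := hkn q
    exact ne_top_of_le_ne_top ENNReal.coe_ne_top (hC n)
  have hcont : ∀ {u v : ℝ≥0 → EuclideanSpace ℝ (Fin d)} {t : ℝ≥0} (i : Fin d),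
      ContinuousWithinAt u (Ici t) t → ContinuousWithinAt v (Ici t) t →
      ContinuousWithinAt (fun t => (u t + v t) i) (Ici t) t := fun i hu hv =>
    (EuclideanSpace.proj (𝕜 := ℝ) i).continuous.continuousAt.comp_continuousWithinAt (hu.add hv)
  refine ⟨fun n t => Yn n t + kn n t, fun t => Y t + k t, fun n t => ?_, fun t => ?_, fun i =>
    weakStarTendsto_of_dense (S := (A ∪ (B \ {0}))ᶜ) (fun n => ?_) (fun n t => ?_) ?_ (fun t => ?_)
      (fun q => ?_) (dense_compl_of_countable (hA.union (hB.mono sdiff_subset))) (by simp [hA0])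
      fun t ht => ?_⟩
  · rw [hxn, add_sub_add_right_eq_sub]; exact hYn n t
  · rw [hx, add_sub_add_right_eq_sub]; exact hY t
  · exact locallyBoundedVariationOn_of_Icc_zero fun q => ne_top_of_le_ne_top
      (ENNReal.add_ne_top.2 ⟨hfin _ (hYnv n) q, hknfin n q⟩) (hcoord _ _ i q)
  · exact hcont i (hYnc n t) (hknc n t)
  · exact locallyBoundedVariationOn_of_Icc_zero fun q => ne_top_of_le_ne_top
      (ENNReal.add_ne_top.2 ⟨hfin _ hYv q, hfin _ hk q⟩) (hcoord _ _ i q)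
  · exact hcont i (hYc t) (k.isCadlag' t).1
  · obtain ⟨C, hC⟩ := hbd q
    obtain ⟨C', hC'⟩ := hkn q
    refine ⟨C + C', hC.mono fun n hn => (hcoord _ _ i q).trans ?_⟩
    rw [ENNReal.coe_add]
    exact add_le_add hn (hC' n)
  · simp only [mem_compl_iff, mem_union, Set.mem_sdiff, mem_singleton_iff, not_or, not_and,
      not_not] at ht
    have hyt : ContinuousAt y t := by
      by_cases h : t ∈ B
      · rw [ht.2 h]; exact y.isCadlag'.continuousAt_zero
      · exact hBc t h
    have h1 : Tendsto (fun n => kn n t) atTop (𝓝 (k t)) := by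
      have := (hlim t hyt).sub (tendsto_of_continuousAt hlam hy hyt)
      simpa [hxn, hx] using this
    exact ((EuclideanSpace.proj (𝕜 := ℝ) i).continuous.tendsto _).comp ((hYlim t ht.1).add h1)

theorem SGeneratingTendsto.tendsto {xn : ℕ → SkorokhodSpace d} {x : SkorokhodSpace d}
    (h : SGeneratingTendsto xn x) :
    Tendsto xn atTop (@nhds (SkorokhodSpace d) (sTopology d) x) := by
  let _ : TopologicalSpace (SkorokhodSpace d) := sTopology d
  intro U hU
  obtain ⟨V, hVU, hV, hxV⟩ := mem_nhds_iff.1 hU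
  exact (hV xn x h hxV).mono fun n hn => hVU hn

theorem theorem2p3 {d : ℕ} (D : Set (EuclideanSpace ℝ (Fin d)))
    (hne : D.Nonempty) (hconv : Convex ℝ D) (hopen : IsOpen D)
    (yn : ℕ → SkorokhodSpace d) (y : SkorokhodSpace d)
    (hy0 : ∀ n, yn n 0 ∈ closure D)
    (hJ : J1Tendsto yn y)
    (xn : ℕ → SkorokhodSpace d)
    (hxn : ∀ n, IsPenalizedSolution D n (yn n) (xn n)) :
    (∀ q : ℝ≥0, ∃ C : ℝ, ∀ n, ∀ t ≤ q, ‖xn n t‖ ≤ C) ∧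
    (∀ q : ℝ≥0, ∃ C : ℝ≥0, ∀ n, variationUpTo (penaltyTerm D n (xn n)) q ≤ C) ∧
    ∃ x k : SkorokhodSpace d,
      IsSkorokhodSolution D y x k ∧
      (∀ x' k' : SkorokhodSpace d, IsSkorokhodSolution D y x' k' → x' = x ∧ k' = k) ∧
      (∀ t : ℝ≥0, ContinuousAt y t → Tendsto (fun n => xn n t) atTop (𝓝 (x t))) ∧
      Tendsto xn atTop (@nhds (SkorokhodSpace d) (sTopology d) x) := by
  obtain ⟨lam, hlam, hy⟩ := hJ
  have hk : ∀ n t, penaltyTerm D n (xn n) t =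
      ∫ s in Icc 0 t, penaltyDensity (closure D) n (xn n) s ∂halfLineVolume := fun n t =>
    penaltyTerm_eq_setIntegral hne hconv n (xn n).isCadlag'.measurable t
  have hint : ∀ n q, IntegrableOn (penaltyDensity (closure D) n (xn n)) (Icc 0 q)
      halfLineVolume := fun n q =>
    integrableOn_penaltyDensity isClosed_closure hne.closure hconv.closure n (xn n).isCadlag' q
  have hbound := exists_integral_penaltyDensity_le hne hconv hopen hlam hy hxn
  have hvar : ∀ q : ℝ≥0, ∃ C : ℝ≥0, ∀ n, variationUpTo (penaltyTerm D n (xn n)) q ≤ C :=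
    fun q => by
      obtain ⟨C, hC⟩ := hbound q
      refine ⟨C.toNNReal, fun n => (eVariationOn_le_integral_norm (hint n q)
        fun t _ => hk n t).trans ?_⟩
      exact ENNReal.ofReal_le_ofReal (hC n)
  refine ⟨fun q => ?_, hvar, ?_⟩
  · obtain ⟨M, hM⟩ := exists_uniform_bound hlam hy (fun n => (yn n).isCadlag') y.isCadlag' q
    obtain ⟨C, hC⟩ := hbound q
    refine ⟨M + C, fun n t ht => ?_⟩
    rw [hxn n t, hk]
    refine (norm_add_le _ _).trans (add_le_add (hM n t ht) ((norm_integral_le_integral_norm _).trans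
      (le_trans ?_ (hC n))))
    exact setIntegral_mono_set (hint n q).norm (ae_of_all _ fun _ => norm_nonneg _)
      (Icc_subset_Icc_right ht).eventuallyLE
  · have hy0' := mem_closure_of_timeChange hlam hy hy0
    obtain ⟨x, k, hsol, happ⟩ := exists_skorokhodSolution hne hconv hopen y hy0'
    have hlim : ∀ t : ℝ≥0, ContinuousAt y t → Tendsto (fun n => xn n t) atTop (𝓝 (x t)) :=
      fun t ht => by
        obtain ⟨C, δ₀, -, hδ₀, hx⟩ := happ t
        exact tendsto_penalizedSolution hne hconv hopen hlam hy hy0' hxn ht hδ₀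
          fun T δ hT hδ hosc => hx T δ hT hδ hosc t le_rfl
    exact ⟨x, k, hsol, fun x' k' h' => hsol.unique h', hlim,
      (sGeneratingTendsto_of_continuousAt hlam hy hxn hsol.1 hvar hsol.2.2.1 hlim).tendsto⟩
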